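/- Let $d\ge 1$ and let $0\le a\in L^1(\mathbb{R}^d)$ have total mass $a^{(0)}=\int a(x)\,dx>0$ and all moments finite, i.e. $\int |x|^n a(x)\,dx<\infty$ for all $n\in\mathbb{N}$. Put $a^{(1)}=\int x\,a(x)\,dx\in\mathbb{R}^d$ and $a^{(2)}_{ij}=\int x_ix_j\,a(x)\,dx$, and let $p,q$ be the even and the odd part of $a$. Let $\Gamma$ be the space of locally finite subsets $\gamma$ of $\mathbb{R}^d$, with the Borel $\sigma$-algebra of the vague topology, $\gamma$ being identified with $\sum_{x\in\gamma}\delta_x$; let $\Theta\subset\Gamma$ be the set of all $\gamma$ for which there is $m\in\mathbb{N}$ with $|\gamma\cap B(n)|\le m\,\mathrm{vol}(B(n))$ for all integers $n\ge1$, where $B(n)$ is the closed ball of radius $n$ centered at $0$. The free Kawasaki process $\mathbf{X}$ with kernel $a$ started in $\gamma$ (expectation $\mathbf{E}_\gamma$) is $\mathbf{X}_t=\sum_{x\in\gamma}\delta_{X^x_t}$, where the $X^x$, $x\in\gamma$, are independent jump processes, $X^x$ starting in $x$, with exponential waiting times of rate $a^{(0)}$ and jumps from $y$ to $y'$ with density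 $a(y-y')/a^{(0)}$ in $y'$. For $\kappa\in\{1,2\}$, $\varepsilon>0$, let $$n^{(\varepsilon)}_t(\varphi,\mathbf{X})=\varepsilon^d\langle\varphi(\varepsilon\,\cdot),\mathbf{X}_{\varepsilon^{-\kappa}t}\rangle .$$ Let $(\mu_\varepsilon)_{\varepsilon>0}$ be probability measures on $\Theta$ that have a first correlation function $\rho_{\mu_\varepsilon}(x)=k_{\mu_\varepsilon}(\{x\})$ and a second correlation function $k_{\mu_\varepsilon}(\{x,y\})$, and let $u^{(2)}_{\mu_\varepsilon}(x,y)=k_{\mu_\varepsilon}(\{x,y\})-\rho_{\mu_\varepsilon}(x)\rho_{\mu_\varepsilon}(y)$. Suppose that $\sup_{\varepsilon>0,\,x}\rho_{\mu_\varepsilon}(x)<\infty$, that the limit $\rho_0(x)=\lim_{\varepsilon\to0^+}\rho_{\mu_\varepsilon}(x/\varepsilon)$ exists for every $x\in\mathbb{R}^d$, and that $$\sup_{x\in\mathbb{R}^d,\ \varepsilon>0}\int_{\mathbb{R}^d}|u^{(2)}_{\mu_\varepsilon}(x,y)|\,dy<\infty .$$ Then, in each of the three cases below, there is a function $\rho_t(x)$,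 $t\ge0$, $x\in\mathbb{R}^d$, such that for all $t\ge0$ and all non-negative $\varphi\in C_c^\infty(\mathbb{R}^d)$ $$\lim_{\varepsilon\to0^+}\int\mu_\varepsilon(d\gamma)\,\mathbf{E}_\gamma\Big[e^{-n^{(\varepsilon)}_t(\varphi,\mathbf{X})}\Big]=e^{-\int\varphi(x)\rho_t(x)\,dx},$$ the right-hand side being the Laplace transform of the Dirac measure $\delta_{\rho_t}$ on the space of distributions, and $\rho$ is the unique (up to null sets for each $t$) bounded measurable weak solution of the stated equation with initial condition $\rho_0$: 1. if $a^{(1)}\ne0$ and $\kappa=1$: the transport equation $\partial_t\rho_t=\mathrm{div}(a^{(1)}\rho_t)$; if $\rho_0$ is continuously differentiable, $\rho$ can be chosen as a strong solution; 2. if $a^{(1)}=0$ and $\kappa=2$: the heat equation $\partial_t\rho_t=\frac12\sum_{i,j}a^{(2)}_{ij}\,\partial_{x_i}\partial_{x_j}\rho_t$, and $\rho$ can be chosen as a strong solution; 3. if $q^{(1)}=\int x\,q(x)\,dx=a^{(1)}\ne0$, $\kappa=2$, and the process for each $\varepsilon$ is the one with kernel $a_\varepsilon=p+\varepsilon q$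 (non-negative for $\varepsilon\le1$): the equation $\partial_t\rho_t=\mathrm{div}(a^{(1)}\rho_t)+\frac12\sum_{i,j}a^{(2)}_{ij}\,\partial_{x_i}\partial_{x_j}\rho_t$, and $\rho$ can be chosen as a strong solution. Here a weak solution satisfies the equation integrated over time and tested against $C_c^\infty(\mathbb{R}^d)$. A strong solution satisfies it pointwise for $t>0$, with $\rho_t\in C^1$ (case 1) or $\rho_t\in C^2$ (cases 2, 3) in $x$, equals $\rho_0$ at $t=0$, and converges to $\rho_0(x)$ at $(0,x)$ whenever $\rho_0$ is continuous at $x$. -/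

import Mathlib

open MeasureTheory ProbabilityTheory Filter Topology Set
open scoped ENNReal NNReal ContDiff

namespace FreeKawasaki

/-! ### Configurations and correlation functions -/

/-- The space `ℝᵈ` with its Euclidean norm. -/
abbrev Space (d : ℕ) : Type := EuclideanSpace ℝ (Fin d)

/-- The configuration space `Γ`: all locally finite subsets of `ℝᵈ`. -/
def Configuration (d : ℕ) : Type :=
  {γ : Set (Space d) // ∀ K : Set (Space d), IsCompact K → (γ ∩ K).Finite}

/-- The Radon measure `∑_{x ∈ γ} δ_x` with which a configuration `γ` is identified. -/
noncomputable def Configuration.toMeasure {d : ℕ} (γ : Configuration d) : Measure (Space d) :=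
  Measure.sum fun x : γ.1 => Measure.dirac (x : Space d)

/-- The σ-algebra on `Γ` generated by the maps `γ ↦ |γ ∩ B|`, `B` Borel. It is the Borel
σ-algebra of the vague topology. -/
noncomputable instance (d : ℕ) : MeasurableSpace (Configuration d) :=
  MeasurableSpace.comap Configuration.toMeasure inferInstance

/-- The set `Θ` of all configurations `γ` such that, for some `m`,
`|γ ∩ B(n)| ≤ m vol(B(n))` for all `n = 1, 2, …`, with `B(n)` the closed ball of radius `n`. -/
def Tempered (d : ℕ) : Set (Configuration d) :=
  {γ | ∃ m : ℕ, ∀ n : ℕ, 1 ≤ n →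
    ((γ.1 ∩ Metric.closedBall 0 (n : ℝ)).ncard : ℝ) ≤
      m * (volume (Metric.closedBall (0 : Space d) (n : ℝ))).toReal}

/-- `ρ` is a first correlation function of `μ`:
`∫ ∑_{x ∈ γ} g(x) μ(dγ) = ∫ g(x) ρ(x) dx` for all measurable `g ≥ 0`. -/
structure IsFirstCorrelationFunction {d : ℕ} (μ : Measure (Configuration d))
    (ρ : Space d → ℝ) : Prop where
  measurable : Measurable ρ
  nonneg : ∀ x, 0 ≤ ρ x
  campbell : ∀ g : Space d → ℝ≥0∞, Measurable g →
    ∫⁻ γ, ∑' x : γ.1, g x ∂μ = ∫⁻ x, g x * ENNReal.ofReal (ρ x)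

open scoped Classical in
/-- `k` is a second correlation function of `μ` (with `k x y` for `k_μ({x, y})`): for all
measurable `g ≥ 0`, the expectation of the sum of `g(x, y)` over all ordered pairs of distinct
points of `γ` equals `∫∫ g(x, y) k(x, y) dx dy`. -/
structure IsSecondCorrelationFunction {d : ℕ} (μ : Measure (Configuration d))
    (k : Space d → Space d → ℝ) : Prop where
  measurable : Measurable (Function.uncurry k)
  nonneg : ∀ x y, 0 ≤ k x y
  symm : ∀ x y, k x y = k y x
  campbell : ∀ g : Space d → Space d → ℝ≥0∞, Measurable (Function.uncurry g) →
    ∫⁻ γ, ∑' x : γ.1, ∑' y : γ.1, (if x = y then 0 else g x y) ∂μ =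
      ∫⁻ x, ∫⁻ y, g x y * ENNReal.ofReal (k x y)

/-- The second Ursell function `u(x, y) = k({x, y}) - ρ(x) ρ(y)`. -/
def ursell {d : ℕ} (ρ : Space d → ℝ) (k : Space d → Space d → ℝ) (x y : Space d) : ℝ :=
  k x y - ρ x * ρ y

/-! ### The jump kernel -/

/-- The total jump rate `a⁽⁰⁾ = ∫ a(x) dx`. -/
noncomputable def totalRate {d : ℕ} (a : Space d → ℝ) : ℝ := ∫ x, a x

/-- The vector of first moments `a⁽¹⁾ = ∫ x a(x) dx`. -/
noncomputable def firstMoment {d : ℕ} (a : Space d → ℝ) : Space d := ∫ x, a x • x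

/-- The matrix of second moments `a⁽²⁾ᵢⱼ = ∫ xᵢ xⱼ a(x) dx`. -/
noncomputable def secondMoment {d : ℕ} (a : Space d → ℝ) : Matrix (Fin d) (Fin d) ℝ :=
  fun i j => ∫ x, x i * x j * a x

/-- The even part `p` of `a`. -/
noncomputable def evenPart {d : ℕ} (a : Space d → ℝ) : Space d → ℝ :=
  fun x => (a x + a (-x)) / 2

/-- The odd part `q` of `a`. -/
noncomputable def oddPart {d : ℕ} (a : Space d → ℝ) : Space d → ℝ :=
  fun x => (a x - a (-x)) / 2

/-- The weakly asymmetric kernel `a_ε = p + ε q`. -/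
noncomputable def weaklyAsymmetric {d : ℕ} (a : Space d → ℝ) (ε : ℝ) : Space d → ℝ :=
  fun x => evenPart a x + ε * oddPart a x

/-! ### The dynamics -/

/-- The probability measure with density `a / a⁽⁰⁾`. -/
noncomputable def jumpLaw {d : ℕ} (a : Space d → ℝ) : Measure (Space d) :=
  (ENNReal.ofReal (totalRate a))⁻¹ • volume.withDensity fun x => ENNReal.ofReal (a x)

/-- Sample space of one particle: its waiting times and its jumps. -/
abbrev ParticleSample (d : ℕ) : Type := (ℕ → ℝ) × (ℕ → Space d)

/-- Independent exponential waiting times of rate `a⁽⁰⁾` and, independently of them, independent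
jumps with density `a / a⁽⁰⁾`. -/
noncomputable def particleLaw {d : ℕ} (a : Space d → ℝ) : Measure (ParticleSample d) :=
  (Measure.infinitePi fun _ : ℕ => expMeasure (totalRate a)).prod
    (Measure.infinitePi fun _ : ℕ => jumpLaw a)

/-- The counting process `Z_t` (a Poisson process) with waiting times `τ 0, τ 1, …`:
the number of `n ≥ 1` with `τ 0 + ⋯ + τ (n - 1) ≤ t`. -/
noncomputable def jumpCount (τ : ℕ → ℝ) (t : ℝ) : ℕ :=
  {n : ℕ | ∑ k ∈ Finset.range (n + 1), τ k ≤ t}.ncard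

/-- The Markov chain `Y` started in `x`, whose transition density from `y` to `y'` is
`a(y - y') / a⁽⁰⁾`. -/
noncomputable def jumpChain {d : ℕ} (x : Space d) (ξ : ℕ → Space d) (n : ℕ) : Space d :=
  x - ∑ k ∈ Finset.range n, ξ k

/-- The one-particle jump process `X_t = Y_{Z_t}` started in `x`. -/
noncomputable def particlePath {d : ℕ} (x : Space d) (w : ParticleSample d) (t : ℝ) : Space d :=
  jumpChain x w.2 (jumpCount w.1 t)

/-- The law `P_γ` of the independent family of particles started in the points of `γ`. -/
noncomputable def configurationLaw {d : ℕ} (a : Space d → ℝ) (γ : Configuration d) :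
    Measure (γ.1 → ParticleSample d) :=
  Measure.infinitePi fun _ : γ.1 => particleLaw a

/-- The free Kawasaki process started in `γ`: the state at time `t`, as the point measure
`∑_{x ∈ γ} δ_{X_t^x}` of the positions of the particles. -/
noncomputable def process {d : ℕ} (γ : Configuration d) (w : γ.1 → ParticleSample d) (t : ℝ) :
    Measure (Space d) :=
  Measure.sum fun x : γ.1 => Measure.dirac (particlePath (x : Space d) (w x) t)

/-- The rescaled empirical field `n_t^{(ε)}(φ, X) = ε^d ⟨φ(ε ·), X_{ε^{-κ} t}⟩`. -/
noncomputable def rescaledField {d : ℕ} (κ : ℕ) (ε t : ℝ) (φ : Space d → ℝ)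
    (γ : Configuration d) (w : γ.1 → ParticleSample d) : ℝ :=
  ε ^ d * ∫ x, φ (ε • x) ∂(process γ w (t / ε ^ κ))

/-- The Laplace transform `∫ μ(dγ) E_γ[exp(-n_t^{(ε)}(φ, X))]` of the rescaled empirical field of
the dynamics with kernel `a` and initial distribution `μ`. -/
noncomputable def fieldLaplace {d : ℕ} (a : Space d → ℝ) (μ : Measure (Configuration d))
    (κ : ℕ) (ε t : ℝ) (φ : Space d → ℝ) : ℝ :=
  ∫ γ, ∫ w, Real.exp (-rescaledField κ ε t φ γ w) ∂(configurationLaw a γ) ∂μ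

/-- The Laplace transform at `φ` of the Dirac measure at the generalized function given by the
density `r`. -/
noncomputable def diracLaplace {d : ℕ} (r φ : Space d → ℝ) : ℝ :=
  Real.exp (-∫ x, φ x * r x)

/-! ### The limiting equations -/

/-- Test functions: infinitely differentiable functions with compact support. -/
def IsTestFunction {d : ℕ} (φ : Space d → ℝ) : Prop :=
  ContDiff ℝ ∞ φ ∧ HasCompactSupport φ

/-- The partial derivative `∂f/∂xᵢ`. -/
noncomputable def partialDeriv {d : ℕ} (i : Fin d) (f : Space d → ℝ) (x : Space d) : ℝ :=
  fderiv ℝ f x (EuclideanSpace.single i 1)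

/-- The operator `f ↦ div(b f) + ½ ∑ᵢⱼ Qᵢⱼ ∂²f/∂xᵢ∂xⱼ`. -/
noncomputable def transportDiffusion {d : ℕ} (b : Space d) (Q : Matrix (Fin d) (Fin d) ℝ)
    (f : Space d → ℝ) (x : Space d) : ℝ :=
  ∑ i, partialDeriv i (fun y => b i * f y) x +
    (1 / 2) * ∑ i, ∑ j, Q i j * partialDeriv i (partialDeriv j f) x

/-- Bounded weak solutions `r` on `[0, ∞)` of
`∂r/∂t = div(b r) + ½ ∑ᵢⱼ Qᵢⱼ ∂²r/∂xᵢ∂xⱼ` with initial condition `r₀`.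
The adjoint of the operator is obtained by replacing `b` by `-b`. -/
structure IsBoundedWeakSolution {d : ℕ} (b : Space d) (Q : Matrix (Fin d) (Fin d) ℝ)
    (r₀ : Space d → ℝ) (r : ℝ → Space d → ℝ) : Prop where
  measurable : Measurable (Function.uncurry r)
  bounded : ∃ C : ℝ, ∀ t, 0 ≤ t → ∀ x, |r t x| ≤ C
  weak : ∀ φ, IsTestFunction φ → ∀ t, 0 ≤ t →
    ∫ x, r t x * φ x = (∫ x, r₀ x * φ x) +
      ∫ s in (0 : ℝ)..t, ∫ x, r s x * transportDiffusion (-b) Q φ x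

/-- `r` is, up to null sets at each time, the only bounded weak solution. -/
def IsUniqueBoundedWeakSolution {d : ℕ} (b : Space d) (Q : Matrix (Fin d) (Fin d) ℝ)
    (r₀ : Space d → ℝ) (r : ℝ → Space d → ℝ) : Prop :=
  IsBoundedWeakSolution b Q r₀ r ∧
    ∀ r', IsBoundedWeakSolution b Q r₀ r' → ∀ t, 0 ≤ t → r' t =ᵐ[volume] r t

/-- Strong (pointwise) solutions of `∂r/∂t = div(b r) + ½ ∑ᵢⱼ Qᵢⱼ ∂²r/∂xᵢ∂xⱼ` with initial
condition `r₀`. Here `m` is the order of the equation, and the initial value is attained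
continuously at all points of continuity of `r₀`. -/
structure IsStrongSolution {d : ℕ} (m : ℕ) (b : Space d) (Q : Matrix (Fin d) (Fin d) ℝ)
    (r₀ : Space d → ℝ) (r : ℝ → Space d → ℝ) : Prop where
  initial : r 0 = r₀
  smooth : ∀ t, 0 < t → ContDiff ℝ m (r t)
  equation : ∀ t, 0 < t → ∀ x,
    HasDerivAt (fun s => r s x) (transportDiffusion b Q (r t) x) t
  attains : ∀ x, ContinuousAt r₀ x →
    Tendsto (Function.uncurry r) (𝓝[Ici (0 : ℝ) ×ˢ univ] ((0 : ℝ), x)) (𝓝 (r₀ x))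

end FreeKawasaki

open FreeKawasaki

namespace FreeKawasaki

variable {d : ℕ}

/-! ### The generator in coordinate-free form -/

/-! Given the initial configuration `γ` the particles are independent, so the conditional Laplace
transform of the field is `exp(-∑_{x ∈ γ} h(x))`, where `h(x)` is the cumulant `-log E exp(-Y)` of
the contribution `Y` of one particle (`fieldLaplace_eq`). Since `0 ≤ Y ≤ ε^d K`, the cumulant agrees
with the mean `E Y` up to a relative error `ε^d K` (`logLaplace_le`, `le_logLaplace`). The
integrability of the Ursell function bounds the variance of `∑ h(x)` by a constant times `sup h · ∫
h`, which is of order `ε^d` (`lintegral_second_moment_le`). Hence a law of large numbers holds, and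
the Laplace transform is asymptotically the exponential of minus the mean field
(`abs_fieldLaplace_sub_le`).

After rescaling space, the mean field is `∫ E φ(y + ε D) ρ_ε(y/ε) dy`, with `D` the displacement of
one particle. `D` is a compound Poisson variable with an explicit characteristic exponent
(`charFun_displacement`). A Taylor expansion of the exponent and Lévy's continuity theorem show that
`ε D` converges in law to `-t b + √t S n`, with `n` standard Gaussian and `S Sᵀ = Q`. The three
regimes differ only in the pair `(b, S)`. Scheffé's lemma upgrades the pointwise convergence of the
averages of `φ` to convergence in `L¹`, and the limit is `∫ φ ρ_t` with `ρ_t(x) = E ρ₀(x + t b - √t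
S n)`, which is `limitDensity`.

It remains to study this explicit function. It is a weak solution because averaging over the shift
can be moved to the test function, where Gaussian integration by parts gives the semigroup identity
(`hasDerivAt_shiftAverage`). Neither smoothness of `ρ₀` nor invertibility of `S` is needed for that.
Uniqueness is the usual duality argument: for a solution `w` with zero initial value, the pairing of
`w_s` with the semigroup at time `t - s` applied to `φ` does not depend on `s`. In the diffusive
cases `S` is invertible, because `a` is a density and hyperplanes are null sets
(`posDef_secondMoment`). The linear change of variables by `S` then reduces the strong equation to
the standard heat equation, verified by differentiating a Gaussian integral (`heat_equation`). -/

lemma partialDeriv_partialDeriv {f : Space d → ℝ} (hf : ContDiff ℝ 2 f) (i j : Fin d)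
    (x : Space d) :
    partialDeriv i (partialDeriv j f) x =
      fderiv ℝ (fderiv ℝ f) x (EuclideanSpace.single i 1) (EuclideanSpace.single j 1) := by
  have hd : DifferentiableAt ℝ (fderiv ℝ f) x :=
    (hf.fderiv_right (m := 1) (by norm_num)).differentiable (by norm_num) x
  change fderiv ℝ (fun y => fderiv ℝ f y (EuclideanSpace.single j 1)) x _ = _
  rw [fderiv_clm_apply hd (differentiableAt_const _)]
  simp

lemma sum_smul_single (v : Space d) :
    ∑ i, v i • EuclideanSpace.single i (1 : ℝ) = v := by
  ext j
  simp [Finset.sum_apply, Pi.single_apply]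

/-- The operator `f ↦ Df(b) + ½ ∑ₖ D²f(S eₖ, S eₖ)`. -/
noncomputable def generator (b : Space d) (S : Space d →L[ℝ] Space d) (f : Space d → ℝ)
    (x : Space d) : ℝ :=
  fderiv ℝ f x b + (1 / 2) * ∑ k, fderiv ℝ (fderiv ℝ f) x (S (EuclideanSpace.single k 1))
    (S (EuclideanSpace.single k 1))

/-- `S` is a square root of the covariance matrix `Q`, that is `Q = S Sᵀ`. -/
def IsRootOf (S : Space d →L[ℝ] Space d) (Q : Matrix (Fin d) (Fin d) ℝ) : Prop :=
  ∀ i j, Q i j = ∑ k, S (EuclideanSpace.single k 1) i * S (EuclideanSpace.single k 1) j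

/-- Expanding `S eₖ` in the standard basis and summing over `k` first produces the entries of `S Sᵀ
= Q`. From here on the equation can be handled without coordinates. -/
lemma transportDiffusion_eq_generator {b : Space d} {Q : Matrix (Fin d) (Fin d) ℝ}
    {S : Space d →L[ℝ] Space d} (hS : IsRootOf S Q) {f : Space d → ℝ} (hf : ContDiff ℝ 2 f) :
    transportDiffusion b Q f = generator b S f := by
  ext x
  have hd : Differentiable ℝ f := hf.differentiable (by norm_num)
  unfold transportDiffusion generator
  congr 1
  · have h1 : ∀ i, partialDeriv i (fun y => b i * f y) x =
        b i * fderiv ℝ f x (EuclideanSpace.single i 1) := by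
      intro i
      simp [partialDeriv, fderiv_const_mul (hd x)]
    simp_rw [h1]
    conv_rhs => rw [← sum_smul_single b]
    simp
  · congr 1
    have h2 : ∀ k, fderiv ℝ (fderiv ℝ f) x (S (EuclideanSpace.single k 1))
        (S (EuclideanSpace.single k 1)) = ∑ i, ∑ j,
        (S (EuclideanSpace.single k 1) i * S (EuclideanSpace.single k 1) j) *
        fderiv ℝ (fderiv ℝ f) x (EuclideanSpace.single i 1) (EuclideanSpace.single j 1) := by
      intro k
      conv_lhs => rw [← sum_smul_single (S (EuclideanSpace.single k 1))]
      simp only [map_sum, map_smul, sum_apply,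
        smul_apply, smul_eq_mul, Finset.mul_sum]
      rw [Finset.sum_comm]
      exact Finset.sum_congr rfl fun i _ => Finset.sum_congr rfl fun j _ => by ring
    simp_rw [h2]
    conv_rhs => rw [Finset.sum_comm]
    refine Finset.sum_congr rfl fun i _ => ?_
    conv_rhs => rw [Finset.sum_comm]
    refine Finset.sum_congr rfl fun j _ => ?_
    rw [partialDeriv_partialDeriv hf, hS, Finset.sum_mul]

/-- This stability allows the generator to be applied twice to a test function in the uniqueness
proof. -/
lemma IsTestFunction.generator {b : Space d} {S : Space d →L[ℝ] Space d} {φ : Space d → ℝ}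
    (hφ : IsTestFunction φ) : IsTestFunction (generator b S φ) := by
  have h1 : ContDiff ℝ ∞ (fderiv ℝ φ) := hφ.1.fderiv_right (by simp)
  have h2 : ContDiff ℝ ∞ (fderiv ℝ (fderiv ℝ φ)) := h1.fderiv_right (by simp)
  have c1 : HasCompactSupport (fderiv ℝ φ) := hφ.2.fderiv ℝ
  have c2 : HasCompactSupport (fderiv ℝ (fderiv ℝ φ)) := c1.fderiv ℝ
  refine ⟨?_, ?_⟩
  · unfold FreeKawasaki.generator
    exact (h1.clm_apply contDiff_const).add (contDiff_const.mul (ContDiff.sum fun k _ =>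
      (h2.clm_apply contDiff_const).clm_apply contDiff_const))
  · refine (c1.union c2 : IsCompact _).of_isClosed_subset (isClosed_tsupport _) ?_
    refine closure_minimal ?_ ((isClosed_tsupport _).union (isClosed_tsupport _))
    intro x hx
    by_contra hcon
    rw [mem_union, not_or] at hcon
    apply hx
    simp [FreeKawasaki.generator, image_eq_zero_of_notMem_tsupport hcon.1,
      image_eq_zero_of_notMem_tsupport hcon.2]

lemma IsTestFunction.comp_add_right {φ : Space d → ℝ} (hφ : IsTestFunction φ) (z : Space d) :
    IsTestFunction fun y => φ (y + z) :=
  ⟨hφ.1.comp (contDiff_id.add contDiff_const), hφ.2.comp_homeomorph (Homeomorph.addRight z)⟩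

/-- The coefficients are constant. This is what makes the generator commute with averages over
random shifts. -/
lemma generator_comp_add_right (b : Space d) (S : Space d →L[ℝ] Space d) (φ : Space d → ℝ)
    (z y : Space d) : generator b S (fun y => φ (y + z)) y = generator b S φ (y + z) := by
  have h : fderiv ℝ (fun y => φ (y + z)) = fun y => fderiv ℝ φ (y + z) := by
    ext1 x
    exact fderiv_comp_add_right z
  unfold generator
  rw [h]
  simp [fderiv_comp_add_right]

lemma IsTestFunction.bounded {φ : Space d → ℝ} (hφ : IsTestFunction φ) :
    ∃ C, 0 ≤ C ∧ ∀ x, |φ x| ≤ C := by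
  obtain ⟨C, hC⟩ := hφ.2.exists_bound_of_continuous hφ.1.continuous
  exact ⟨C, (norm_nonneg _).trans (hC 0), hC⟩

lemma IsTestFunction.integrable {φ : Space d → ℝ} (hφ : IsTestFunction φ) : Integrable φ :=
  hφ.1.continuous.integrable_of_hasCompactSupport hφ.2

/-! ### The standard Gaussian measure -/

/-- The density of the standard Gaussian measure. -/
noncomputable def gaussDensity (d : ℕ) (n : Space d) : ℝ :=
  (2 * Real.pi) ^ (-(d : ℝ) / 2) * Real.exp (-‖n‖ ^ 2 / 2)

lemma gaussDensity_pos (n : Space d) : 0 < gaussDensity d n := by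
  unfold gaussDensity; positivity

lemma continuous_gaussDensity : Continuous (gaussDensity d) := by
  unfold gaussDensity; fun_prop

lemma hasFDerivAt_gaussDensity (n : Space d) :
    HasFDerivAt (gaussDensity d) (-(gaussDensity d n) • innerSL ℝ n) n := by
  have h := ((((hasStrictFDerivAt_norm_sq n).hasFDerivAt.neg.mul_const (2⁻¹)).exp).const_mul
    ((2 * Real.pi) ^ (-(d : ℝ) / 2)))
  refine (h.congr_fderiv ?_)
  ext v
  simp [gaussDensity, div_eq_mul_inv]
  ring

/-- The integrand is the norm of the complex Gaussian integrand. Exponential moments dominate the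
coordinate functions, through `|s| ≤ e^s + e^{-s}`. -/
lemma integrable_exp_linear_gaussDensity (w : Space d) :
    Integrable fun n => Real.exp (inner ℝ w n) * gaussDensity d n := by
  have h := (GaussianFourier.integrable_cexp_neg_mul_sq_norm_add (V := Space d) (b := 1 / 2)
    (by norm_num) 1 w).norm.const_mul ((2 * Real.pi) ^ (-(d : ℝ) / 2))
  refine h.congr (ae_of_all _ fun n => ?_)
  simp only [gaussDensity, Complex.norm_exp]
  have : (-(1 / 2 : ℂ) * (‖n‖ : ℂ) ^ 2 + 1 * (inner ℝ w n : ℝ)).re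
      = inner ℝ w n + -‖n‖ ^ 2 / 2 := by
    simp only [Complex.add_re, Complex.mul_re, one_mul, Complex.ofReal_re]
    norm_cast
    simp
    ring
  rw [this, Real.exp_add]
  ring

lemma integrable_gaussDensity : Integrable (gaussDensity d) := by
  simpa using integrable_exp_linear_gaussDensity (0 : Space d)

/-- The standard Gaussian measure on `ℝᵈ`. -/
noncomputable def gauss (d : ℕ) : Measure (Space d) :=
  volume.withDensity fun n => ENNReal.ofReal (gaussDensity d n)

lemma integral_gauss {E : Type*} [NormedAddCommGroup E] [NormedSpace ℝ E] (f : Space d → E) :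
    ∫ n, f n ∂(gauss d) = ∫ n, gaussDensity d n • f n := by
  rw [gauss, integral_withDensity_eq_integral_toReal_smul₀]
  · simp [ENNReal.toReal_ofReal (gaussDensity_pos _).le]
  · exact (continuous_gaussDensity.measurable.ennreal_ofReal).aemeasurable
  · exact ae_of_all _ fun _ => ENNReal.ofReal_lt_top

lemma integrable_gauss_iff {E : Type*} [NormedAddCommGroup E] [NormedSpace ℝ E] {f : Space d → E} :
    Integrable f (gauss d) ↔ Integrable fun n => gaussDensity d n • f n := by
  rw [gauss, integrable_withDensity_iff_integrable_smul₀']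
  · simp [ENNReal.toReal_ofReal (gaussDensity_pos _).le]
  · exact (continuous_gaussDensity.measurable.ennreal_ofReal).aemeasurable
  · exact ae_of_all _ fun _ => ENNReal.ofReal_lt_top

/-- Besides identifying limit laws, its value at `u = 0` shows that `gauss` has total mass one. -/
lemma charFun_gauss (u : Space d) :
    charFun (gauss d) u = Complex.exp (-‖u‖ ^ 2 / 2) := by
  rw [charFun_apply, integral_gauss]
  have h := GaussianFourier.integral_cexp_neg_mul_sq_norm_add (V := Space d) (b := 1 / 2)
    (by norm_num) Complex.I u
  have h2 : ∀ n : Space d, gaussDensity d n • Complex.exp ((inner ℝ n u : ℝ) * Complex.I) =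
      (((2 * Real.pi) ^ (-(d : ℝ) / 2) : ℝ) : ℂ) *
        Complex.exp (-(1 / 2) * (‖n‖ : ℂ) ^ 2 + Complex.I * (inner ℝ u n : ℝ)) := by
    intro n
    rw [Complex.exp_add, gaussDensity, real_inner_comm]
    simp only [Complex.real_smul]
    push_cast
    rw [show -(1 / 2 : ℂ) * (‖n‖ : ℂ) ^ 2 = -(‖n‖ : ℂ) ^ 2 / 2 by ring, mul_comm Complex.I]
    ring
  simp_rw [h2]
  rw [integral_const_mul, h, ← mul_assoc]
  have h3 : ((((2 * Real.pi) ^ (-(d : ℝ) / 2) : ℝ) : ℂ)) *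
      ((Real.pi : ℂ) / (1 / 2)) ^ ((Module.finrank ℝ (Space d) : ℂ) / 2) = 1 := by
    have e1 : ((Real.pi : ℂ) / (1 / 2)) = ((2 * Real.pi : ℝ) : ℂ) := by push_cast; ring
    have e2 : ((Module.finrank ℝ (Space d) : ℂ) / 2) = (((d : ℝ) / 2 : ℝ) : ℂ) := by simp
    rw [e1, e2, ← Complex.ofReal_cpow (by positivity), ← Complex.ofReal_mul,
      ← Real.rpow_add (by positivity)]
    simp [neg_div]
  rw [h3, one_mul]
  congr 1
  rw [Complex.I_sq]
  ring

instance : IsProbabilityMeasure (gauss d) := by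
  have h0 := charFun_gauss (0 : Space d)
  have hfin : IsFiniteMeasure (gauss d) :=
    isFiniteMeasure_withDensity_ofReal integrable_gaussDensity.2
  rw [charFun_zero] at h0
  constructor
  have h1 : (gauss d).real univ = 1 := by
    have := h0
    simp only [norm_zero] at this
    norm_num at this
    exact_mod_cast this
  have := (ENNReal.toReal_eq_one_iff _).1 h1
  exact this

lemma integrable_norm_gauss : Integrable (fun n : Space d => ‖n‖) (gauss d) := by
  have hg : ∀ i, Integrable (fun n : Space d => ‖n i‖) (gauss d) := by
    intro i
    rw [integrable_gauss_iff]
    refine ((integrable_exp_linear_gaussDensity (EuclideanSpace.single i (1 : ℝ))).add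
      (integrable_exp_linear_gaussDensity (-EuclideanSpace.single i (1 : ℝ)))).mono' ?_ ?_
    · exact (continuous_gaussDensity.smul (by fun_prop)).aestronglyMeasurable
    · refine ae_of_all _ fun n => ?_
      simp only [smul_eq_mul, norm_mul, Pi.add_apply, norm_norm]
      rw [Real.norm_of_nonneg (gaussDensity_pos n).le, ← add_mul, mul_comm]
      refine mul_le_mul_of_nonneg_right ?_ (gaussDensity_pos n).le
      simp only [inner_neg_left, EuclideanSpace.inner_single_left, map_one, one_mul]
      rw [Real.norm_eq_abs]
      have h1 := Real.add_one_le_exp (n i)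
      have h2 := Real.add_one_le_exp (-(n i))
      have h3 := Real.exp_pos (n i)
      have h4 := Real.exp_pos (-(n i))
      rcases abs_cases (n i) with h | h <;> linarith
  refine (integrable_finsetSum Finset.univ fun i _ => hg i).mono' (by fun_prop) ?_
  refine ae_of_all _ fun n => ?_
  rw [norm_norm, EuclideanSpace.norm_eq]
  rw [Real.sqrt_le_left (Finset.sum_nonneg fun i _ => norm_nonneg _)]
  exact Finset.sum_sq_le_sq_sum_of_nonneg fun i _ => norm_nonneg _

lemma integrable_gauss_of_bounded {f : Space d → ℝ} (hf : AEStronglyMeasurable f (gauss d))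
    {C : ℝ} (hC : ∀ x, |f x| ≤ C) : Integrable f (gauss d) :=
  Integrable.of_bound hf C (ae_of_all _ hC)

/-- Gaussian integration by parts. -/
lemma integral_coord_mul_gauss {h : Space d → ℝ} (hh : ContDiff ℝ 1 h) {C : ℝ}
    (hC : ∀ x, |h x| ≤ C) (k : Fin d) {C' : ℝ}
    (hC' : ∀ x, |fderiv ℝ h x (EuclideanSpace.single k 1)| ≤ C') :
    ∫ n, n k * h n ∂(gauss d) =
      ∫ n, fderiv ℝ h n (EuclideanSpace.single k 1) ∂(gauss d) := by
  set e : Space d := EuclideanSpace.single k 1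
  -- The factor `n k` is minus the logarithmic derivative of the Gaussian density, so integration by
  -- parts against Lebesgue measure moves it onto `h`.
  have hdg : ∀ n, fderiv ℝ (gaussDensity d) n e = -(gaussDensity d n * n k) := by
    intro n
    rw [(hasFDerivAt_gaussDensity n).fderiv]
    simp [e, EuclideanSpace.inner_single_right]
  have hcd : Continuous fun n => fderiv ℝ h n e :=
    (hh.continuous_fderiv (by norm_num)).clm_apply continuous_const
  have hk : ∀ n : Space d, ‖n k‖ ≤ ‖n‖ := fun n => PiLp.norm_apply_le n k
  have i1 : Integrable (fun n => n k * h n) (gauss d) := by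
    refine (integrable_norm_gauss.mul_const C).mono'
      (by have := hh.continuous; fun_prop) (ae_of_all _ fun n => ?_)
    rw [norm_mul]
    exact mul_le_mul (hk n) (hC n) (norm_nonneg _) (norm_nonneg _)
  have i2 : Integrable (fun n => fderiv ℝ h n e) (gauss d) :=
    integrable_gauss_of_bounded (C := C') hcd.aestronglyMeasurable hC'
  have i3 : Integrable h (gauss d) :=
    integrable_gauss_of_bounded hh.continuous.aestronglyMeasurable hC
  rw [integrable_gauss_iff] at i1 i2 i3
  rw [integral_gauss, integral_gauss]
  have key := integral_mul_fderiv_eq_neg_fderiv_mul_of_integrable (μ := (volume : Measure (Space d)))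
    (f := h) (g := gaussDensity d) (v := e) ?_ ?_ ?_
    (fun x _ => hh.differentiable (by norm_num) x)
    (fun x _ => (hasFDerivAt_gaussDensity x).differentiableAt)
  · simp_rw [hdg] at key
    calc ∫ n, gaussDensity d n • (n k * h n) = -∫ n, h n * -(gaussDensity d n * n k) := by
          rw [← integral_neg]; congr 1; ext n; simp; ring
      _ = ∫ n, gaussDensity d n • fderiv ℝ h n e := by
          rw [key, neg_neg]; congr 1; ext n; simp; ring
  · exact i2.congr (ae_of_all _ fun n => by simp [mul_comm])
  · simp_rw [hdg]
    exact i1.neg.congr (ae_of_all _ fun n => by simp; ring)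
  · exact i3.congr (ae_of_all _ fun n => by simp [mul_comm])

/-! ### Averaging over random shifts -/

lemma integrable_mul_of_bounded {f φ : Space d → ℝ} (hf : Measurable f) {C : ℝ}
    (hC : ∀ x, |f x| ≤ C) (hφ : Integrable φ) : Integrable fun x => f x * φ x :=
  hφ.bdd_mul hf.aestronglyMeasurable (ae_of_all _ hC)

/-- Fubini's theorem for the average of a bounded function over a random shift. -/
lemma integral_shift_mul {Ω : Type*} [MeasurableSpace Ω] (ν : Measure Ω) [IsFiniteMeasure ν]
    {Z : Ω → Space d} (hZ : Measurable Z) {f : Space d → ℝ} (hf : Measurable f) {C : ℝ}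
    (hC : ∀ x, |f x| ≤ C) {φ : Space d → ℝ} (hφ : Integrable φ) :
    ∫ x, (∫ w, f (x - Z w) ∂ν) * φ x = ∫ w, (∫ x, f x * φ (x + Z w)) ∂ν := by
  have h1 : ∀ w, ∫ x, f x * φ (x + Z w) = ∫ x, f (x - Z w) * φ x := by
    intro w
    rw [← integral_sub_right_eq_self (fun x => f x * φ (x + Z w)) (Z w)]
    simp
  simp_rw [h1, ← integral_mul_const]
  rw [integral_integral_swap]
  refine (hφ.comp_fst ν).bdd_mul (c := C) ?_ (ae_of_all _ fun p => hC _)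
  exact (hf.comp (measurable_fst.sub (hZ.comp measurable_snd))).aestronglyMeasurable

/-- Averaging over a random shift is dual to averaging over the opposite shift. -/
lemma integral_shift_dual {Ω : Type*} [MeasurableSpace Ω] (ν : Measure Ω) [IsFiniteMeasure ν]
    {Z : Ω → Space d} (hZ : Measurable Z) {f : Space d → ℝ} (hf : Measurable f) {C : ℝ}
    (hC : ∀ x, |f x| ≤ C) {φ : Space d → ℝ} (hφm : Measurable φ) (hφ : Integrable φ) :
    ∫ x, (∫ w, f (x - Z w) ∂ν) * φ x = ∫ x, f x * ∫ w, φ (x + Z w) ∂ν := by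
  rw [integral_shift_mul ν hZ hf hC hφ]
  simp_rw [← integral_const_mul]
  rw [integral_integral_swap]
  refine Integrable.bdd_mul (c := C) ?_ (hf.comp measurable_snd).aestronglyMeasurable
    (ae_of_all _ fun p => hC _)
  have hm : Measurable fun p : Ω × Space d => φ (p.2 + Z p.1) :=
    hφm.comp (measurable_snd.add (hZ.comp measurable_fst))
  rw [integrable_prod_iff hm.aestronglyMeasurable]
  refine ⟨ae_of_all _ fun w => hφ.comp_add_right (Z w), ?_⟩
  have : ∀ w, ∫ y, ‖φ (y + Z w)‖ = ∫ y, ‖φ y‖ := fun w =>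
    integral_add_right_eq_self (fun y => ‖φ y‖) (Z w)
  simp_rw [this]
  exact integrable_const _

/-! ### The limiting displacement and its semigroup -/

/-- The limiting displacement `-t b + √t S n` of a particle, where `n` is standard Gaussian. -/
noncomputable def limitShift (b : Space d) (S : Space d →L[ℝ] Space d) (t : ℝ) (n : Space d) :
    Space d :=
  -(t • b) + √t • S n

/-- The action of the limiting displacement on test functions. -/
noncomputable def shiftAverage (b : Space d) (S : Space d →L[ℝ] Space d) (φ : Space d → ℝ)
    (t : ℝ) (y : Space d) : ℝ :=
  ∫ n, φ (y + limitShift b S t n) ∂(gauss d)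

/-- The density at time `t`: the initial density averaged over the limiting displacement. -/
noncomputable def limitDensity (b : Space d) (S : Space d →L[ℝ] Space d) (f : Space d → ℝ)
    (t : ℝ) (x : Space d) : ℝ :=
  ∫ n, f (x - limitShift b S t n) ∂(gauss d)

variable {b : Space d} {S : Space d →L[ℝ] Space d}

lemma continuous_limitShift : Continuous fun p : ℝ × Space d => limitShift b S p.1 p.2 := by
  unfold limitShift; fun_prop

lemma measurable_limitShift (t : ℝ) : Measurable (limitShift b S t) :=
  (continuous_limitShift.comp (Continuous.prodMk_right t)).measurable

lemma measurable_limitDensity {f : Space d → ℝ} (hf : Measurable f) :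
    Measurable (Function.uncurry (limitDensity b S f)) := by
  have : StronglyMeasurable fun p : (ℝ × Space d) × Space d =>
      f (p.1.2 - limitShift b S p.1.1 p.2) := by
    refine (hf.comp ?_).stronglyMeasurable
    refine (measurable_snd.comp measurable_fst).sub ?_
    exact continuous_limitShift.measurable.comp
      ((measurable_fst.comp measurable_fst).prodMk measurable_snd)
  exact (this.integral_prod_right (ν := gauss d)).measurable

lemma measurable_shiftAverage {f : Space d → ℝ} (hf : Measurable f) :
    Measurable (Function.uncurry (shiftAverage b S f)) := by
  have : StronglyMeasurable fun p : (ℝ × Space d) × Space d =>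
      f (p.1.2 + limitShift b S p.1.1 p.2) := by
    refine (hf.comp ?_).stronglyMeasurable
    refine (measurable_snd.comp measurable_fst).add ?_
    exact continuous_limitShift.measurable.comp
      ((measurable_fst.comp measurable_fst).prodMk measurable_snd)
  exact (this.integral_prod_right (ν := gauss d)).measurable

lemma abs_limitDensity_le {f : Space d → ℝ} {C : ℝ} (hC : ∀ x, |f x| ≤ C) (t : ℝ) (x : Space d) :
    |limitDensity b S f t x| ≤ C := by
  have := norm_integral_le_of_norm_le_const (μ := gauss d)
    (f := fun n => f (x - limitShift b S t n)) (C := C) (ae_of_all _ fun n => hC _)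
  simpa [limitDensity] using this

lemma limitDensity_zero (f : Space d → ℝ) : limitDensity b S f 0 = f := by
  ext x
  simp [limitDensity, limitShift]

lemma shiftAverage_zero (f : Space d → ℝ) : shiftAverage b S f 0 = f := by
  ext x
  simp [shiftAverage, limitShift]

/-- This moves the average from the merely bounded `f` to the smooth `φ`, so no derivative ever
falls on `f`. -/
lemma integral_limitDensity_mul {f : Space d → ℝ} (hf : Measurable f) {C : ℝ}
    (hC : ∀ x, |f x| ≤ C) {φ : Space d → ℝ} (hφm : Measurable φ) (hφ : Integrable φ) (t : ℝ) :
    ∫ x, limitDensity b S f t x * φ x = ∫ x, f x * shiftAverage b S φ t x :=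
  integral_shift_dual (gauss d) (measurable_limitShift t) hf hC hφm hφ

/-- Continuity includes `t = 0`, where `√t` is not differentiable; it replaces differentiability
there. -/
lemma continuous_shiftAverage {φ : Space d → ℝ} (hφ : Continuous φ) {C : ℝ}
    (hC : ∀ x, |φ x| ≤ C) (y : Space d) : Continuous fun t => shiftAverage b S φ t y := by
  refine continuous_of_dominated (bound := fun _ => C) ?_ ?_ (integrable_const _) ?_
  · intro t
    exact (hφ.measurable.comp ((measurable_limitShift t).const_add y)).aestronglyMeasurable
  · exact fun t => ae_of_all _ fun n => hC _
  · refine ae_of_all _ fun n => ?_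
    exact hφ.comp (continuous_const.add (continuous_limitShift.comp (Continuous.prodMk_left n)))

lemma continuous_limitShift_right (t : ℝ) : Continuous (limitShift b S t) := by
  unfold limitShift; fun_prop

lemma IsTestFunction.contDiff_fderiv_apply {φ : Space d → ℝ} (hφ : IsTestFunction φ)
    (v : Space d) : ContDiff ℝ ∞ fun x => fderiv ℝ φ x v :=
  (hφ.1.fderiv_right (m := ∞) (by simp)).clm_apply contDiff_const

lemma IsTestFunction.fderiv_apply {φ : Space d → ℝ} (hφ : IsTestFunction φ)
    (v : Space d) : IsTestFunction fun x => fderiv ℝ φ x v :=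
  ⟨hφ.contDiff_fderiv_apply v, hφ.2.fderiv_apply ℝ v⟩

lemma IsTestFunction.fderiv_fderiv_apply {φ : Space d → ℝ} (hφ : IsTestFunction φ)
    (v w : Space d) : IsTestFunction fun x => fderiv ℝ (fderiv ℝ φ) x v w := by
  have h : (fun x => fderiv ℝ (fderiv ℝ φ) x v w) =
      fun x => fderiv ℝ (fun x => fderiv ℝ φ x w) x v := by
    ext x
    have hd : DifferentiableAt ℝ (fderiv ℝ φ) x :=
      (hφ.1.fderiv_right (m := ∞) (by simp)).differentiable (by simp) x
    rw [fderiv_clm_apply hd (differentiableAt_const _)]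
    simp
  rw [h]
  exact (hφ.fderiv_apply w).fderiv_apply v

lemma hasFDerivAt_fderiv_limitShift {φ : Space d → ℝ} (hφ : IsTestFunction φ) (t : ℝ)
    (y v n : Space d) :
    HasFDerivAt (fun n => fderiv ℝ φ (y + limitShift b S t n) v)
      (√t • ((fderiv ℝ (fderiv ℝ φ) (y + limitShift b S t n)).flip v).comp S) n := by
  have hφ1 : ContDiff ℝ ∞ (fderiv ℝ φ) := hφ.1.fderiv_right (by simp)
  have h1 : HasFDerivAt (fun n => y + limitShift b S t n) (√t • S) n :=
    ((S.hasFDerivAt.const_smul (√t)).const_add _).const_add _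
  have h2 : HasFDerivAt (fun n => fderiv ℝ φ (y + limitShift b S t n))
      ((fderiv ℝ (fderiv ℝ φ) (y + limitShift b S t n)).comp (√t • S)) n :=
    ((hφ1.differentiable (by simp)) (y + limitShift b S t n)).hasFDerivAt.comp n h1
  refine (h2.clm_apply (hasFDerivAt_const v n)).congr_fderiv ?_
  ext w
  simp

/-- Gaussian integration by parts for one coordinate along the limiting displacement. -/
lemma integral_coord_mul_fderiv_limitShift {φ : Space d → ℝ} (hφ : IsTestFunction φ) (t : ℝ)
    (y v : Space d) (k : Fin d) :
    Integrable (fun n => n k * fderiv ℝ φ (y + limitShift b S t n) v) (gauss d) ∧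
    ∫ n, n k * fderiv ℝ φ (y + limitShift b S t n) v ∂(gauss d) =
      √t * ∫ n, fderiv ℝ (fderiv ℝ φ) (y + limitShift b S t n)
        (S (EuclideanSpace.single k 1)) v ∂(gauss d) := by
  obtain ⟨C1, -, hC1⟩ := (hφ.fderiv_apply v).bounded
  obtain ⟨C2, -, hC2⟩ := (hφ.fderiv_fderiv_apply (S (EuclideanSpace.single k 1)) v).bounded
  have hh : ContDiff ℝ 1 fun n => fderiv ℝ φ (y + limitShift b S t n) v := by
    refine ((hφ.contDiff_fderiv_apply v).of_le (by simp)).comp ?_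
    unfold limitShift
    fun_prop
  have hfd : ∀ n, fderiv ℝ (fun n => fderiv ℝ φ (y + limitShift b S t n) v) n
      (EuclideanSpace.single k 1) = √t * fderiv ℝ (fderiv ℝ φ) (y + limitShift b S t n)
        (S (EuclideanSpace.single k 1)) v := by
    intro n
    rw [(hasFDerivAt_fderiv_limitShift hφ t y v n).fderiv]
    simp
  constructor
  · refine (integrable_norm_gauss.mul_const C1).mono' ?_ (ae_of_all _ fun n => ?_)
    · exact ((EuclideanSpace.proj k).continuous.mul hh.continuous).aestronglyMeasurable
    · rw [norm_mul]
      exact mul_le_mul (PiLp.norm_apply_le n k) (hC1 _) (norm_nonneg _) (norm_nonneg _)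
  · rw [integral_coord_mul_gauss hh (fun n => hC1 _) k (C' := √t * C2) ?_, ← integral_const_mul]
    · exact integral_congr_ae (ae_of_all _ hfd)
    · intro n
      rw [hfd, abs_mul, abs_of_nonneg (Real.sqrt_nonneg _)]
      exact mul_le_mul_of_nonneg_left (hC2 _) (Real.sqrt_nonneg _)

/-- Gaussian integration by parts along the limiting displacement. -/
lemma integral_fderiv_limitShift {φ : Space d → ℝ} (hφ : IsTestFunction φ) (t : ℝ)
    (y : Space d) :
    Integrable (fun n => fderiv ℝ φ (y + limitShift b S t n) (S n)) (gauss d) ∧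
    ∫ n, fderiv ℝ φ (y + limitShift b S t n) (S n) ∂(gauss d) =
      √t * ∑ k, ∫ n, fderiv ℝ (fderiv ℝ φ) (y + limitShift b S t n)
        (S (EuclideanSpace.single k 1)) (S (EuclideanSpace.single k 1)) ∂(gauss d) := by
  have hdec : ∀ n, fderiv ℝ φ (y + limitShift b S t n) (S n) =
      ∑ k, n k * fderiv ℝ φ (y + limitShift b S t n) (S (EuclideanSpace.single k 1)) := by
    intro n
    conv_lhs => enter [2]; rw [← sum_smul_single n]
    simp only [map_sum, map_smul, smul_eq_mul]
  simp_rw [hdec]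
  have i1 := fun k => integral_coord_mul_fderiv_limitShift (b := b) (S := S) hφ t y
    (S (EuclideanSpace.single k 1)) k
  refine ⟨integrable_finsetSum _ fun k _ => (i1 k).1, ?_⟩
  rw [integral_finsetSum _ fun k _ => (i1 k).1, Finset.mul_sum]
  exact Finset.sum_congr rfl fun k _ => (i1 k).2

lemma integrable_comp_limitShift {φ : Space d → ℝ} (hφ : IsTestFunction φ) (t : ℝ)
    (y : Space d) : Integrable (fun n => φ (y + limitShift b S t n)) (gauss d) := by
  obtain ⟨C, -, hC⟩ := hφ.bounded
  exact integrable_gauss_of_bounded (hφ.1.continuous.comp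
    (continuous_const.add (continuous_limitShift_right t))).aestronglyMeasurable fun n => hC _

lemma IsTestFunction.exists_bound_fderiv {φ : Space d → ℝ} (hφ : IsTestFunction φ) :
    ∃ C, ∀ x, ‖fderiv ℝ φ x‖ ≤ C := by
  have h : Continuous fun x => ‖fderiv ℝ φ x‖ := (hφ.1.continuous_fderiv (by simp)).norm
  have hc : HasCompactSupport fun x => ‖fderiv ℝ φ x‖ := (hφ.2.fderiv ℝ).norm
  obtain ⟨C, hC⟩ := hc.exists_bound_of_continuous h
  exact ⟨C, fun x => (Real.norm_of_nonneg (norm_nonneg _)).symm.trans_le (hC x)⟩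

lemma hasDerivAt_comp_limitShift {φ : Space d → ℝ} (hφ : IsTestFunction φ) {s : ℝ} (hs : 0 < s)
    (y n : Space d) : HasDerivAt (fun s => φ (y + limitShift b S s n))
      (fderiv ℝ φ (y + limitShift b S s n) (-b + (1 / (2 * √s)) • S n)) s := by
  have h1 : HasDerivAt (fun s => y + limitShift b S s n) (-b + (1 / (2 * √s)) • S n) s := by
    have := (((hasDerivAt_id s).smul_const b).neg.add
      ((Real.hasDerivAt_sqrt hs.ne').smul_const (S n))).const_add y
    simpa [limitShift] using this
  exact ((hφ.1.differentiable (by simp)) _).hasFDerivAt.comp_hasDerivAt s h1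

/-- Differentiating `√t S n` gives `S n / (2√t)`. Gaussian integration by parts turns the factor `n`
into `√t` times a second derivative, so `√t` cancels and `½ ∑ D²φ(S eₖ, S eₖ)` remains. The
displacement drifts along `-b`, which is why the generator has drift `-b`. -/
lemma hasDerivAt_shiftAverage {φ : Space d → ℝ} (hφ : IsTestFunction φ) {t : ℝ} (ht : 0 < t)
    (y : Space d) :
    HasDerivAt (fun t => shiftAverage b S φ t y)
      (shiftAverage b S (generator (-b) S φ) t y) t := by
  have hφ1 : Continuous (fderiv ℝ φ) := hφ.1.continuous_fderiv (by simp)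
  obtain ⟨C1, hC1⟩ := hφ.exists_bound_fderiv
  have hC1n : 0 ≤ C1 := (norm_nonneg _).trans (hC1 0)
  have hcont : Continuous fun n => y + limitShift b S t n :=
    continuous_const.add (continuous_limitShift_right t)
  -- Staying above `t / 2` keeps `1 / (2√s)` bounded; the remaining growth is linear in `‖n‖`, which
  -- is integrable.
  have hbd : ∀ n, ∀ s ∈ Ioi (t / 2),
      ‖fderiv ℝ φ (y + limitShift b S s n) (-b + (1 / (2 * √s)) • S n)‖ ≤
        C1 * (‖b‖ + (1 / (2 * √(t / 2))) * (‖S‖ * ‖n‖)) := by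
    intro n s hs
    have hs' : t / 2 < s := hs
    have h1 : ‖-b + (1 / (2 * √s)) • S n‖ ≤ ‖b‖ + (1 / (2 * √(t / 2))) * (‖S‖ * ‖n‖) := by
      refine (norm_add_le _ _).trans ?_
      rw [norm_neg, norm_smul, Real.norm_of_nonneg (by positivity)]
      gcongr
      exact S.le_opNorm n
    calc _ ≤ ‖fderiv ℝ φ (y + limitShift b S s n)‖ * ‖-b + (1 / (2 * √s)) • S n‖ :=
          ContinuousLinearMap.le_opNorm _ _
      _ ≤ _ := mul_le_mul (hC1 _) h1 (norm_nonneg _) hC1n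
  have hm : Continuous fun n => fderiv ℝ φ (y + limitShift b S t n) (-b + (1 / (2 * √t)) • S n) :=
    (hφ1.comp hcont).clm_apply (by fun_prop)
  have hbi : Integrable (fun n => C1 * (‖b‖ + (1 / (2 * √(t / 2))) * (‖S‖ * ‖n‖))) (gauss d) :=
    ((integrable_const _).add ((integrable_norm_gauss.const_mul _).const_mul _)).const_mul _
  have key := hasDerivAt_integral_of_dominated_loc_of_deriv_le (μ := gauss d)
    (F := fun s n => φ (y + limitShift b S s n))
    (F' := fun s n => fderiv ℝ φ (y + limitShift b S s n) (-b + (1 / (2 * √s)) • S n))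
    (x₀ := t) (s := Ioi (t / 2))
    (bound := fun n => C1 * (‖b‖ + (1 / (2 * √(t / 2))) * (‖S‖ * ‖n‖)))
    (Ioi_mem_nhds (by linarith))
    (Eventually.of_forall fun s => (integrable_comp_limitShift hφ s y).aestronglyMeasurable)
    (integrable_comp_limitShift hφ t y) hm.aestronglyMeasurable (ae_of_all _ hbd) hbi
    (ae_of_all _ fun n s hs =>
      hasDerivAt_comp_limitShift hφ (lt_trans (by linarith) (show t / 2 < s from hs)) y n)
  refine key.2.congr_deriv ?_
  obtain ⟨i1, hib⟩ := integral_fderiv_limitShift (b := b) (S := S) hφ t y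
  have i2 := fun k : Fin d => integrable_comp_limitShift (b := b) (S := S)
    (hφ.fderiv_fderiv_apply (S (EuclideanSpace.single k 1)) (S (EuclideanSpace.single k 1))) t y
  have i0 := integrable_comp_limitShift (b := b) (S := S) (hφ.fderiv_apply (-b)) t y
  simp_rw [map_add, map_smul, smul_eq_mul]
  rw [integral_add i0 (i1.const_mul _), integral_const_mul, hib]
  unfold shiftAverage generator
  rw [integral_add i0 ((integrable_finsetSum _ fun k _ => i2 k).const_mul _), integral_const_mul,
    integral_finsetSum _ fun k _ => i2 k]
  have hst : 0 < √t := Real.sqrt_pos.2 ht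
  congr 1
  field_simp

/-- The fundamental theorem of calculus is used in the form that asks for the derivative on the open
interval only, with continuity at the endpoints. -/
lemma shiftAverage_eq_add_integral {φ : Space d → ℝ} (hφ : IsTestFunction φ) {t : ℝ} (ht : 0 ≤ t)
    (y : Space d) :
    shiftAverage b S φ t y =
      φ y + ∫ s in (0 : ℝ)..t, shiftAverage b S (generator (-b) S φ) s y := by
  obtain ⟨C0, -, hC0⟩ := hφ.bounded
  have hL : IsTestFunction (generator (-b) S φ) := hφ.generator
  obtain ⟨C1, -, hC1⟩ := hL.bounded
  rw [intervalIntegral.integral_eq_sub_of_hasDerivAt_of_le ht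
    (continuous_shiftAverage hφ.1.continuous hC0 y).continuousOn
    (fun s hs => hasDerivAt_shiftAverage hφ hs.1 y)
    ((continuous_shiftAverage hL.1.continuous hC1 y).intervalIntegrable _ _), shiftAverage_zero]
  ring

end FreeKawasaki

namespace FreeKawasaki

variable {d : ℕ} {b : Space d} {S : Space d →L[ℝ] Space d}

/-! ### Weak solutions -/

lemma IsTestFunction.contDiff_two {φ : Space d → ℝ} (hφ : IsTestFunction φ) : ContDiff ℝ 2 φ :=
  contDiff_infty.1 hφ.1 2

lemma abs_integral_mul_le {f φ : Space d → ℝ} {C : ℝ}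
    (hC : ∀ x, |f x| ≤ C) (hφ : Integrable φ) : |∫ x, f x * φ x| ≤ C * ∫ x, |φ x| := by
  rw [← integral_const_mul, ← Real.norm_eq_abs]
  refine norm_integral_le_of_norm_le (hφ.abs.const_mul C) (ae_of_all _ fun x => ?_)
  rw [norm_mul]
  exact mul_le_mul_of_nonneg_right (hC x) (abs_nonneg _)

lemma intervalIntegrable_of_bounded {g : ℝ → ℝ} (hg : Measurable g) {C s t : ℝ}
    (hC : ∀ r ∈ Set.uIoc s t, |g r| ≤ C) : IntervalIntegrable g volume s t := by
  rw [intervalIntegrable_iff]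
  exact Measure.integrableOn_of_bounded (measure_Ioc_lt_top.ne) hg.aestronglyMeasurable
    ((ae_restrict_iff' measurableSet_uIoc).2 (ae_of_all _ hC))

lemma measurable_integral_mul {r : ℝ → Space d → ℝ} (hr : Measurable (Function.uncurry r))
    {φ : Space d → ℝ} (hφ : Measurable φ) : Measurable fun s => ∫ x, r s x * φ x := by
  have : StronglyMeasurable fun p : ℝ × Space d => r p.1 p.2 * φ p.2 :=
    (hr.mul (hφ.comp measurable_snd)).stronglyMeasurable
  exact (this.integral_prod_right (ν := volume)).measurable

lemma integrable_shift_prod {Ω : Type*} [MeasurableSpace Ω] (ν : Measure Ω) [IsFiniteMeasure ν]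
    {Z : Ω → Space d} (hZ : Measurable Z) {g : Space d → ℝ} (hgm : Measurable g)
    (hg : Integrable g) : Integrable (fun p : Ω × Space d => g (p.2 + Z p.1)) (ν.prod volume) := by
  have hm : Measurable fun p : Ω × Space d => g (p.2 + Z p.1) :=
    hgm.comp (measurable_snd.add (hZ.comp measurable_fst))
  refine (integrable_prod_iff hm.aestronglyMeasurable).2
    ⟨ae_of_all _ fun o => hg.comp_add_right (Z o), ?_⟩
  have : ∀ o, ∫ y, ‖g (y + Z o)‖ = ∫ y, ‖g y‖ := fun o =>
    integral_add_right_eq_self (fun y => ‖g y‖) (Z o)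
  simp_rw [this]
  exact integrable_const _

lemma integral_mul_shift {Ω : Type*} [MeasurableSpace Ω] (ν : Measure Ω) [IsFiniteMeasure ν]
    {Z : Ω → Space d} (hZ : Measurable Z) {f : Space d → ℝ} (hf : Measurable f) {C : ℝ}
    (hC : ∀ x, |f x| ≤ C) {g : Space d → ℝ} (hgm : Measurable g) (hg : Integrable g) :
    ∫ x, f x * ∫ o, g (x + Z o) ∂ν = ∫ o, (∫ x, f x * g (x + Z o)) ∂ν :=
  (integral_shift_dual ν hZ hf hC hgm hg).symm.trans (integral_shift_mul ν hZ hf hC hg)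

/-- Time and the Gaussian variable are treated as one random parameter on `(0, t] × ℝᵈ`. The time
integral is then an average over a random shift, and the general shift lemmas supply Fubini. -/
lemma integral_mul_timeIntegral_shiftAverage {f : Space d → ℝ} (hf : Measurable f) {C : ℝ}
    (hC : ∀ x, |f x| ≤ C) {g : Space d → ℝ} (hg : IsTestFunction g) {t : ℝ} (ht : 0 ≤ t) :
    Integrable (fun x => f x * ∫ s in (0 : ℝ)..t, shiftAverage b S g s x) ∧
    ∫ x, f x * ∫ s in (0 : ℝ)..t, shiftAverage b S g s x =
      ∫ s in (0 : ℝ)..t, ∫ x, f x * shiftAverage b S g s x := by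
  have hgm : Measurable g := hg.1.continuous.measurable
  obtain ⟨K, -, hK⟩ := hg.bounded
  set ν : Measure (ℝ × Space d) := (volume.restrict (Ioc 0 t)).prod (gauss d)
  have hZ : Measurable fun p : ℝ × Space d => limitShift b S p.1 p.2 :=
    continuous_limitShift.measurable
  have hν : ∀ x, ∫ s in (0 : ℝ)..t, shiftAverage b S g s x =
      ∫ p, g (x + limitShift b S p.1 p.2) ∂ν := by
    intro x
    rw [intervalIntegral.integral_of_le ht, integral_prod]
    · rfl
    · exact Integrable.of_bound (hgm.comp (measurable_const.add hZ)).aestronglyMeasurable K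
        (ae_of_all _ fun p => hK _)
  simp_rw [hν]
  constructor
  · exact (integrable_shift_prod ν hZ hgm hg.integrable).integral_prod_right.bdd_mul
      hf.aestronglyMeasurable (ae_of_all _ hC)
  · rw [integral_mul_shift ν hZ hf hC hgm hg.integrable, intervalIntegral.integral_of_le ht,
      integral_prod]
    · refine integral_congr_ae (ae_of_all _ fun s => ?_)
      exact (integral_mul_shift (gauss d) (measurable_limitShift s) hf hC hgm hg.integrable).symm
    · have hm : StronglyMeasurable fun q : (ℝ × Space d) × Space d =>
          f q.2 * g (q.2 + limitShift b S q.1.1 q.1.2) :=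
        ((hf.comp measurable_snd).mul (hgm.comp
          (measurable_snd.add (hZ.comp measurable_fst)))).stronglyMeasurable
      refine Integrable.of_bound hm.integral_prod_right.aestronglyMeasurable (C * ∫ x, |g x|)
        (ae_of_all _ fun p => ?_)
      have := abs_integral_mul_le hC (hg.comp_add_right (limitShift b S p.1 p.2)).integrable
      rwa [integral_add_right_eq_self (fun x => |g x|)] at this

/-- Pairing the semigroup identity with a bounded function. -/
lemma integral_mul_shiftAverage {f : Space d → ℝ} (hf : Measurable f) {C : ℝ}
    (hC : ∀ x, |f x| ≤ C) {φ : Space d → ℝ} (hφ : IsTestFunction φ) {t : ℝ} (ht : 0 ≤ t) :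
    ∫ x, f x * shiftAverage b S φ t x = (∫ x, f x * φ x) +
      ∫ s in (0 : ℝ)..t, ∫ x, f x * shiftAverage b S (generator (-b) S φ) s x := by
  obtain ⟨h1, h2⟩ := integral_mul_timeIntegral_shiftAverage (b := b) (S := S) hf hC
    (hφ.generator (b := -b) (S := S)) ht
  rw [← h2, ← integral_add (integrable_mul_of_bounded hf hC hφ.integrable) h1]
  refine integral_congr_ae (ae_of_all _ fun x => ?_)
  simp only
  rw [shiftAverage_eq_add_integral hφ ht, mul_add]

lemma isBoundedWeakSolution_limitDensity {Q : Matrix (Fin d) (Fin d) ℝ} (hS : IsRootOf S Q)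
    {f : Space d → ℝ} (hf : Measurable f) {C : ℝ} (hC : ∀ x, |f x| ≤ C) :
    IsBoundedWeakSolution b Q f (limitDensity b S f) where
  measurable := measurable_limitDensity hf
  bounded := ⟨C, fun t _ x => abs_limitDensity_le hC t x⟩
  weak φ hφ t ht := by
    rw [transportDiffusion_eq_generator hS hφ.contDiff_two]
    have hL : IsTestFunction (generator (-b) S φ) := hφ.generator
    rw [integral_limitDensity_mul hf hC hφ.1.continuous.measurable hφ.integrable,
      integral_mul_shiftAverage hf hC hφ ht]
    simp_rw [integral_limitDensity_mul hf hC hL.1.continuous.measurable hL.integrable]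

/-! ### Uniqueness of bounded weak solutions -/

/-- A function whose increments are at most quadratic is constant. -/
lemma eq_of_abs_sub_le_sq {f : ℝ → ℝ} {t K : ℝ} (ht : 0 ≤ t)
    (h : ∀ s s', 0 ≤ s → s ≤ s' → s' ≤ t → |f s' - f s| ≤ K * (s' - s) ^ 2) : f t = f 0 := by
  -- Cut `[0, t]` into `n + 1` equal steps: each contributes at most `K (t / (n + 1))²`, so the
  -- total is of order `1 / n`.
  have hK : ∀ n : ℕ, |f t - f 0| ≤ (K * t ^ 2) / ((n : ℝ) + 1) := by
    intro n
    have hn : (0 : ℝ) < n + 1 := by positivity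
    have hs : ∀ m : ℕ, m ≤ n + 1 → |f (m * (t / (n + 1))) - f 0| ≤ m * (K * (t / (n + 1)) ^ 2) := by
      intro m
      induction m with
      | zero => simp
      | succ m ih =>
        intro hm
        have h1 := ih (by omega)
        have hm' : ((m : ℝ) + 1) ≤ n + 1 := by exact_mod_cast hm
        have h2 := h (m * (t / (n + 1))) ((m + 1 : ℕ) * (t / (n + 1))) (by positivity)
          (by push_cast; nlinarith [div_nonneg ht hn.le])
          (by
            push_cast
            rw [← mul_div_assoc, div_le_iff₀ hn]
            nlinarith)
        have h3 : ((m + 1 : ℕ) * (t / (n + 1)) - m * (t / (n + 1))) = t / ((n : ℝ) + 1) := by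
          push_cast; ring
        rw [h3] at h2
        have h4 := abs_sub_le (f ((m + 1 : ℕ) * (t / (n + 1)))) (f (m * (t / (n + 1)))) (f 0)
        push_cast at h2 h4 ⊢
        linarith
    have h5 := hs (n + 1) le_rfl
    have h6 : ((n + 1 : ℕ) : ℝ) * (t / (n + 1)) = t := by push_cast; field_simp
    rw [h6] at h5
    refine h5.trans_eq ?_
    push_cast
    field_simp
  have hlim : Tendsto (fun n : ℕ => (K * t ^ 2) / ((n : ℝ) + 1)) atTop (𝓝 0) := by
    have := (tendsto_one_div_add_atTop_nhds_zero_nat (𝕜 := ℝ)).const_mul (K * t ^ 2)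
    simpa [div_eq_mul_inv] using this
  have := ge_of_tendsto' hlim hK
  have h0 : |f t - f 0| = 0 := le_antisymm this (abs_nonneg _)
  linarith [abs_eq_zero.1 h0]

/-- The pairing of `w_s` with the semigroup at time `u` applied to a test function. -/
noncomputable def twoTime (b : Space d) (S : Space d →L[ℝ] Space d) (w : ℝ → Space d → ℝ)
    (φ : Space d → ℝ) (s u : ℝ) : ℝ :=
  ∫ x, w s x * shiftAverage b S φ u x

section Uniqueness

variable {w : ℝ → Space d → ℝ} {C : ℝ}

/-- The average is moved onto `w s`, which keeps its bound. The estimate is therefore uniform in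
`u`. -/
lemma abs_twoTime_le (hw : Measurable (Function.uncurry w)) (hC : ∀ t, 0 ≤ t → ∀ x, |w t x| ≤ C)
    {φ : Space d → ℝ} (hφ : IsTestFunction φ) {s : ℝ} (hs : 0 ≤ s) (u : ℝ) :
    |twoTime b S w φ s u| ≤ C * ∫ x, |φ x| := by
  unfold twoTime
  have hws : Measurable (w s) := hw.comp measurable_prodMk_left
  rw [← integral_limitDensity_mul hws (hC s hs) hφ.1.continuous.measurable hφ.integrable]
  exact abs_integral_mul_le (abs_limitDensity_le (hC s hs) u) hφ.integrable

lemma measurable_twoTime (hw : Measurable (Function.uncurry w)) {φ : Space d → ℝ}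
    (hφ : IsTestFunction φ) : Measurable (Function.uncurry (twoTime b S w φ)) := by
  have hm : Measurable (Function.uncurry (shiftAverage b S φ)) :=
    measurable_shiftAverage hφ.1.continuous.measurable
  have : StronglyMeasurable fun p : (ℝ × ℝ) × Space d =>
      w p.1.1 p.2 * shiftAverage b S φ p.1.2 p.2 := by
    refine Measurable.stronglyMeasurable (Measurable.mul ?_ ?_)
    · exact hw.comp ((measurable_fst.comp measurable_fst).prodMk measurable_snd)
    · exact hm.comp ((measurable_snd.comp measurable_fst).prodMk measurable_snd)
  exact (this.integral_prod_right (ν := volume)).measurable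

lemma intervalIntegrable_twoTime_left (hw : Measurable (Function.uncurry w))
    (hC : ∀ t, 0 ≤ t → ∀ x, |w t x| ≤ C) {φ : Space d → ℝ} (hφ : IsTestFunction φ)
    {s t : ℝ} (hs : 0 ≤ s) (ht : 0 ≤ t) (u : ℝ) :
    IntervalIntegrable (fun r => twoTime b S w φ r u) volume s t := by
  refine intervalIntegrable_of_bounded (C := C * ∫ x, |φ x|)
    ((measurable_twoTime hw hφ).comp measurable_prodMk_right) fun r hr => ?_
  refine abs_twoTime_le hw hC hφ ?_ u
  rcases mem_uIoc.1 hr with h | h <;> linarith [h.1]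

lemma intervalIntegrable_twoTime_right (hw : Measurable (Function.uncurry w))
    (hC : ∀ t, 0 ≤ t → ∀ x, |w t x| ≤ C) {φ : Space d → ℝ} (hφ : IsTestFunction φ)
    {r : ℝ} (hr : 0 ≤ r) (s t : ℝ) :
    IntervalIntegrable (fun u => twoTime b S w φ r u) volume s t :=
  intervalIntegrable_of_bounded (C := C * ∫ x, |φ x|)
    ((measurable_twoTime hw hφ).comp measurable_prodMk_left) fun u _ =>
      abs_twoTime_le hw hC hφ hr u

lemma twoTime_eq_integral_right (hw : Measurable (Function.uncurry w))
    (hC : ∀ t, 0 ≤ t → ∀ x, |w t x| ≤ C) {φ : Space d → ℝ} (hφ : IsTestFunction φ)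
    {s u : ℝ} (hs : 0 ≤ s) (hu : 0 ≤ u) :
    twoTime b S w φ s u = twoTime b S w φ s 0 +
      ∫ v in (0 : ℝ)..u, twoTime b S w (generator (-b) S φ) s v := by
  have hws : Measurable (w s) := hw.comp measurable_prodMk_left
  unfold twoTime
  rw [integral_mul_shiftAverage hws (hC s hs) hφ hu, shiftAverage_zero]

/-- The semigroup applied to `φ` need not have compact support, so it cannot be inserted into the
weak equation. It is however an average of translates of `φ`: the equation is tested with each
translate, the generator commutes with translations, and the result is averaged. -/
lemma twoTime_eq_integral_left (hw : Measurable (Function.uncurry w))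
    (hC : ∀ t, 0 ≤ t → ∀ x, |w t x| ≤ C)
    (heq : ∀ φ, IsTestFunction φ → ∀ t, 0 ≤ t →
      ∫ x, w t x * φ x = ∫ s in (0 : ℝ)..t, ∫ x, w s x * generator (-b) S φ x)
    {φ : Space d → ℝ} (hφ : IsTestFunction φ) {s : ℝ} (hs : 0 ≤ s) (u : ℝ) :
    twoTime b S w φ s u = ∫ r in (0 : ℝ)..s, twoTime b S w (generator (-b) S φ) r u := by
  have hL : IsTestFunction (generator (-b) S φ) := hφ.generator
  have hdual : ∀ {ψ : Space d → ℝ}, IsTestFunction ψ → ∀ r, 0 ≤ r → twoTime b S w ψ r u =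
      ∫ n, (∫ x, w r x * ψ (x + limitShift b S u n)) ∂(gauss d) := by
    intro ψ hψ r hr
    have hwr : Measurable (w r) := hw.comp measurable_prodMk_left
    unfold twoTime
    rw [← integral_limitDensity_mul hwr (hC r hr) hψ.1.continuous.measurable hψ.integrable]
    exact integral_shift_mul (gauss d) (measurable_limitShift u) hwr (hC r hr) hψ.integrable
  rw [hdual hφ s hs]
  have h1 : ∀ n, ∫ x, w s x * φ (x + limitShift b S u n) =
      ∫ r in (0 : ℝ)..s, ∫ x, w r x * generator (-b) S φ (x + limitShift b S u n) := by
    intro n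
    rw [heq _ (hφ.comp_add_right (limitShift b S u n)) s hs]
    simp_rw [generator_comp_add_right]
  simp_rw [h1, intervalIntegral.integral_of_le hs]
  rw [integral_integral_swap]
  · refine setIntegral_congr_fun measurableSet_Ioc fun r hr => ?_
    exact (hdual hL r hr.1.le).symm
  · have hm : StronglyMeasurable fun p : (Space d × ℝ) × Space d =>
        w p.1.2 p.2 * generator (-b) S φ (p.2 + limitShift b S u p.1.1) := by
      refine Measurable.stronglyMeasurable (Measurable.mul ?_ (hL.1.continuous.measurable.comp ?_))
      · exact hw.comp ((measurable_snd.comp measurable_fst).prodMk measurable_snd)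
      · exact measurable_snd.add
          ((measurable_limitShift u).comp (measurable_fst.comp measurable_fst))
    refine Integrable.of_bound (C := C * ∫ x, |generator (-b) S φ x|)
      hm.integral_prod_right.aestronglyMeasurable ?_
    have hae : ∀ᵐ p : Space d × ℝ ∂((gauss d).prod (volume.restrict (Ioc 0 s))), p.2 ∈ Ioc 0 s :=
      Measure.quasiMeasurePreserving_snd.ae (ae_restrict_mem measurableSet_Ioc)
    filter_upwards [hae] with p hp
    have := abs_integral_mul_le (hC p.2 hp.1.le) ((hL.comp_add_right (limitShift b S u p.1)).integrable)
    rwa [integral_add_right_eq_self (fun x => |generator (-b) S φ x|)] at this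

/-- A bounded weak solution with initial value zero vanishes. -/
lemma integral_mul_eq_zero_of_weak (hw : Measurable (Function.uncurry w))
    (hC : ∀ t, 0 ≤ t → ∀ x, |w t x| ≤ C)
    (heq : ∀ φ, IsTestFunction φ → ∀ t, 0 ≤ t →
      ∫ x, w t x * φ x = ∫ s in (0 : ℝ)..t, ∫ x, w s x * generator (-b) S φ x)
    {φ : Space d → ℝ} (hφ : IsTestFunction φ) {t : ℝ} (ht : 0 ≤ t) :
    ∫ x, w t x * φ x = 0 := by
  have hL : IsTestFunction (generator (-b) S φ) := hφ.generator
  have hLL : IsTestFunction (generator (-b) S (generator (-b) S φ)) := hL.generator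
  have dleft : ∀ {ψ : Space d → ℝ}, IsTestFunction ψ → ∀ s s' u, 0 ≤ s → 0 ≤ s' →
      twoTime b S w ψ s' u - twoTime b S w ψ s u =
        ∫ r in s..s', twoTime b S w (generator (-b) S ψ) r u := by
    intro ψ hψ s s' u hs hs'
    rw [twoTime_eq_integral_left hw hC heq hψ hs', twoTime_eq_integral_left hw hC heq hψ hs]
    exact intervalIntegral.integral_interval_sub_left
      (intervalIntegrable_twoTime_left hw hC hψ.generator le_rfl hs' u)
      (intervalIntegrable_twoTime_left hw hC hψ.generator le_rfl hs u)
  have dright : ∀ {ψ : Space d → ℝ}, IsTestFunction ψ → ∀ s u u', 0 ≤ s → 0 ≤ u → 0 ≤ u' →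
      twoTime b S w ψ s u' - twoTime b S w ψ s u =
        ∫ v in u..u', twoTime b S w (generator (-b) S ψ) s v := by
    intro ψ hψ s u u' hs hu hu'
    rw [twoTime_eq_integral_right hw hC hψ hs hu', twoTime_eq_integral_right hw hC hψ hs hu,
      add_sub_add_left_eq_sub]
    exact intervalIntegral.integral_interval_sub_left
      (intervalIntegrable_twoTime_right hw hC hψ.generator hs _ _)
      (intervalIntegrable_twoTime_right hw hC hψ.generator hs _ _)
  set D := C * ∫ x, |generator (-b) S (generator (-b) S φ) x| with hD
  have lip1 : ∀ s s' u, 0 ≤ s → 0 ≤ s' → |twoTime b S w (generator (-b) S φ) s' u -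
      twoTime b S w (generator (-b) S φ) s u| ≤ D * |s' - s| := by
    intro s s' u hs hs'
    rw [dleft hL s s' u hs hs', ← Real.norm_eq_abs]
    refine intervalIntegral.norm_integral_le_of_norm_le_const fun r hr => ?_
    refine abs_twoTime_le hw hC hLL ?_ u
    rcases mem_uIoc.1 hr with h | h <;> linarith [h.1]
  have lip2 : ∀ s u u', 0 ≤ s → 0 ≤ u → 0 ≤ u' → |twoTime b S w (generator (-b) S φ) s u' -
      twoTime b S w (generator (-b) S φ) s u| ≤ D * |u' - u| := by
    intro s u u' hs hu hu'
    rw [dright hL s u u' hs hu hu', ← Real.norm_eq_abs]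
    exact intervalIntegral.norm_integral_le_of_norm_le_const fun r _ => abs_twoTime_le hw hC hLL hs r
  have hD0 : 0 ≤ D := (abs_nonneg _).trans (abs_twoTime_le (b := b) (S := S) hw hC hLL le_rfl 0)
  -- Formally the derivative of `s ↦ twoTime s (t - s)` is zero, because both variables contribute
  -- the same pairing with the generator, with opposite signs. The Lipschitz bounds `lip1` and
  -- `lip2` make this quantitative: the increments are quadratic.
  have main : (fun s => twoTime b S w φ s (t - s)) t = (fun s => twoTime b S w φ s (t - s)) 0 := by
    refine eq_of_abs_sub_le_sq (f := fun s => twoTime b S w φ s (t - s)) (K := 2 * D) ht fun s s' hs hss hs' => ?_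
    -- Go from `(s, t - s)` to `(s', t - s')` through the corner `(s, t - s')`. Both legs have
    -- first-order term `(s' - s) k`, and each has an error of at most `D (s' - s)²`; hence the
    -- constant `2 * D`.
    set k := twoTime b S w (generator (-b) S φ) s (t - s') with hk
    have e1 : (twoTime b S w φ s' (t - s') - twoTime b S w φ s (t - s')) - (s' - s) * k =
        ∫ r in s..s', (twoTime b S w (generator (-b) S φ) r (t - s') - k) := by
      rw [dleft hφ s s' _ hs (hs.trans hss), intervalIntegral.integral_sub
        (intervalIntegrable_twoTime_left hw hC hL hs (hs.trans hss) _)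
        intervalIntegrable_const]
      simp
    have e2 : (twoTime b S w φ s (t - s) - twoTime b S w φ s (t - s')) - (s' - s) * k =
        ∫ v in (t - s')..(t - s), (twoTime b S w (generator (-b) S φ) s v - k) := by
      rw [dright hφ s (t - s') (t - s) hs (by linarith) (by linarith),
        intervalIntegral.integral_sub (intervalIntegrable_twoTime_right hw hC hL hs _ _)
        intervalIntegrable_const]
      simp
    have b1 : |∫ r in s..s', (twoTime b S w (generator (-b) S φ) r (t - s') - k)| ≤
        D * (s' - s) * |s' - s| := by
      rw [← Real.norm_eq_abs]
      refine intervalIntegral.norm_integral_le_of_norm_le_const fun r hr => ?_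
      rw [uIoc_of_le hss] at hr
      refine (lip1 s r (t - s') hs (hs.trans hr.1.le)).trans ?_
      rw [abs_of_nonneg (by linarith [hr.1])]
      exact mul_le_mul_of_nonneg_left (by linarith [hr.2]) hD0
    have b2 : |∫ v in (t - s')..(t - s), (twoTime b S w (generator (-b) S φ) s v - k)| ≤
        D * (s' - s) * |(t - s) - (t - s')| := by
      rw [← Real.norm_eq_abs]
      refine intervalIntegral.norm_integral_le_of_norm_le_const fun v hv => ?_
      rw [uIoc_of_le (by linarith)] at hv
      refine (lip2 s (t - s') v hs (by linarith) (by linarith [hv.1])).trans ?_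
      rw [abs_of_nonneg (by linarith [hv.1])]
      exact mul_le_mul_of_nonneg_left (by linarith [hv.2]) hD0
    rw [← e1] at b1
    rw [← e2] at b2
    rw [abs_of_nonneg (show 0 ≤ s' - s by linarith)] at b1
    rw [abs_of_nonneg (show 0 ≤ (t - s) - (t - s') by linarith)] at b2
    rw [abs_le] at b1 b2 ⊢
    constructor <;> nlinarith [b1.1, b1.2, b2.1, b2.2]
  simp only [sub_self, sub_zero] at main
  -- At `s = 0` the pairing is an integral over an empty interval; at `s = t` the semigroup is the
  -- identity.
  rw [twoTime_eq_integral_left hw hC heq hφ le_rfl] at main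
  simpa [twoTime, shiftAverage_zero] using main

end Uniqueness

/-- By linearity the difference of two solutions solves the equation with initial value zero. It
then annihilates all test functions, so it vanishes almost everywhere. -/
lemma isUniqueBoundedWeakSolution_limitDensity {Q : Matrix (Fin d) (Fin d) ℝ} (hS : IsRootOf S Q)
    {f : Space d → ℝ} (hf : Measurable f) {C : ℝ} (hC : ∀ x, |f x| ≤ C) :
    IsUniqueBoundedWeakSolution b Q f (limitDensity b S f) := by
  have hr := isBoundedWeakSolution_limitDensity (b := b) hS hf hC
  refine ⟨hr, fun r' hr' t ht => ?_⟩
  obtain ⟨C', hC'⟩ := hr'.bounded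
  set r := limitDensity b S f
  have hw : Measurable (Function.uncurry fun t x => r' t x - r t x) :=
    hr'.measurable.sub hr.measurable
  have hwC : ∀ t, 0 ≤ t → ∀ x, |r' t x - r t x| ≤ C' + C := fun t ht x =>
    (abs_sub _ _).trans (add_le_add (hC' t ht x) (abs_limitDensity_le hC t x))
  have mr : ∀ t, Measurable (r t) := fun t => hr.measurable.comp measurable_prodMk_left
  have mr' : ∀ t, Measurable (r' t) := fun t => hr'.measurable.comp measurable_prodMk_left
  have hsub : ∀ {φ : Space d → ℝ}, IsTestFunction φ → ∀ t, 0 ≤ t →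
      ∫ x, (r' t x - r t x) * φ x = (∫ x, r' t x * φ x) - ∫ x, r t x * φ x := by
    intro φ hφ t ht
    simp_rw [sub_mul]
    exact integral_sub (integrable_mul_of_bounded (mr' t) (hC' t ht) hφ.integrable)
      (integrable_mul_of_bounded (mr t) (abs_limitDensity_le hC t) hφ.integrable)
  have hii : ∀ {φ : Space d → ℝ} (q : ℝ → Space d → ℝ) (K : ℝ), IsTestFunction φ →
      Measurable (Function.uncurry q) → (∀ t, 0 ≤ t → ∀ x, |q t x| ≤ K) → ∀ t, 0 ≤ t →
      IntervalIntegrable (fun s => ∫ x, q s x * φ x) volume 0 t := by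
    intro φ q K hφ hq hK t ht
    refine intervalIntegrable_of_bounded (C := K * ∫ x, |φ x|)
      (measurable_integral_mul hq hφ.1.continuous.measurable) fun s hs => ?_
    rw [uIoc_of_le ht] at hs
    exact abs_integral_mul_le (hK s hs.1.le) hφ.integrable
  have hzero : ∀ φ, IsTestFunction φ → ∫ x, (r' t x - r t x) * φ x = 0 := by
    intro φ hφ
    refine integral_mul_eq_zero_of_weak (b := b) (S := S) (w := fun t x => r' t x - r t x)
      hw hwC ?_ hφ ht
    intro ψ hψ s hs
    have hL : IsTestFunction (generator (-b) S ψ) := hψ.generator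
    have e1 := hr'.weak ψ hψ s hs
    have e2 := hr.weak ψ hψ s hs
    rw [transportDiffusion_eq_generator hS hψ.contDiff_two] at e1 e2
    rw [hsub hψ s hs, e1, e2, add_sub_add_left_eq_sub, ← intervalIntegral.integral_sub
      (hii r' C' hL hr'.measurable hC' s hs)
      (hii r C hL hr.measurable (fun t _ => abs_limitDensity_le hC t) s hs)]
    refine intervalIntegral.integral_congr fun v hv => ?_
    rw [uIcc_of_le hs] at hv
    exact (hsub hL v hv.1).symm
  have hloc : LocallyIntegrable (fun x => r' t x - r t x) :=
    (locallyIntegrable_const (C' + C)).mono ((mr' t).sub (mr t)).aestronglyMeasurable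
      (ae_of_all _ fun x => (hwC t ht x).trans (le_abs_self _))
  have hae := ae_eq_zero_of_integral_contDiff_smul_eq_zero hloc fun g hg hgc => by
    have := hzero g ⟨hg, hgc⟩
    simpa [mul_comm] using this
  filter_upwards [hae] with x hx
  linarith

end FreeKawasaki

namespace FreeKawasaki

/-! ### Smoothness of Gaussian averages -/

section Laplace

variable {E : Type*} [NormedAddCommGroup E] [InnerProductSpace ℝ E] [FiniteDimensional ℝ E]
  [MeasurableSpace E] [BorelSpace E]

/-- Measurable functions of at most exponential growth. -/
def ExpGrowth (G : E → ℝ) : Prop :=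
  Measurable G ∧ ∃ C c : ℝ, 0 ≤ C ∧ ∀ y, |G y| ≤ C * Real.exp (c * ‖y‖)

omit [InnerProductSpace ℝ E] [FiniteDimensional ℝ E] [BorelSpace E] in
lemma expGrowth_of_bounded {G : E → ℝ} (hG : Measurable G) {C : ℝ} (hC : ∀ y, |G y| ≤ C) :
    ExpGrowth G :=
  ⟨hG, C, 0, (abs_nonneg _).trans (hC 0), fun y => by simpa using hC y⟩

/-- Differentiating the transform brings down factors `⟨v, y⟩` and `‖y‖²`. Exponential growth is
preserved by both, which bounded functions would not be. -/
lemma ExpGrowth.inner_mul {G : E → ℝ} (hG : ExpGrowth G) (v : E) :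
    ExpGrowth fun y => inner ℝ v y * G y := by
  obtain ⟨hm, C, c, hC0, hC⟩ := hG
  refine ⟨(by fun_prop : Measurable fun y : E => inner ℝ v y).mul hm, ‖v‖ * C, c + 1,
    by positivity, fun y => ?_⟩
  rw [abs_mul, add_mul, Real.exp_add, one_mul]
  have h1 : |inner ℝ v y| ≤ ‖v‖ * Real.exp ‖y‖ :=
    (abs_real_inner_le_norm v y).trans (by
      gcongr; linarith [Real.add_one_le_exp ‖y‖])
  calc |inner ℝ v y| * |G y| ≤ (‖v‖ * Real.exp ‖y‖) * (C * Real.exp (c * ‖y‖)) :=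
        mul_le_mul h1 (hC y) (abs_nonneg _) (by positivity)
    _ = _ := by ring

omit [InnerProductSpace ℝ E] [FiniteDimensional ℝ E] in
lemma ExpGrowth.norm_sq_mul {G : E → ℝ} (hG : ExpGrowth G) :
    ExpGrowth fun y => ‖y‖ ^ 2 * G y := by
  obtain ⟨hm, C, c, hC0, hC⟩ := hG
  refine ⟨(by fun_prop : Measurable fun y : E => ‖y‖ ^ 2).mul hm, 2 * C, c + 1,
    by positivity, fun y => ?_⟩
  rw [abs_mul, add_mul, Real.exp_add, one_mul]
  have h1 : |‖y‖ ^ 2| ≤ 2 * Real.exp ‖y‖ := by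
    rw [abs_of_nonneg (by positivity)]
    have := Real.quadratic_le_exp_of_nonneg (norm_nonneg y)
    linarith [norm_nonneg y]
  calc |‖y‖ ^ 2| * |G y| ≤ (2 * Real.exp ‖y‖) * (C * Real.exp (c * ‖y‖)) :=
        mul_le_mul h1 (hC y) (abs_nonneg _) (by positivity)
    _ = _ := by ring

/-- Completing the square: `c r ≤ c² / (2s) + s r² / 2`, which leaves half of the Gaussian decay. -/
lemma integrable_exp_norm_sub_sq (c : ℝ) {s : ℝ} (hs : 0 < s) :
    Integrable fun y : E => Real.exp (c * ‖y‖ - s * ‖y‖ ^ 2) := by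
  have h0 : Integrable fun y : E => Real.exp (-(s / 2) * ‖y‖ ^ 2) := by
    have h := (GaussianFourier.integrable_cexp_neg_mul_sq_norm_add (V := E) (b := ((s / 2 : ℝ) : ℂ))
      (by simpa using hs) 0 0).norm
    refine h.congr (ae_of_all _ fun n => ?_)
    simp only [Complex.norm_exp]
    congr 1
    simp only [zero_mul, add_zero]
    norm_cast
  refine (h0.const_mul (Real.exp (c ^ 2 / (2 * s)))).mono'
    (by fun_prop) (ae_of_all _ fun y => ?_)
  rw [Real.norm_of_nonneg (Real.exp_pos _).le, ← Real.exp_add]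
  refine Real.exp_le_exp.2 ?_
  have : 0 ≤ (c - s * ‖y‖) ^ 2 / (2 * s) := by positivity
  have e : (c - s * ‖y‖) ^ 2 / (2 * s) = c ^ 2 / (2 * s) - c * ‖y‖ + s / 2 * ‖y‖ ^ 2 := by
    field_simp
    ring
  linarith

/-! ### Differentiating Gaussian-type integrals in their parameters. -/

section Exponent

variable {P : Type*} [NormedAddCommGroup P] [NormedSpace ℝ P]

/-- The exponent `p ↦ -s(p) |y|² / 2 + ⟨y, w(p)⟩` of the Laplace transform. -/
noncomputable def laplaceExponent (s : P →L[ℝ] ℝ) (w : P →L[ℝ] E) (y : E) : P →L[ℝ] ℝ :=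
  (-‖y‖ ^ 2 / 2) • s + (innerSL ℝ y).comp w

variable (s : P →L[ℝ] ℝ) (w : P →L[ℝ] E)

omit [FiniteDimensional ℝ E] [MeasurableSpace E] [BorelSpace E] in
lemma laplaceExponent_apply (y : E) (p : P) :
    laplaceExponent s w y p = -‖y‖ ^ 2 / 2 * s p + inner ℝ y (w p) := by
  simp [laplaceExponent]

omit [FiniteDimensional ℝ E] [MeasurableSpace E] [BorelSpace E] in
lemma continuous_laplaceExponent : Continuous (laplaceExponent s w) := by
  unfold laplaceExponent
  have h1 : Continuous fun y : E => -‖y‖ ^ 2 / 2 := by fun_prop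
  exact (h1.smul continuous_const).add ((innerSL ℝ).continuous.clm_comp continuous_const)

omit [FiniteDimensional ℝ E] [MeasurableSpace E] [BorelSpace E] in
lemma norm_laplaceExponent_le (y : E) :
    ‖laplaceExponent s w y‖ ≤ (‖s‖ + ‖w‖) * (2 * Real.exp ‖y‖) := by
  have h1 := Real.quadratic_le_exp_of_nonneg (norm_nonneg y)
  have h2 : ‖-‖y‖ ^ 2 / 2‖ = ‖y‖ ^ 2 / 2 := by
    rw [norm_div, norm_neg, norm_pow, norm_norm]; simp
  calc ‖laplaceExponent s w y‖ ≤ ‖y‖ ^ 2 / 2 * ‖s‖ + ‖y‖ * ‖w‖ := by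
        refine (norm_add_le _ _).trans (add_le_add ?_ ?_)
        · rw [norm_smul, h2]
        · exact (ContinuousLinearMap.opNorm_comp_le _ _).trans_eq (by rw [innerSL_apply_norm])
    _ ≤ (2 * Real.exp ‖y‖) * ‖s‖ + (2 * Real.exp ‖y‖) * ‖w‖ := by
        gcongr <;> nlinarith [norm_nonneg y, sq_nonneg ‖y‖]
    _ = _ := by ring

omit [FiniteDimensional ℝ E] [MeasurableSpace E] [BorelSpace E] in
lemma abs_mul_exp_laplaceExponent_le {G : E → ℝ} {C c : ℝ} (hC0 : 0 ≤ C)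
    (hC : ∀ y, |G y| ≤ C * Real.exp (c * ‖y‖)) {p : P} {r R : ℝ} (hs : r ≤ s p)
    (hR : ‖w p‖ ≤ R) (y : E) :
    |G y * Real.exp (laplaceExponent s w y p)| ≤
      C * Real.exp ((c + R) * ‖y‖ - (r / 2) * ‖y‖ ^ 2) := by
  rw [abs_mul, abs_of_pos (Real.exp_pos _)]
  calc |G y| * Real.exp (laplaceExponent s w y p)
      ≤ (C * Real.exp (c * ‖y‖)) * Real.exp (R * ‖y‖ - (r / 2) * ‖y‖ ^ 2) := by
        refine mul_le_mul (hC y) (Real.exp_le_exp.2 ?_) (Real.exp_pos _).le (by positivity)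
        rw [laplaceExponent_apply]
        have h1 := real_inner_le_norm y (w p)
        have h2 : ‖y‖ * ‖w p‖ ≤ ‖y‖ * R := mul_le_mul_of_nonneg_left hR (norm_nonneg _)
        have h3 : r * ‖y‖ ^ 2 ≤ s p * ‖y‖ ^ 2 := mul_le_mul_of_nonneg_right hs (by positivity)
        nlinarith
    _ = _ := by rw [mul_assoc, ← Real.exp_add]; ring_nf

lemma ExpGrowth.measurable_mul_exp {G : E → ℝ} (hG : ExpGrowth G) (p : P) :
    Measurable fun y => G y * Real.exp (laplaceExponent s w y p) := by
  refine hG.1.mul ?_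
  simp only [laplaceExponent_apply]
  fun_prop

lemma ExpGrowth.integrable_mul_exp {G : E → ℝ} (hG : ExpGrowth G) {p : P} (hp : 0 < s p) :
    Integrable fun y => G y * Real.exp (laplaceExponent s w y p) := by
  have hm := hG.measurable_mul_exp s w p
  obtain ⟨-, C, c, hC0, hC⟩ := hG
  exact ((integrable_exp_norm_sub_sq (c + ‖w p‖) (half_pos hp)).const_mul C).mono'
    hm.aestronglyMeasurable
    (ae_of_all _ (abs_mul_exp_laplaceExponent_le s w hC0 hC le_rfl le_rfl))

/-- The exponent is linear in the parameter, so differentiating the integrand only multiplies it by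
the exponent itself. This factor grows at most exponentially in `‖y‖` and is absorbed by the
Gaussian decay. -/
lemma hasFDerivAt_integral_mul_exp {G : E → ℝ} (hG : ExpGrowth G) {p : P} (hp : 0 < s p) :
    ∃ A : P →L[ℝ] ℝ,
      HasFDerivAt (fun q => ∫ y, G y * Real.exp (laplaceExponent s w y q)) A p ∧
      ∀ v, A v = ∫ y, G y * Real.exp (laplaceExponent s w y p) * laplaceExponent s w y v := by
  have hint := hG.integrable_mul_exp s w hp
  have hmeas := hG.measurable_mul_exp s w
  obtain ⟨hm, C, c, hC0, hC⟩ := hG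
  set r := s p / 2 with hr
  have hr0 : 0 < r := by positivity
  set R := ‖w p‖ + 1 with hR
  set bound : E → ℝ := fun y => C * (‖s‖ + ‖w‖) * 2 *
    Real.exp ((c + R + 1) * ‖y‖ - (r / 2) * ‖y‖ ^ 2) with hbound
  have hbi : Integrable bound := (integrable_exp_norm_sub_sq _ (half_pos hr0)).const_mul _
  -- On this neighbourhood the Gaussian decay rate stays above `s p / 2` and the linear term below
  -- `‖w p‖ + 1`, so one dominating function serves all `q`.
  set U : Set P := {q | r < s q} ∩ {q | ‖w q‖ < R} with hU
  have hUn : U ∈ 𝓝 p := by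
    refine inter_mem ?_ ?_
    · exact (isOpen_lt continuous_const s.continuous).mem_nhds (by
        simp only [Set.mem_ofPred_eq]; linarith)
    · exact (isOpen_lt w.continuous.norm continuous_const).mem_nhds (by
        simp only [Set.mem_ofPred_eq]; linarith)
  have hbd : ∀ y : E, ∀ q ∈ U,
      ‖(G y * Real.exp (laplaceExponent s w y q)) • laplaceExponent s w y‖ ≤ bound y := by
    intro y q hq
    rw [norm_smul]
    calc _ ≤ (C * Real.exp ((c + R) * ‖y‖ - (r / 2) * ‖y‖ ^ 2)) *
          ((‖s‖ + ‖w‖) * (2 * Real.exp ‖y‖)) :=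
          mul_le_mul (abs_mul_exp_laplaceExponent_le s w hC0 hC hq.1.le hq.2.le y)
            (norm_laplaceExponent_le s w y) (norm_nonneg _) (by positivity)
      _ = C * (‖s‖ + ‖w‖) * 2 *
          (Real.exp ((c + R) * ‖y‖ - (r / 2) * ‖y‖ ^ 2) * Real.exp ‖y‖) := by ring
      _ = bound y := by rw [hbound, ← Real.exp_add]; ring_nf
  have hF' : AEStronglyMeasurable
      (fun y => (G y * Real.exp (laplaceExponent s w y p)) • laplaceExponent s w y) volume :=
    (hmeas p).aestronglyMeasurable.smul (continuous_laplaceExponent s w).aestronglyMeasurable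
  have hI : Integrable
      (fun y => (G y * Real.exp (laplaceExponent s w y p)) • laplaceExponent s w y) :=
    hbi.mono' hF' (ae_of_all _ fun y => hbd y p (mem_of_mem_nhds hUn))
  refine ⟨∫ y, (G y * Real.exp (laplaceExponent s w y p)) • laplaceExponent s w y, ?_,
    fun v => ?_⟩
  · refine hasFDerivAt_integral_of_dominated_of_fderiv_le (F := fun q y =>
      G y * Real.exp (laplaceExponent s w y q)) (F' := fun q y =>
      (G y * Real.exp (laplaceExponent s w y q)) • laplaceExponent s w y)
      hUn (Eventually.of_forall fun q => (hmeas q).aestronglyMeasurable) hint hF'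
      (ae_of_all _ hbd) hbi (ae_of_all _ fun y q _ => ?_)
    have h := ((laplaceExponent s w y).hasFDerivAt (x := q)).exp.const_mul (G y)
    rwa [smul_smul] at h
  · rw [ContinuousLinearMap.integral_apply hI]
    simp

end Exponent

/-- The Laplace transform of `G`. -/
noncomputable def laplace (G : E → ℝ) (p : ℝ × E) : ℝ :=
  ∫ y, G y * Real.exp (-‖y‖ ^ 2 / 2 * p.1 + inner ℝ y p.2)

lemma ExpGrowth.integrable {G : E → ℝ} (hG : ExpGrowth G) {p : ℝ × E} (hp : 0 < p.1) :
    Integrable fun y => G y * Real.exp (-‖y‖ ^ 2 / 2 * p.1 + inner ℝ y p.2) := by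
  have := hG.integrable_mul_exp (ContinuousLinearMap.fst ℝ ℝ E)
    (ContinuousLinearMap.snd ℝ ℝ E) (p := p) hp
  simpa [laplaceExponent_apply] using this

lemma laplace_deriv_apply {G : E → ℝ} (hG : ExpGrowth G) {p : ℝ × E} (hp : 0 < p.1) :
    ∃ A : ℝ × E →L[ℝ] ℝ, HasFDerivAt (laplace G) A p ∧ ∀ σ v, A (σ, v) =
      -σ / 2 * laplace (fun y => ‖y‖ ^ 2 * G y) p + laplace (fun y => inner ℝ v y * G y) p := by
  obtain ⟨A, h1, h2⟩ := hasFDerivAt_integral_mul_exp (ContinuousLinearMap.fst ℝ ℝ E)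
    (ContinuousLinearMap.snd ℝ ℝ E) hG (p := p) hp
  simp only [laplaceExponent_apply, ContinuousLinearMap.coe_fst',
    ContinuousLinearMap.coe_snd'] at h1 h2
  refine ⟨A, h1, fun σ v => ?_⟩
  rw [h2]
  unfold laplace
  rw [← integral_const_mul, ← integral_add (hG.norm_sq_mul.integrable hp |>.const_mul _)
    ((hG.inner_mul v).integrable hp)]
  refine integral_congr_ae (ae_of_all _ fun y => ?_)
  simp only
  rw [real_inner_comm v y]
  ring

lemma laplace_sum {ι : Type*} (s : Finset ι) (c : ι → ℝ) {G : ι → E → ℝ}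
    (hG : ∀ i, ExpGrowth (G i)) {p : ℝ × E} (hp : 0 < p.1) :
    laplace (fun y => ∑ i ∈ s, c i * G i y) p = ∑ i ∈ s, c i * laplace (G i) p := by
  unfold laplace
  simp_rw [Finset.sum_mul, mul_assoc]
  rw [integral_finsetSum _ fun i _ => ((hG i).integrable hp).const_mul _]
  simp_rw [integral_const_mul]

/-- The logarithm of the prefactor of the heat kernel. -/
noncomputable def heatPrefactor (p : ℝ × E) : ℝ :=
  -(Module.finrank ℝ E / 2 : ℝ) * Real.log (2 * Real.pi * p.1) - ‖p.2‖ ^ 2 * (p.1)⁻¹ / 2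

/-- The heat semigroup applied to `G`, as a Laplace transform. -/
noncomputable def heat (G : E → ℝ) (p : ℝ × E) : ℝ :=
  Real.exp (heatPrefactor p) * laplace G (p.1⁻¹, p.1⁻¹ • p.2)

omit [FiniteDimensional ℝ E] [MeasurableSpace E] [BorelSpace E] in
lemma heatPrefactor_deriv {p : ℝ × E} (hp : 0 < p.1) :
    ∃ A : ℝ × E →L[ℝ] ℝ, HasFDerivAt (heatPrefactor (E := E)) A p ∧ ∀ τ e, A (τ, e) =
      -(Module.finrank ℝ E / 2 : ℝ) * (τ / p.1) + τ * ‖p.2‖ ^ 2 / (2 * p.1 ^ 2)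
        - inner ℝ p.2 e / p.1 := by
  have hfst : HasFDerivAt (fun q : ℝ × E => q.1) (ContinuousLinearMap.fst ℝ ℝ E) p := hasFDerivAt_fst
  have hsnd : HasFDerivAt (fun q : ℝ × E => q.2) (ContinuousLinearMap.snd ℝ ℝ E) p := hasFDerivAt_snd
  have h1 := ((hfst.const_mul (2 * Real.pi)).log (by positivity)).const_mul
    (-(Module.finrank ℝ E / 2 : ℝ))
  have h2 : HasFDerivAt (fun q : ℝ × E => (q.1)⁻¹) _ p :=
    (hasDerivAt_inv hp.ne').comp_hasFDerivAt p hfst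
  have h3 := (hsnd.norm_sq.mul h2).mul_const (2⁻¹)
  refine ⟨_, h1.sub h3, fun τ e => ?_⟩
  simp
  field_simp
  ring

/-- The chain rule along `(t, z) ↦ (1/t, z/t)`. Every derivative of `heat G` is a combination of
`heat` applied to `G` times a polynomial, so the heat equation becomes an algebraic identity. -/
lemma heat_deriv_apply {G : E → ℝ} (hG : ExpGrowth G) {p : ℝ × E} (hp : 0 < p.1) :
    ∃ A : ℝ × E →L[ℝ] ℝ, HasFDerivAt (heat G) A p ∧ ∀ τ e, A (τ, e) =
      (-(Module.finrank ℝ E / 2 : ℝ) * (τ / p.1) + τ * ‖p.2‖ ^ 2 / (2 * p.1 ^ 2)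
        - inner ℝ p.2 e / p.1) * heat G p + τ / (2 * p.1 ^ 2) * heat (fun y => ‖y‖ ^ 2 * G y) p
        + heat (fun y => inner ℝ (p.1⁻¹ • e - (τ / p.1 ^ 2) • p.2) y * G y) p := by
  obtain ⟨A, hA, hAv⟩ := heatPrefactor_deriv hp
  have hp' : 0 < (p.1⁻¹, p.1⁻¹ • p.2).1 := inv_pos.2 hp
  obtain ⟨B, hB, hBv⟩ := laplace_deriv_apply hG hp'
  have hfst : HasFDerivAt (fun q : ℝ × E => q.1) (ContinuousLinearMap.fst ℝ ℝ E) p := hasFDerivAt_fst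
  have hsnd : HasFDerivAt (fun q : ℝ × E => q.2) (ContinuousLinearMap.snd ℝ ℝ E) p := hasFDerivAt_snd
  have h2 : HasFDerivAt (fun q : ℝ × E => (q.1)⁻¹) _ p :=
    (hasDerivAt_inv hp.ne').comp_hasFDerivAt p hfst
  have h3 := hB.comp p (h2.prodMk (h2.smul hsnd))
  refine ⟨_, hA.exp.mul h3, fun τ e => ?_⟩
  simp only [add_apply, smul_apply, ContinuousLinearMap.comp_apply, smul_eq_mul, hAv,
    ContinuousLinearMap.prod_apply, ContinuousLinearMap.coe_fst', ContinuousLinearMap.coe_snd',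
    hBv, ContinuousLinearMap.smulRight_apply]
  have hv : p.1⁻¹ • e + (-(p.1 ^ 2)⁻¹ * τ) • p.2 = p.1⁻¹ • e - (τ / p.1 ^ 2) • p.2 := by
    rw [sub_eq_add_neg, ← neg_smul]
    congr 2
    field_simp
  rw [hv]
  unfold heat
  field_simp
  ring

end Laplace

end FreeKawasaki

namespace FreeKawasaki

/-! ### Spatial derivatives of the heat semigroup and the heat equation. -/

section HeatEquation

variable {E : Type*} [NormedAddCommGroup E] [InnerProductSpace ℝ E] [FiniteDimensional ℝ E]
  [MeasurableSpace E] [BorelSpace E]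

lemma heat_const_mul (c : ℝ) (G : E → ℝ) (p : ℝ × E) :
    heat (fun y => c * G y) p = c * heat G p := by
  unfold heat laplace
  simp_rw [mul_assoc]
  rw [integral_const_mul]
  ring

lemma heat_sum {ι : Type*} (s : Finset ι) (c : ι → ℝ) {G : ι → E → ℝ}
    (hG : ∀ i, ExpGrowth (G i)) {p : ℝ × E} (hp : 0 < p.1) :
    heat (fun y => ∑ i ∈ s, c i * G i y) p = ∑ i ∈ s, c i * heat (G i) p := by
  unfold heat
  rw [laplace_sum s c hG (inv_pos.2 hp), Finset.mul_sum]
  exact Finset.sum_congr rfl fun i _ => by ring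

lemma heat_space_deriv {G : E → ℝ} (hG : ExpGrowth G) {t : ℝ} (ht : 0 < t) (z : E) :
    ∃ A : E →L[ℝ] ℝ, HasFDerivAt (fun z => heat G (t, z)) A z ∧ ∀ e, A e =
      t⁻¹ * (heat (fun y => inner ℝ e y * G y) (t, z) - inner ℝ z e * heat G (t, z)) := by
  obtain ⟨A, hA, hAv⟩ := heat_deriv_apply hG (p := (t, z)) ht
  refine ⟨A.comp (ContinuousLinearMap.inr ℝ ℝ E), hA.comp z (hasFDerivAt_prodMk_right t z),
    fun e => ?_⟩
  rw [ContinuousLinearMap.comp_apply, ContinuousLinearMap.inr_apply, hAv]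
  simp only [zero_div, mul_zero, zero_mul, zero_sub, zero_smul, sub_zero, add_zero]
  simp_rw [real_inner_smul_left, mul_assoc]
  rw [heat_const_mul]
  ring

lemma heat_fderiv_apply {G : E → ℝ} (hG : ExpGrowth G) {t : ℝ} (ht : 0 < t) (z e : E) :
    fderiv ℝ (fun z => heat G (t, z)) z e =
      t⁻¹ * (heat (fun y => inner ℝ e y * G y) (t, z) - inner ℝ z e * heat G (t, z)) := by
  obtain ⟨A, hA, hAv⟩ := heat_space_deriv hG ht z
  rw [hA.fderiv, hAv]

lemma differentiable_heat {G : E → ℝ} (hG : ExpGrowth G) {t : ℝ} (ht : 0 < t) :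
    Differentiable ℝ fun z => heat G (t, z) := fun z => by
  obtain ⟨A, hA, -⟩ := heat_space_deriv hG ht z
  exact hA.differentiableAt

/-- The induction runs over all `G` at once, since the derivative in direction `e` involves `heat`
of `⟨e, ·⟩ G` as well as of `G`. -/
lemma contDiff_heat {t : ℝ} (ht : 0 < t) (n : ℕ) :
    ∀ {G : E → ℝ}, ExpGrowth G → ContDiff ℝ n fun z => heat G (t, z) := by
  induction n with
  | zero => exact fun hG => contDiff_zero.2 (differentiable_heat hG ht).continuous
  | succ n ih =>
    intro G hG
    push_cast
    rw [contDiff_succ_iff_fderiv_apply]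
    refine ⟨differentiable_heat hG ht, by simp, fun e => ?_⟩
    simp_rw [heat_fderiv_apply hG ht]
    exact contDiff_const.mul ((ih (hG.inner_mul e)).sub
      ((contDiff_id.inner ℝ contDiff_const).mul (ih hG)))

omit [InnerProductSpace ℝ E] [FiniteDimensional ℝ E] [MeasurableSpace E] [BorelSpace E] in
lemma fderiv_fderiv_eq [NormedSpace ℝ E] {f : E → ℝ} (hf : ContDiff ℝ 2 f) (x v w : E) :
    fderiv ℝ (fderiv ℝ f) x v w = fderiv ℝ (fun y => fderiv ℝ f y w) x v := by
  have hd : DifferentiableAt ℝ (fderiv ℝ f) x :=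
    (hf.fderiv_right (m := 1) (by norm_num)).differentiable (by norm_num) x
  rw [fderiv_clm_apply hd (differentiableAt_const _)]
  simp

lemma heat_fderiv_fderiv_apply {G : E → ℝ} (hG : ExpGrowth G) {t : ℝ} (ht : 0 < t) (z e : E) :
    fderiv ℝ (fderiv ℝ fun z => heat G (t, z)) z e e =
      t⁻¹ ^ 2 * (heat (fun y => inner ℝ e y * (inner ℝ e y * G y)) (t, z)
        - 2 * (inner ℝ z e * heat (fun y => inner ℝ e y * G y) (t, z))
        + inner ℝ z e ^ 2 * heat G (t, z)) - t⁻¹ * (‖e‖ ^ 2 * heat G (t, z)) := by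
  rw [fderiv_fderiv_eq (contDiff_heat ht 2 hG)]
  simp_rw [heat_fderiv_apply hG ht]
  obtain ⟨A, hA, hAv⟩ := heat_space_deriv hG ht z
  obtain ⟨B, hB, hBv⟩ := heat_space_deriv (hG.inner_mul e) ht z
  have hi : HasFDerivAt (fun z : E => inner ℝ z e) (innerSL ℝ e) z := by
    refine (innerSL ℝ e).hasFDerivAt.congr_of_eventuallyEq (Eventually.of_forall fun y => ?_)
    simp [real_inner_comm]
  have h := (hB.sub (hi.mul hA)).const_mul t⁻¹
  have h' : fderiv ℝ (fun y => t⁻¹ * (heat (fun y => inner ℝ e y * G y) (t, y) -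
      inner ℝ y e * heat G (t, y))) z = _ := HasFDerivAt.fderiv h
  rw [h']
  simp only [smul_apply, sub_apply, add_apply, smul_eq_mul, hAv, hBv, innerSL_apply_apply,
    real_inner_self_eq_norm_sq]
  ring

/-- The heat equation, along a moving frame of velocity `c`. -/
lemma heat_equation {ι : Type*} [Fintype ι] (v : OrthonormalBasis ι ℝ E) {G : E → ℝ}
    (hG : ExpGrowth G) {t : ℝ} (ht : 0 < t) (z c : E) :
    ∃ A : ℝ × E →L[ℝ] ℝ, HasFDerivAt (heat G) A (t, z) ∧ A (1, c) =
      fderiv ℝ (fun z => heat G (t, z)) z c +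
        (1 / 2) * ∑ k, fderiv ℝ (fderiv ℝ fun z => heat G (t, z)) z (v k) (v k) := by
  obtain ⟨A, hA, hAv⟩ := heat_deriv_apply hG (p := (t, z)) ht
  refine ⟨A, hA, ?_⟩
  rw [hAv, heat_fderiv_apply hG ht]
  simp_rw [heat_fderiv_fderiv_apply hG ht]
  -- Parseval's identity in the orthonormal basis turns the sums over `k` into the terms with
  -- `‖y‖²`, `⟨z, y⟩` and `‖z‖²` of the time derivative; the sum of `‖v k‖²` gives the dimension.
  have e1 : ∑ k, heat (fun y => inner ℝ (v k) y * (inner ℝ (v k) y * G y)) (t, z) =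
      heat (fun y => ‖y‖ ^ 2 * G y) (t, z) := by
    have := heat_sum Finset.univ (fun _ => (1 : ℝ))
      (fun k => (hG.inner_mul (v k)).inner_mul (v k)) (p := (t, z)) ht
    simp only [one_mul] at this
    rw [← this]
    congr 1
    ext y
    rw [← v.sum_sq_inner_left, Finset.sum_mul]
    refine Finset.sum_congr rfl fun k _ => ?_
    rw [real_inner_comm]
    ring
  have e2 : ∑ k, inner ℝ z (v k) * heat (fun y => inner ℝ (v k) y * G y) (t, z) =
      heat (fun y => inner ℝ z y * G y) (t, z) := by
    rw [← heat_sum Finset.univ (fun k => inner ℝ z (v k)) (fun k => hG.inner_mul (v k)) ht]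
    congr 1
    ext y
    rw [← v.sum_inner_mul_inner z y, Finset.sum_mul]
    exact Finset.sum_congr rfl fun k _ => by ring
  have e3 : ∑ k, inner ℝ z (v k) ^ 2 = ‖z‖ ^ 2 := v.sum_sq_inner_left z
  have e4 : (Fintype.card ι : ℝ) = Module.finrank ℝ E := by
    rw [Module.finrank_eq_card_basis v.toBasis]
  have e5 : heat (fun y => inner ℝ (t⁻¹ • c - (1 / t ^ 2) • z) y * G y) (t, z) =
      t⁻¹ * heat (fun y => inner ℝ c y * G y) (t, z) -
        1 / t ^ 2 * heat (fun y => inner ℝ z y * G y) (t, z) := by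
    have := heat_sum (Finset.univ : Finset Bool) (fun i => cond i t⁻¹ (-(1 / t ^ 2)))
      (G := fun i => cond i (fun y => inner ℝ c y * G y) (fun y => inner ℝ z y * G y))
      (fun i => by cases i; exacts [hG.inner_mul z, hG.inner_mul c]) (p := (t, z)) ht
    simp only [Fintype.sum_bool, cond_true, cond_false] at this
    rw [sub_eq_add_neg (t⁻¹ * _), ← neg_mul, ← this]
    congr 1
    ext y
    rw [inner_sub_left, real_inner_smul_left, real_inner_smul_left]
    ring
  simp only [Finset.sum_sub_distrib, ← Finset.mul_sum, Finset.sum_add_distrib, e1, e2,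
    ← Finset.sum_mul, e3, v.norm_eq_one, one_pow, Finset.sum_const, Finset.card_univ, e5,
    nsmul_eq_mul, e4]
  field_simp
  ring

end HeatEquation

/-! ### Strong solutions -/

variable {d : ℕ} {b : Space d}

/-- The initial value is attained at points of continuity. -/
lemma tendsto_limitDensity_zero {S : Space d →L[ℝ] Space d} {f : Space d → ℝ} (hf : Measurable f)
    {C : ℝ} (hC : ∀ x, |f x| ≤ C) {x : Space d} (hx : ContinuousAt f x) :
    Tendsto (Function.uncurry (limitDensity b S f)) (𝓝 ((0 : ℝ), x)) (𝓝 (f x)) := by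
  have h := tendsto_integral_filter_of_dominated_convergence (μ := gauss d)
    (l := 𝓝 ((0 : ℝ), x)) (F := fun p n => f (p.2 - limitShift b S p.1 n)) (f := fun _ => f x)
    (fun _ => C) ?_ ?_ (integrable_const _) ?_
  · simp only [integral_const, probReal_univ, one_smul] at h
    exact h
  · exact Eventually.of_forall fun p =>
      (hf.comp (measurable_const.sub (measurable_limitShift p.1))).aestronglyMeasurable
  · exact Eventually.of_forall fun p => ae_of_all _ fun n => hC _
  · refine ae_of_all _ fun n => ?_
    have hc : Continuous fun p : ℝ × Space d => p.2 - limitShift b S p.1 n :=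
      continuous_snd.sub (continuous_limitShift.comp (continuous_fst.prodMk continuous_const))
    have := hc.tendsto ((0 : ℝ), x)
    simp only [limitShift, zero_smul, neg_zero, Real.sqrt_zero, add_zero, sub_zero] at this
    exact hx.tendsto.comp this

/-- The density at positive times in terms of the heat semigroup. -/
lemma limitDensity_eq_heat (S : Space d ≃L[ℝ] Space d) (f : Space d → ℝ) {t : ℝ} (ht : 0 < t)
    (x : Space d) : limitDensity b (S : Space d →L[ℝ] Space d) f t x =
      heat (fun y => f (S y)) (t, S.symm (x + t • b)) := by
  set z := S.symm (x + t • b) with hz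
  have hst : 0 < √t := Real.sqrt_pos.2 ht
  have h1 : ∀ n, x - limitShift b (S : Space d →L[ℝ] Space d) t n = S (z - √t • n) := by
    intro n
    rw [map_sub, hz, S.apply_symm_apply, map_smul, limitShift]
    simp
    abel
  unfold limitDensity
  simp_rw [h1]
  rw [integral_gauss]
  -- Substitute `m = √t n`, then `y = z - m`.
  have h2 := Measure.integral_comp_smul (volume : Measure (Space d))
    (fun m => gaussDensity d ((√t)⁻¹ • m) • f (S (z - m))) (√t)
  simp only [smul_smul, inv_mul_cancel₀ hst.ne', one_smul] at h2
  rw [h2, ← integral_sub_left_eq_self (fun m => gaussDensity d ((√t)⁻¹ • m) • f (S (z - m))) _ z]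
  unfold heat laplace
  rw [smul_eq_mul, ← integral_const_mul, ← integral_const_mul]
  refine integral_congr_ae (ae_of_all _ fun y => ?_)
  simp only [sub_sub_cancel, smul_eq_mul, gaussDensity, norm_smul, finrank_euclideanSpace,
    Fintype.card_fin, heatPrefactor]
  have h3 : |((√t) ^ d)⁻¹| * (2 * Real.pi) ^ (-(d : ℝ) / 2) =
      Real.exp (-(d / 2 : ℝ) * Real.log (2 * Real.pi * t)) := by
    rw [abs_of_pos (by positivity), mul_comm (-(d / 2 : ℝ)), ← Real.rpow_def_of_pos (by positivity),
      Real.mul_rpow (by positivity) ht.le, mul_comm, ← Real.rpow_natCast, Real.sqrt_eq_rpow,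
      ← Real.rpow_mul ht.le, ← Real.rpow_neg ht.le]
    congr 2 <;> ring
  -- Expanding `‖z - y‖²`: the part depending on `z` alone goes into the prefactor, the rest is the
  -- Laplace exponent at `(1/t, z/t)`.
  have h4 : -(‖(√t)⁻¹‖ * ‖z - y‖) ^ 2 / 2 = -(‖z‖ ^ 2 * t⁻¹ / 2) +
      (-‖y‖ ^ 2 / 2 * t⁻¹ + inner ℝ y (t⁻¹ • z)) := by
    rw [norm_inv, Real.norm_of_nonneg hst.le, mul_pow, inv_pow, Real.sq_sqrt ht.le,
      norm_sub_sq_real, real_inner_smul_right, real_inner_comm]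
    ring
  rw [h4, Real.exp_add (-(‖z‖ ^ 2 * t⁻¹ / 2)), sub_eq_add_neg, 
    Real.exp_add (-(d / 2 : ℝ) * Real.log (2 * Real.pi * t)), ← h3]
  ring

/-- In the variable `z = S⁻¹(x + t b)` the density is a standard heat flow seen from a frame of
velocity `S⁻¹ b`. The frame velocity yields the drift term, and `∑ D²(S eₖ, S eₖ)` becomes the
Laplacian in `z`. -/
lemma isStrongSolution_limitDensity {Q : Matrix (Fin d) (Fin d) ℝ} {S : Space d ≃L[ℝ] Space d}
    (hS : IsRootOf (S : Space d →L[ℝ] Space d) Q) {f : Space d → ℝ} (hf : Measurable f) {C : ℝ}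
    (hC : ∀ x, |f x| ≤ C) :
    IsStrongSolution 2 b Q f (limitDensity b (S : Space d →L[ℝ] Space d) f) := by
  have hG : ExpGrowth fun y => f (S y) :=
    expGrowth_of_bounded (hf.comp S.continuous.measurable) fun y => hC _
  have hsm : ∀ t, 0 < t → ContDiff ℝ 2 (limitDensity b (S : Space d →L[ℝ] Space d) f t) := by
    intro t ht
    rw [show limitDensity b (S : Space d →L[ℝ] Space d) f t =
      (fun z => heat (fun y => f (S y)) (t, z)) ∘ fun x => S.symm (x + t • b) from
      funext fun x => limitDensity_eq_heat S f ht x]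
    exact (contDiff_heat ht 2 hG).comp (S.symm.contDiff.comp (contDiff_id.add contDiff_const))
  refine ⟨limitDensity_zero f, hsm, fun t ht x => ?_, fun x hx =>
    (tendsto_limitDensity_zero hf hC hx).mono_left nhdsWithin_le_nhds⟩
  rw [transportDiffusion_eq_generator hS (hsm t ht)]
  set g := fun z => heat (fun y => f (S y)) (t, z) with hg
  have hgc : ContDiff ℝ 2 g := contDiff_heat ht 2 hG
  have hu : limitDensity b (S : Space d →L[ℝ] Space d) f t = fun x => g (S.symm (x + t • b)) :=
    funext fun x => limitDensity_eq_heat S f ht x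
  have haff : ∀ x, HasFDerivAt (fun x => S.symm (x + t • b))
      (S.symm : Space d →L[ℝ] Space d) x := by
    intro x
    have h1 : HasFDerivAt (fun x => x + t • b) (ContinuousLinearMap.id ℝ (Space d)) x :=
      (hasFDerivAt_id x).add_const _
    exact ((S.symm : Space d →L[ℝ] Space d).hasFDerivAt (x := x + t • b)).comp x h1
  have hd1 : ∀ (h : Space d → ℝ) (x v : Space d), Differentiable ℝ h →
      fderiv ℝ (fun x => h (S.symm (x + t • b))) x v =
        fderiv ℝ h (S.symm (x + t • b)) (S.symm v) := by
    intro h x v hh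
    have : HasFDerivAt (fun x => h (S.symm (x + t • b))) _ x :=
      (hh (S.symm (x + t • b))).hasFDerivAt.comp x (haff x)
    rw [this.fderiv]
    rfl
  obtain ⟨A, hA, hAv⟩ := heat_equation (EuclideanSpace.basisFun (Fin d) ℝ) hG ht
    (S.symm (x + t • b)) (S.symm b)
  have hpath : HasDerivAt (fun s : ℝ => (s, S.symm (x + s • b))) (1, S.symm b) t := by
    refine (hasDerivAt_id t).prodMk ?_
    have h1 : HasDerivAt (fun s : ℝ => x + s • b) b t := by
      simpa using ((hasDerivAt_id t).smul_const b).const_add x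
    exact (S.symm.hasFDerivAt (x := x + t • b)).comp_hasDerivAt t h1
  have h := hA.comp_hasDerivAt t hpath
  rw [hAv] at h
  have hev : (fun s => limitDensity b (S : Space d →L[ℝ] Space d) f s x) =ᶠ[𝓝 t]
      (heat fun y => f (S y)) ∘ fun s => (s, S.symm (x + s • b)) := by
    filter_upwards [lt_mem_nhds ht] with s hs
    exact limitDensity_eq_heat S f hs x
  refine (h.congr_of_eventuallyEq hev).congr_deriv ?_
  unfold generator
  congr 1
  · rw [hu, hd1 g x b (hgc.differentiable (by norm_num))]
  · congr 1
    refine Finset.sum_congr rfl fun k _ => ?_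
    rw [fderiv_fderiv_eq (hsm t ht), fderiv_fderiv_eq hgc, hu]
    simp_rw [hd1 g _ _ (hgc.differentiable (by norm_num))]
    have hgd : Differentiable ℝ fun z => fderiv ℝ g z (EuclideanSpace.single k 1) :=
      ((hgc.fderiv_right (m := 1) (by norm_num)).clm_apply contDiff_const).differentiable
        (by norm_num)
    have := hd1 (fun z => fderiv ℝ g z (EuclideanSpace.single k 1)) x
      (S (EuclideanSpace.single k 1)) hgd
    simp only [ContinuousLinearEquiv.coe_coe, ContinuousLinearEquiv.symm_apply_apply] at this ⊢
    rw [this]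
    simp

/-- For `S = 0` the shift is deterministic and the density is `f(x + t b)`. -/
lemma isStrongSolution_transport {f : Space d → ℝ} (hf : ContDiff ℝ 1 f) {C : ℝ}
    (hC : ∀ x, |f x| ≤ C) : IsStrongSolution 1 b 0 f (limitDensity b 0 f) := by
  have hu : ∀ t x, limitDensity b 0 f t x = f (x + t • b) := by
    intro t x
    simp [limitDensity, limitShift]
  refine ⟨limitDensity_zero f, fun t _ => ?_, fun t _ x => ?_, fun x hx =>
    (tendsto_limitDensity_zero hf.continuous.measurable hC hx).mono_left nhdsWithin_le_nhds⟩
  · rw [show limitDensity b 0 f t = fun x => f (x + t • b) from funext (hu t)]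
    exact hf.comp (contDiff_id.add contDiff_const)
  · have hd : Differentiable ℝ f := hf.differentiable (by norm_num)
    have h1 : HasDerivAt (fun s : ℝ => x + s • b) b t := by
      simpa using ((hasDerivAt_id t).smul_const b).const_add x
    have h2 := (hd (x + t • b)).hasFDerivAt.comp_hasDerivAt t h1
    have h3 : transportDiffusion b 0 (limitDensity b 0 f t) x = fderiv ℝ f (x + t • b) b := by
      have hfd : fderiv ℝ (limitDensity b 0 f t) x = fderiv ℝ f (x + t • b) := by
        rw [show limitDensity b 0 f t = fun x => f (x + t • b) from funext (hu t)]
        exact fderiv_comp_add_right _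
      have hdd : DifferentiableAt ℝ (limitDensity b 0 f t) x := by
        rw [show limitDensity b 0 f t = fun x => f (x + t • b) from funext (hu t)]
        exact (hd _).comp x ((differentiableAt_id).add_const _)
      unfold transportDiffusion
      have h4 : ∀ i, partialDeriv i (fun y => b i * limitDensity b 0 f t y) x =
          b i * fderiv ℝ f (x + t • b) (EuclideanSpace.single i 1) := by
        intro i
        simp [partialDeriv, fderiv_const_mul hdd, hfd]
      simp_rw [h4]
      conv_rhs => enter [2]; rw [← sum_smul_single b]
      simp
    rw [h3]
    exact h2.congr_of_eventuallyEq (Eventually.of_forall fun s => hu s x)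

/-! ### The number of jumps is Poisson distributed -/

/-- The weight of `k` under the Poisson distribution of parameter `r * A`, for `0 ≤ A`. -/
noncomputable def poissonWeight (r : ℝ) (k : ℕ) (A : ℝ) : ℝ≥0∞ :=
  if 0 ≤ A then ENNReal.ofReal (Real.exp (-(r * A)) * (r * A) ^ k / k.factorial) else 0

lemma measurable_poissonWeight (r : ℝ) (k : ℕ) : Measurable (poissonWeight r k) :=
  Measurable.ite (measurableSet_le measurable_const measurable_id)
    (by fun_prop) measurable_const

lemma integral_poissonWeight_aux (r A : ℝ) (k : ℕ) :
    ∫ s in (0 : ℝ)..A, r * Real.exp (-(r * A)) * (r * (A - s)) ^ k / k.factorial =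
      Real.exp (-(r * A)) * (r * A) ^ (k + 1) / (k + 1).factorial := by
  have h : ∀ s : ℝ, HasDerivAt
      (fun s => -(Real.exp (-(r * A)) * (r * (A - s)) ^ (k + 1) / (k + 1).factorial))
      (r * Real.exp (-(r * A)) * (r * (A - s)) ^ k / k.factorial) s := by
    intro s
    have h1 : HasDerivAt (fun s => (r * (A - s)) ^ (k + 1))
        ((k + 1 : ℕ) * (r * (A - s)) ^ k * (r * (-1))) s := by
      have h0 : HasDerivAt (fun s => r * (A - s)) (r * (-1)) s :=
        ((hasDerivAt_id s).const_sub A).const_mul r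
      exact h0.pow (k + 1)
    have h2 := ((h1.const_mul (Real.exp (-(r * A)))).div_const ((k + 1).factorial : ℝ)).neg
    convert! h2 using 1
    have : ((k.factorial : ℕ) : ℝ) ≠ 0 := by positivity
    rw [Nat.factorial_succ]
    push_cast
    field_simp
  rw [intervalIntegral.integral_eq_sub_of_hasDerivAt (fun s _ => h s)
    (Continuous.intervalIntegrable (by fun_prop) _ _)]
  simp

/-- Conditioning on one exponential waiting time raises the Poisson index by one: the factors
`e^{-rs}` and `e^{-r(A - s)}` combine, leaving the integral of a power. The value zero at negative
arguments discards waiting times longer than `A`. -/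
lemma lintegral_poissonWeight_sub {r : ℝ} (hr : 0 < r) (k : ℕ) (A : ℝ) :
    ∫⁻ s, poissonWeight r k (A - s) ∂(expMeasure r) = poissonWeight r (k + 1) A := by
  have hd : expMeasure r = volume.withDensity (exponentialPDF r) := rfl
  have hm : Measurable (exponentialPDF r) := (measurable_exponentialPDFReal r).ennreal_ofReal
  rw [hd, lintegral_withDensity_eq_lintegral_mul (g := fun s => poissonWeight r k (A - s)) _ hm
    ((measurable_poissonWeight r k).comp (by fun_prop : Measurable fun s : ℝ => A - s))]
  have key : ∀ s, (exponentialPDF r * fun s => poissonWeight r k (A - s)) s =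
      (Icc 0 A).indicator (fun s => ENNReal.ofReal
        (r * Real.exp (-(r * A)) * (r * (A - s)) ^ k / k.factorial)) s := by
    intro s
    rw [Pi.mul_apply]
    by_cases hs : 0 ≤ s
    · by_cases hA : s ≤ A
      · rw [indicator_of_mem (show s ∈ Icc 0 A from ⟨hs, hA⟩), exponentialPDF_of_nonneg hs,
          poissonWeight, if_pos (by linarith), ← ENNReal.ofReal_mul (by positivity)]
        congr 1
        have : Real.exp (-(r * A)) = Real.exp (-(r * s)) * Real.exp (-(r * (A - s))) := by
          rw [← Real.exp_add]; ring_nf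
        rw [this]; ring
      · rw [indicator_of_notMem (fun h => hA h.2), poissonWeight, if_neg (by linarith), mul_zero]
    · rw [indicator_of_notMem (fun h => hs h.1), exponentialPDF_of_neg (not_le.1 hs), zero_mul]
  rw [lintegral_congr key, lintegral_indicator measurableSet_Icc]
  by_cases hA : 0 ≤ A
  · rw [poissonWeight, if_pos hA, ← integral_poissonWeight_aux,
      intervalIntegral.integral_of_le hA, ← integral_Icc_eq_integral_Ioc,
      ofReal_integral_eq_lintegral_ofReal]
    · exact (Continuous.continuousOn (by fun_prop)).integrableOn_Icc
    · refine (ae_restrict_iff' measurableSet_Icc).2 (ae_of_all _ fun s hs => ?_)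
      have : 0 ≤ A - s := by linarith [hs.2]
      simp only [Pi.zero_apply]
      positivity
  · rw [poissonWeight, if_neg hA, Icc_eq_empty hA]
    simp

lemma expMeasure_Ioi {r : ℝ} (hr : 0 < r) {A : ℝ} (hA : 0 ≤ A) :
    expMeasure r (Ioi A) = poissonWeight r 0 A := by
  have := isProbabilityMeasure_expMeasure hr
  have h : (expMeasure r).real (Iic A) = 1 - Real.exp (-(r * A)) := by
    rw [← cdf_eq_real, cdf_expMeasure_eq hr, if_pos hA]
  rw [← compl_Iic, ← ofReal_measureReal, probReal_compl_eq_one_sub measurableSet_Iic, h,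
    poissonWeight, if_pos hA]
  simp

lemma expMeasure_ae_nonneg {r : ℝ} : ∀ᵐ s ∂(expMeasure r), 0 ≤ s := by
  have hd : expMeasure r = volume.withDensity (exponentialPDF r) := rfl
  have hm : Measurable (exponentialPDF r) := (measurable_exponentialPDFReal r).ennreal_ofReal
  rw [hd, ae_withDensity_iff hm]
  refine ae_of_all _ fun s hs => ?_
  by_contra h
  exact hs (exponentialPDF_of_neg (not_le.1 h))

/-- Independent waiting times. -/
noncomputable abbrev waitingLaw (r : ℝ) : Measure (ℕ → ℝ) :=
  Measure.infinitePi fun _ : ℕ => expMeasure r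

lemma isProbabilityMeasure_waitingLaw {r : ℝ} (hr : 0 < r) :
    IsProbabilityMeasure (waitingLaw r) := by
  have := isProbabilityMeasure_expMeasure hr
  infer_instance

lemma lintegral_partialSum_next {r : ℝ} (hr : 0 < r) (n : ℕ) {F : ℝ → ℝ → ℝ≥0∞}
    (hF : Measurable (Function.uncurry F)) :
    ∫⁻ τ, F (∑ k ∈ Finset.range n, τ k) (τ n) ∂(waitingLaw r) =
      ∫⁻ τ, ∫⁻ s, F (∑ k ∈ Finset.range n, τ k) s ∂(expMeasure r) ∂(waitingLaw r) := by
  have := isProbabilityMeasure_expMeasure hr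
  have hi : iIndepFun (fun (i : ℕ) (τ : ℕ → ℝ) => τ i) (waitingLaw r) :=
    iIndepFun_infinitePi (X := fun _ x => x) (fun _ => measurable_id)
  have h := hi.indepFun_sum_range_succ (fun i => measurable_pi_apply i) n
  have hS : Measurable (fun τ : ℕ → ℝ => ∑ k ∈ Finset.range n, τ k) := by fun_prop
  have h' : IndepFun (fun τ : ℕ → ℝ => ∑ k ∈ Finset.range n, τ k) (fun τ => τ n)
      (waitingLaw r) := by
    convert h using 1
    ext τ; simp
  have hp := (indepFun_iff_map_prod_eq_prod_map_map hS.aemeasurable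
    (measurable_pi_apply n).aemeasurable).1 h'
  calc ∫⁻ τ, F (∑ k ∈ Finset.range n, τ k) (τ n) ∂(waitingLaw r)
      = ∫⁻ z, Function.uncurry F z ∂((waitingLaw r).map
          fun τ => (∑ k ∈ Finset.range n, τ k, τ n)) := by
        rw [lintegral_map hF (hS.prodMk (measurable_pi_apply n))]; rfl
    _ = _ := by
        rw [hp, Measure.infinitePi_map_eval, lintegral_prod _ hF.aemeasurable,
          lintegral_map hF.lintegral_prod_right' hS]
        rfl

/-- Each of the `n` waiting times raises the index by one. For `k = 0` the integrand is the
conditional probability that the first `n` jumps happen by time `T` and the next one does not. -/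
lemma lintegral_poissonWeight_partialSum {r : ℝ} (hr : 0 < r) (n k : ℕ) (T : ℝ) :
    ∫⁻ τ, poissonWeight r k (T - ∑ j ∈ Finset.range n, τ j) ∂(waitingLaw r) =
      poissonWeight r (n + k) T := by
  induction n generalizing k with
  | zero =>
    have := isProbabilityMeasure_waitingLaw hr
    simp
  | succ n ih =>
    simp_rw [Finset.sum_range_succ, ← sub_sub]
    rw [lintegral_partialSum_next hr n (F := fun x s => poissonWeight r k (T - x - s))
      ((measurable_poissonWeight r k).comp (by fun_prop))]
    simp_rw [lintegral_poissonWeight_sub hr]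
    rw [ih, add_right_comm, add_assoc]

lemma jumpCount_eq {τ : ℕ → ℝ} (hτ : ∀ n, 0 ≤ τ n) {n : ℕ} {T : ℝ}
    (h1 : ∑ k ∈ Finset.range n, τ k ≤ T) (h2 : T < ∑ k ∈ Finset.range (n + 1), τ k) :
    jumpCount τ T = n := by
  have hmono : Monotone fun n => ∑ k ∈ Finset.range n, τ k := by
    refine monotone_nat_of_le_succ fun n => ?_
    rw [Finset.sum_range_succ]; linarith [hτ n]
  have : {m : ℕ | ∑ k ∈ Finset.range (m + 1), τ k ≤ T} = Iio n := by
    ext m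
    constructor
    · intro hm
      by_contra h
      exact absurd (lt_of_lt_of_le h2 (hmono (show n + 1 ≤ m + 1 by simpa using h)))
        (not_lt.2 hm)
    · intro hm
      exact (hmono (Nat.succ_le_of_lt hm)).trans h1
  rw [jumpCount, this]
  simp [Set.ncard_eq_toFinset_card']

lemma measurable_jumpCount (T : ℝ) : Measurable fun τ : ℕ → ℝ => jumpCount τ T := by
  classical
  -- The default values agree: an infinite set has `ncard` zero, and `toReal` sends `⊤` to zero.
  have h : ∀ τ : ℕ → ℝ, ((jumpCount τ T : ℕ) : ℝ≥0∞) =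
      ENNReal.ofReal (∑' n : ℕ, if ∑ k ∈ Finset.range (n + 1), τ k ≤ T then (1 : ℝ≥0∞) else 0).toReal := by
    intro τ
    set s := {n : ℕ | ∑ k ∈ Finset.range (n + 1), τ k ≤ T} with hs
    have h1 : (∑' n : ℕ, if ∑ k ∈ Finset.range (n + 1), τ k ≤ T then (1 : ℝ≥0∞) else 0) =
        s.encard := by
      rw [← ENNReal.tsum_set_one, tsum_subtype s (fun _ => (1 : ℝ≥0∞))]
      rfl
    rw [h1, jumpCount, ← hs]
    by_cases hf : s.Finite
    · rw [← hf.cast_ncard_eq]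
      simp
    · rw [Set.Infinite.ncard hf, Set.Infinite.encard_eq hf]
      simp
  have hm : Measurable fun τ : ℕ → ℝ => ENNReal.ofReal
      (∑' n : ℕ, if ∑ k ∈ Finset.range (n + 1), τ k ≤ T then (1 : ℝ≥0∞) else 0).toReal := by
    refine (Measurable.tsum fun n => ?_).ennreal_toReal.ennreal_ofReal
    exact Measurable.ite (measurableSet_le (by fun_prop) measurable_const) measurable_const
      measurable_const
  simp_rw [← h] at hm
  refine measurable_to_countable' fun n => ?_
  have : (fun τ : ℕ → ℝ => jumpCount τ T) ⁻¹' {n} =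
      (fun τ : ℕ → ℝ => ((jumpCount τ T : ℕ) : ℝ≥0∞)) ⁻¹' {(n : ℝ≥0∞)} := by
    ext τ; simp
  rw [this]
  exact hm (measurableSet_singleton _)

/-- Both sides are probability measures on `ℕ`, so it suffices that each Poisson mass is at most the
corresponding mass of the count. This makes a separate proof that infinitely many jumps have
probability zero unnecessary. -/
lemma map_jumpCount {r : ℝ} (hr : 0 < r) {T : ℝ} (hT : 0 ≤ T) :
    (waitingLaw r).map (fun τ => jumpCount τ T) = poissonMeasure (r * T).toNNReal := by
  have := isProbabilityMeasure_waitingLaw hr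
  have := isProbabilityMeasure_expMeasure hr
  have : IsProbabilityMeasure ((waitingLaw r).map fun τ => jumpCount τ T) :=
    Measure.isProbabilityMeasure_map (measurable_jumpCount T).aemeasurable
  have hpos : ∀ᵐ τ ∂(waitingLaw r), ∀ n, 0 ≤ τ n := by
    rw [ae_all_iff]
    intro n
    have := (measurable_pi_apply (X := fun _ : ℕ => ℝ) n).aemeasurable (μ := waitingLaw r)
    have h2 : ∀ᵐ s ∂((waitingLaw r).map fun τ => τ n), 0 ≤ s := by
      rw [Measure.infinitePi_map_eval]; exact expMeasure_ae_nonneg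
    exact ae_of_ae_map this h2
  symm
  refine Measure.eq_of_le_of_measure_univ_eq ?_ (by simp)
  have hs : ∀ n : ℕ, poissonMeasure (r * T).toNNReal {n} ≤
      (waitingLaw r).map (fun τ => jumpCount τ T) {n} := by
    intro n
    rw [Measure.map_apply (measurable_jumpCount T) (measurableSet_singleton n),
      poissonMeasure_singleton]
    have h0 := lintegral_poissonWeight_partialSum hr n 0 T
    rw [add_zero, poissonWeight, if_pos hT] at h0
    rw [Real.coe_toNNReal _ (by positivity), ← h0]
    have h1 : ∫⁻ τ, poissonWeight r 0 (T - ∑ j ∈ Finset.range n, τ j) ∂(waitingLaw r) =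
        ∫⁻ τ, {z : ℝ × ℝ | z.1 ≤ T ∧ T < z.1 + z.2}.indicator (fun _ => (1 : ℝ≥0∞))
          (∑ j ∈ Finset.range n, τ j, τ n) ∂(waitingLaw r) := by
      have hM : MeasurableSet {z : ℝ × ℝ | z.1 ≤ T ∧ T < z.1 + z.2} :=
        (measurableSet_le measurable_fst measurable_const).inter
          (measurableSet_lt measurable_const (measurable_fst.add measurable_snd))
      rw [lintegral_partialSum_next hr n
        (F := fun x s => {z : ℝ × ℝ | z.1 ≤ T ∧ T < z.1 + z.2}.indicator (fun _ => (1 : ℝ≥0∞))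
          (x, s)) (measurable_const.indicator hM)]
      refine lintegral_congr fun τ => ?_
      set x := ∑ j ∈ Finset.range n, τ j
      by_cases hx : x ≤ T
      · rw [← expMeasure_Ioi hr (by linarith : 0 ≤ T - x), ← lintegral_indicator_one measurableSet_Ioi]
        refine lintegral_congr fun s => ?_
        simp only [indicator_apply, mem_Ioi, Set.mem_ofPred_eq, hx, true_and, sub_lt_iff_lt_add',
          Pi.one_apply]
      · rw [poissonWeight, if_neg (by linarith)]
        simp [hx]
    rw [h1, ← lintegral_indicator_one
      ((measurable_jumpCount T) (measurableSet_singleton n))]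
    refine lintegral_mono_ae ?_
    filter_upwards [hpos] with τ hτ
    by_cases hm : ∑ j ∈ Finset.range n, τ j ≤ T ∧ T < ∑ j ∈ Finset.range n, τ j + τ n
    · have : jumpCount τ T = n := jumpCount_eq hτ hm.1 (by rw [Finset.sum_range_succ]; exact hm.2)
      rw [indicator_of_mem (show τ ∈ (fun τ => jumpCount τ T) ⁻¹' {n} from this)]
      exact indicator_apply_le' (fun _ => le_rfl) (fun _ => zero_le_one)
    · rw [indicator_of_notMem (s := {z : ℝ × ℝ | z.1 ≤ T ∧ T < z.1 + z.2}) hm]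
      exact zero_le
  refine Measure.le_iff.2 fun s hm => ?_
  rw [← Measure.tsum_indicator_apply_singleton _ s hm,
    ← Measure.tsum_indicator_apply_singleton _ s hm]
  refine ENNReal.tsum_le_tsum fun n => ?_
  by_cases hn : n ∈ s
  · simpa [hn] using hs n
  · simp [hn]

/-! ### The displacement of one particle -/

/-- Admissible jump kernels. -/
structure IsJumpKernel (a : Space d → ℝ) : Prop where
  nonneg : ∀ x, 0 ≤ a x
  integrable : Integrable a
  totalRate_pos : 0 < totalRate a

lemma IsJumpKernel.isProbabilityMeasure_jumpLaw {a : Space d → ℝ} (ha : IsJumpKernel a) :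
    IsProbabilityMeasure (jumpLaw a) := by
  refine ⟨?_⟩
  rw [jumpLaw, Measure.smul_apply, withDensity_apply _ MeasurableSet.univ, Measure.restrict_univ,
    ← ofReal_integral_eq_lintegral_ofReal ha.integrable (ae_of_all _ ha.nonneg), smul_eq_mul]
  exact ENNReal.inv_mul_cancel (by simpa using ha.totalRate_pos) ENNReal.ofReal_ne_top

lemma IsJumpKernel.isProbabilityMeasure_particleLaw {a : Space d → ℝ} (ha : IsJumpKernel a) :
    IsProbabilityMeasure (particleLaw a) := by
  have := ha.isProbabilityMeasure_jumpLaw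
  have := isProbabilityMeasure_expMeasure ha.totalRate_pos
  unfold particleLaw
  infer_instance

lemma IsJumpKernel.integral_jumpLaw {a : Space d → ℝ} (ha : IsJumpKernel a) (f : Space d → ℂ) :
    ∫ x, f x ∂(jumpLaw a) = (totalRate a : ℂ)⁻¹ * ∫ x, f x * a x := by
  rw [jumpLaw, integral_smul_measure, integral_withDensity_eq_integral_toReal_smul₀
    ha.integrable.aestronglyMeasurable.aemeasurable.ennreal_ofReal (ae_of_all _ fun _ => by simp),
    ENNReal.toReal_inv, ENNReal.toReal_ofReal ha.totalRate_pos.le, Complex.real_smul]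
  congr 1
  · push_cast; rfl
  · refine integral_congr_ae (ae_of_all _ fun x => ?_)
    simp only [ENNReal.toReal_ofReal (ha.nonneg x), Complex.real_smul]
    ring

/-- The displacement of a particle up to time `T`. -/
noncomputable def displacement (w : ParticleSample d) (T : ℝ) : Space d :=
  -∑ k ∈ Finset.range (jumpCount w.1 T), w.2 k

lemma particlePath_eq (x : Space d) (w : ParticleSample d) (T : ℝ) :
    particlePath x w T = x + displacement w T := by
  rw [particlePath, jumpChain, displacement, sub_eq_add_neg]

lemma measurable_displacement (T : ℝ) :
    Measurable fun w : ParticleSample d => displacement w T := by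
  have h : Measurable fun z : ℕ × (ℕ → Space d) => -∑ k ∈ Finset.range z.1, z.2 k :=
    measurable_from_prod_countable_right fun n => by
      change Measurable fun ξ : ℕ → Space d => -∑ k ∈ Finset.range n, ξ k
      fun_prop
  exact h.comp (((measurable_jumpCount T).comp measurable_fst).prodMk measurable_snd)

lemma integral_exp_neg_sum_jumps {a : Space d → ℝ} (ha : IsJumpKernel a) (n : ℕ) (u : Space d) :
    ∫ ξ, Complex.exp (inner ℝ (-∑ k ∈ Finset.range n, ξ k) u * Complex.I)
      ∂(Measure.infinitePi fun _ : ℕ => jumpLaw a) = charFun (jumpLaw a) (-u) ^ n := by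
  have := ha.isProbabilityMeasure_jumpLaw
  have hi : iIndepFun (fun (i : ℕ) (ξ : ℕ → Space d) => ξ i)
      (Measure.infinitePi fun _ : ℕ => jumpLaw a) :=
    iIndepFun_infinitePi (X := fun _ x => x) (fun _ => measurable_id)
  have h := congrFun (iIndepFun.charFun_map_fun_finsetSum_eq_prod (s := Finset.range n)
    (fun i _ => (measurable_pi_apply i).aemeasurable) (hi.restrict _)) (-u)
  rw [charFun_apply, integral_map (by fun_prop) (by fun_prop), Finset.prod_apply] at h
  simp_rw [Measure.infinitePi_map_eval, Finset.prod_const, Finset.card_range] at h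
  rw [← h]
  simp_rw [inner_neg_left, inner_neg_right]

/-- Given `N` jumps the characteristic function is `c ^ N`, and averaging over the Poisson variable
`N` gives `exp(a⁽⁰⁾ T (c - 1))`. The rate cancels the normalisation of `jumpLaw`. The minus sign in
the exponent is there because `jumpChain` subtracts the jumps. -/
lemma charFun_displacement {a : Space d → ℝ} (ha : IsJumpKernel a) {T : ℝ} (hT : 0 ≤ T)
    (u : Space d) :
    charFun ((particleLaw a).map fun w => displacement w T) u =
      Complex.exp (T * ∫ x, (Complex.exp (-(inner ℝ x u * Complex.I)) - 1) * a x) := by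
  have := ha.isProbabilityMeasure_jumpLaw
  have := isProbabilityMeasure_expMeasure ha.totalRate_pos
  set c := charFun (jumpLaw a) (-u) with hc
  have hr := ha.totalRate_pos
  have h1 : charFun ((particleLaw a).map fun w => displacement w T) u =
      ∫ τ, c ^ jumpCount τ T ∂(waitingLaw (totalRate a)) := by
    rw [charFun_apply, integral_map (measurable_displacement T).aemeasurable (by fun_prop),
      particleLaw, integral_prod]
    · refine integral_congr_ae (ae_of_all _ fun τ => ?_)
      exact integral_exp_neg_sum_jumps ha (jumpCount τ T) u
    · refine Integrable.of_bound (C := 1) ?_ (ae_of_all _ fun w => ?_)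
      · have := measurable_displacement (d := d) T
        exact Measurable.aestronglyMeasurable (by fun_prop)
      · rw [Complex.norm_exp_ofReal_mul_I]
  have h2 : ∫ τ, c ^ jumpCount τ T ∂(waitingLaw (totalRate a)) =
      ∫ n, c ^ n ∂(poissonMeasure (totalRate a * T).toNNReal) := by
    rw [← map_jumpCount hr hT, integral_map (measurable_jumpCount T).aemeasurable
      .of_discrete]
  have h3 : ∀ s : ℝ≥0, ∫ n, c ^ n ∂(poissonMeasure s) = Complex.exp (s * (c - 1)) := by
    intro s
    rw [integral_poissonMeasure]
    calc ∑' n : ℕ, (Real.exp (-s) * s ^ n / n.factorial) • c ^ n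
        = ∑' n : ℕ, (Real.exp (-s) : ℂ) * ((s * c) ^ n / n.factorial) := by
          refine tsum_congr fun n => ?_
          rw [Complex.real_smul]
          push_cast
          ring
      _ = Real.exp (-s) * Complex.exp (s * c) := by
          rw [tsum_mul_left, (NormedSpace.expSeries_div_hasSum_exp ((s : ℂ) * c)).tsum_eq,
            Complex.exp_eq_exp_ℂ]
      _ = _ := by
          rw [Complex.ofReal_exp, ← Complex.exp_add]
          push_cast
          ring_nf
  have h4 : c - 1 = (totalRate a : ℂ)⁻¹ *
      ∫ x, (Complex.exp (-(inner ℝ x u * Complex.I)) - 1) * a x := by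
    have e : c - 1 = ∫ x, (Complex.exp (-(inner ℝ x u * Complex.I)) - 1) ∂(jumpLaw a) := by
      rw [integral_sub _ (integrable_const _), hc, charFun_apply]
      · simp
      · refine Integrable.of_bound (C := 1) (Measurable.aestronglyMeasurable (by fun_prop))
          (ae_of_all _ fun x => ?_)
        rw [← neg_mul, ← Complex.ofReal_neg, Complex.norm_exp_ofReal_mul_I]
    rw [e, ha.integral_jumpLaw]
  rw [h1, h2, h3, h4, Real.coe_toNNReal _ (by positivity)]
  congr 1
  have : (totalRate a : ℂ) ≠ 0 := by exact_mod_cast hr.ne'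
  push_cast
  have key : ∀ r T X : ℂ, r ≠ 0 → r * T * (r⁻¹ * X) = T * X := by intros; field_simp
  exact key _ _ _ this

lemma charFun_limitShift (b : Space d) (S : Space d →L[ℝ] Space d) {t : ℝ} (ht : 0 ≤ t)
    (u : Space d) :
    charFun ((gauss d).map fun n => limitShift b S t n) u =
      Complex.exp (-(t * (inner ℝ b u * Complex.I)) - t / 2 * ‖S.adjoint u‖ ^ 2) := by
  rw [charFun_apply, integral_map (by unfold limitShift; fun_prop) (by fun_prop)]
  have h : ∀ n, Complex.exp (inner ℝ (limitShift b S t n) u * Complex.I) =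
      Complex.exp (-(t * (inner ℝ b u * Complex.I))) *
        Complex.exp (inner ℝ n (√t • S.adjoint u) * Complex.I) := by
    intro n
    rw [← Complex.exp_add, limitShift, inner_add_left, inner_neg_left, inner_smul_left,
      inner_smul_left, inner_smul_right, ContinuousLinearMap.adjoint_inner_right]
    simp only [conj_trivial]
    push_cast
    ring_nf
  simp_rw [h]
  rw [integral_const_mul, ← charFun_apply, charFun_gauss, ← Complex.exp_add, norm_smul,
    Real.norm_eq_abs, abs_of_nonneg (Real.sqrt_nonneg t)]
  congr 1
  push_cast
  rw [mul_pow, ← Complex.ofReal_pow (√t), Real.sq_sqrt ht]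
  ring

/-- Convergence in distribution of the rescaled displacements, from the convergence of their
characteristic exponents. -/
lemma tendsto_integral_displacement {a : ℝ → Space d → ℝ} (ha : ∀ᶠ ε in 𝓝[>] 0, IsJumpKernel (a ε))
    {T : ℝ → ℝ} (hT : ∀ᶠ ε in 𝓝[>] 0, 0 ≤ T ε) (b : Space d) (S : Space d →L[ℝ] Space d)
    {t : ℝ} (ht : 0 ≤ t)
    (hlim : ∀ u : Space d, Tendsto (fun ε : ℝ => (T ε : ℂ) *
        ∫ x, (Complex.exp (-(inner ℝ x (ε • u) * Complex.I)) - 1) * a ε x) (𝓝[>] 0)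
      (𝓝 (-(t * (inner ℝ b u * Complex.I)) - t / 2 * ‖S.adjoint u‖ ^ 2)))
    {f : Space d → ℝ} (hf : Continuous f) {C : ℝ} (hC : ∀ x, |f x| ≤ C) :
    Tendsto (fun ε : ℝ => ∫ w, f (ε • displacement w (T ε)) ∂(particleLaw (a ε))) (𝓝[>] 0)
      (𝓝 (∫ n, f (limitShift b S t n) ∂(gauss d))) := by
  -- Lévy's continuity theorem is applied along sequences; dropping the first `N` terms makes every
  -- law a genuine probability measure.
  refine tendsto_of_seq_tendsto fun e he => ?_
  obtain ⟨N, hN⟩ := eventually_atTop.1 ((he.eventually ha).and (he.eventually hT))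
  rw [← tendsto_add_atTop_iff_nat N]
  have hN' : ∀ n, IsJumpKernel (a (e (n + N))) ∧ 0 ≤ T (e (n + N)) :=
    fun n => hN _ (Nat.le_add_left _ _)
  have hmL : Measurable fun n => limitShift b S t n := by unfold limitShift; fun_prop
  have hmD : ∀ n, Measurable fun w : ParticleSample d =>
      e (n + N) • displacement w (T (e (n + N))) :=
    fun n => by
      have := measurable_displacement (d := d) (T (e (n + N)))
      fun_prop
  let P : ℕ → ProbabilityMeasure (Space d) := fun n =>
    ⟨(particleLaw (a (e (n + N)))).map fun w => e (n + N) • displacement w (T (e (n + N))), by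
      have := (hN' n).1.isProbabilityMeasure_particleLaw
      exact Measure.isProbabilityMeasure_map (hmD n).aemeasurable⟩
  let P₀ : ProbabilityMeasure (Space d) :=
    ⟨(gauss d).map fun n => limitShift b S t n, Measure.isProbabilityMeasure_map hmL.aemeasurable⟩
  have hP : Tendsto P atTop (𝓝 P₀) := by
    rw [ProbabilityMeasure.tendsto_iff_tendsto_charFun]
    intro u
    have h1 : charFun (P₀ : Measure (Space d)) u = _ := charFun_limitShift b S ht u
    have h2 : ∀ n, charFun (P n : Measure (Space d)) u = Complex.exp ((T (e (n + N)) : ℂ) *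
        ∫ x, (Complex.exp (-(inner ℝ x (e (n + N) • u) * Complex.I)) - 1) * a (e (n + N)) x) := by
      intro n
      rw [← charFun_displacement (hN' n).1 (hN' n).2]
      change charFun (Measure.map _ _) u = _
      rw [charFun_apply, charFun_apply, integral_map (hmD n).aemeasurable (by fun_prop),
        integral_map (measurable_displacement _).aemeasurable (by fun_prop)]
      simp_rw [inner_smul_left, inner_smul_right]
      simp
    rw [h1]
    simp_rw [h2]
    exact (Complex.continuous_exp.tendsto _).comp
      ((hlim u).comp (he.comp (tendsto_add_atTop_nat N)))
  have hP' := (ProbabilityMeasure.tendsto_iff_forall_integral_tendsto.1 hP)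
    (BoundedContinuousFunction.ofNormedAddCommGroup f hf C hC)
  have h3 : ∫ x, f x ∂(P₀ : Measure (Space d)) = ∫ n, f (limitShift b S t n) ∂(gauss d) :=
    integral_map hmL.aemeasurable hf.aestronglyMeasurable
  have h4 : ∀ n, ∫ x, f x ∂(P n : Measure (Space d)) =
      ∫ w, f (e (n + N) • displacement w (T (e (n + N)))) ∂(particleLaw (a (e (n + N)))) :=
    fun n => integral_map (hmD n).aemeasurable hf.aestronglyMeasurable
  simp only [BoundedContinuousFunction.coe_ofNormedAddCommGroup, h3, h4] at hP'
  exact hP'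

/-! ### Square roots of the covariance matrix -/

-- In the C⋆-algebra of matrices, a strictly positive element is `star y * y` with `y` invertible.
open scoped MatrixOrder Matrix.Norms.L2Operator in
lemma exists_isUnit_mul_transpose {Q : Matrix (Fin d) (Fin d) ℝ} (hQ : Q.PosDef) :
    ∃ A : Matrix (Fin d) (Fin d) ℝ, IsUnit A ∧ Q = A * A.transpose := by
  obtain ⟨y, hy, h⟩ := CStarAlgebra.isStrictlyPositive_iff_eq_star_mul_self.mp
    (Matrix.isStrictlyPositive_iff_posDef.2 hQ)
  refine ⟨star y, hy.star, ?_⟩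
  rw [h]
  congr 1

lemma exists_isRootOf {Q : Matrix (Fin d) (Fin d) ℝ} (hQ : Q.PosDef) :
    ∃ S : Space d ≃L[ℝ] Space d, IsRootOf (S : Space d →L[ℝ] Space d) Q := by
  obtain ⟨A, hA, hQA⟩ := exists_isUnit_mul_transpose hQ
  have hu : IsUnit (Matrix.toEuclideanCLM (n := Fin d) (𝕜 := ℝ) A) :=
    hA.map (Matrix.toEuclideanCLM (n := Fin d) (𝕜 := ℝ))
  refine ⟨ContinuousLinearEquiv.ofUnit hu.unit, fun i j => ?_⟩
  have h : ∀ k i, (Matrix.toEuclideanCLM (n := Fin d) (𝕜 := ℝ) A) (EuclideanSpace.single k 1) i =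
      A i k := by
    intro k i
    rw [Matrix.ofLp_toEuclideanCLM]
    simp
  have h' : ∀ k i, ((ContinuousLinearEquiv.ofUnit hu.unit : Space d ≃L[ℝ] Space d) :
      Space d →L[ℝ] Space d) (EuclideanSpace.single k 1) i = A i k := h
  simp_rw [h']
  rw [hQA, Matrix.mul_apply]
  rfl

/-- This matches the exponent of the Gaussian limit with the quadratic form of second moments from
the Taylor expansion. -/
lemma IsRootOf.norm_adjoint_sq {S : Space d →L[ℝ] Space d} {Q : Matrix (Fin d) (Fin d) ℝ}
    (hS : IsRootOf S Q) (u : Space d) :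
    ‖S.adjoint u‖ ^ 2 = ∑ i, ∑ j, Q i j * (u i * u j) := by
  have h : ∀ k, S.adjoint u k = ∑ i, S (EuclideanSpace.single k 1) i * u i := by
    intro k
    have : S.adjoint u k = inner ℝ (EuclideanSpace.single k (1 : ℝ)) (S.adjoint u) := by
      simp [EuclideanSpace.inner_single_left]
    rw [this, ContinuousLinearMap.adjoint_inner_right, PiLp.inner_apply]
    simp [mul_comm]
  rw [EuclideanSpace.real_norm_sq_eq]
  have hQ : ∀ i j, Q i j * (u i * u j) = ∑ k, S (EuclideanSpace.single k 1) i *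
      S (EuclideanSpace.single k 1) j * (u i * u j) := fun i j => by rw [hS i j, Finset.sum_mul]
  rw [Finset.sum_congr rfl fun i _ => Finset.sum_congr rfl fun j _ => hQ i j]
  simp_rw [h, sq, Finset.sum_mul_sum]
  rw [Finset.sum_comm]
  refine Finset.sum_congr rfl fun i _ => ?_
  rw [Finset.sum_comm]
  refine Finset.sum_congr rfl fun j _ => Finset.sum_congr rfl fun k _ => by ring

/-! ### Moments -/

/-- Kernels, possibly signed, with moments of all orders. -/
structure HasMoments (g : Space d → ℝ) : Prop where
  aestronglyMeasurable : AEStronglyMeasurable g volume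
  integrable : ∀ n : ℕ, Integrable fun x => ‖x‖ ^ n * g x

lemma HasMoments.integrable_mul {g : Space d → ℝ} (hg : HasMoments g) (n : ℕ) (C : ℝ)
    {f : Space d → ℝ} (hf : Continuous f) (hC : ∀ x, |f x| ≤ C * ‖x‖ ^ n) :
    Integrable fun x => f x * g x := by
  refine ((hg.integrable n).norm.const_mul C).mono'
    (hf.aestronglyMeasurable.mul hg.aestronglyMeasurable) (ae_of_all _ fun x => ?_)
  rw [norm_mul, norm_mul, norm_pow, norm_norm, Real.norm_eq_abs, ← mul_assoc]
  exact mul_le_mul_of_nonneg_right (hC x) (norm_nonneg _)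

lemma HasMoments.integrable_self {g : Space d → ℝ} (hg : HasMoments g) : Integrable g := by
  simpa using hg.integrable 0

lemma HasMoments.integrable_coord_mul {g : Space d → ℝ} (hg : HasMoments g) (i j : Fin d) :
    Integrable fun x => x i * x j * g x := by
  refine hg.integrable_mul 2 1 (by fun_prop) fun x => ?_
  rw [abs_mul, one_mul, sq]
  exact mul_le_mul (PiLp.norm_apply_le x i) (PiLp.norm_apply_le x j) (abs_nonneg _) (norm_nonneg _)

lemma HasMoments.integrable_inner_mul {g : Space d → ℝ} (hg : HasMoments g) (u : Space d) :
    Integrable fun x => inner ℝ x u * g x := by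
  refine hg.integrable_mul 1 ‖u‖ (by fun_prop) fun x => ?_
  rw [pow_one, mul_comm]
  exact abs_real_inner_le_norm x u

lemma HasMoments.integrable_smul {g : Space d → ℝ} (hg : HasMoments g) :
    Integrable fun x => g x • x := by
  refine (hg.integrable 1).norm.mono' (hg.aestronglyMeasurable.smul aestronglyMeasurable_id)
    (ae_of_all _ fun x => ?_)
  rw [norm_smul, norm_mul, pow_one, norm_norm, mul_comm]

lemma HasMoments.integral_inner_mul {g : Space d → ℝ} (hg : HasMoments g) (u : Space d) :
    ∫ x, inner ℝ x u * g x = inner ℝ (firstMoment g) u := by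
  rw [firstMoment, real_inner_comm, ← integral_inner hg.integrable_smul]
  refine integral_congr_ae (ae_of_all _ fun x => ?_)
  simp only [inner_smul_right, real_inner_comm u x]
  ring

lemma HasMoments.integral_inner_sq_mul {g : Space d → ℝ} (hg : HasMoments g) (u : Space d) :
    ∫ x, (inner ℝ x u) ^ 2 * g x = ∑ i, ∑ j, secondMoment g i j * (u i * u j) := by
  have h : ∀ x : Space d, (inner ℝ x u) ^ 2 * g x =
      ∑ i, ∑ j, (x i * x j * g x) * (u i * u j) := by
    intro x
    rw [PiLp.inner_apply, sq, Finset.sum_mul_sum, Finset.sum_mul]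
    refine Finset.sum_congr rfl fun i _ => ?_
    rw [Finset.sum_mul]
    refine Finset.sum_congr rfl fun j _ => ?_
    simp only [RCLike.inner_apply, conj_trivial]
    ring
  simp_rw [h]
  rw [integral_finsetSum _ fun i _ => integrable_finsetSum _ fun j _ =>
    (hg.integrable_coord_mul i j).mul_const _]
  refine Finset.sum_congr rfl fun i _ => ?_
  rw [integral_finsetSum _ fun j _ => (hg.integrable_coord_mul i j).mul_const _]
  exact Finset.sum_congr rfl fun j _ => integral_mul_const _ _

lemma ae_inner_ne_zero {u : Space d} (hu : u ≠ 0) : ∀ᵐ x : Space d, inner ℝ x u ≠ 0 := by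
  have h := Measure.addHaar_submodule (volume : Measure (Space d)) (LinearMap.ker (innerₛₗ ℝ u))
    (by
      intro h
      have : u ∈ LinearMap.ker (innerₛₗ ℝ u) := by rw [h]; trivial
      exact hu (by simpa using this))
  rw [ae_iff]
  convert h using 2
  ext x
  simp [real_inner_comm]

/-- The quadratic form is `∫ ⟨x, u⟩² a(x) dx`. If it vanished for some `u ≠ 0`, then `a` would be
zero off a hyperplane, hence almost everywhere, contradicting its positive mass. -/
lemma posDef_secondMoment {a : Space d → ℝ} (ha : IsJumpKernel a) (hm : HasMoments a) :
    (secondMoment a).PosDef := by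
  have hsymm : (secondMoment a).IsHermitian := by
    ext i j
    simp [secondMoment, mul_comm]
  refine Matrix.PosDef.of_dotProduct_mulVec_pos hsymm fun {v} hv => ?_
  set u : Space d := WithLp.toLp 2 v with hu
  have hu0 : u ≠ 0 := by simpa [hu] using hv
  have h1 : star v ⬝ᵥ (secondMoment a).mulVec v = ∫ x, (inner ℝ x u) ^ 2 * a x := by
    rw [hm.integral_inner_sq_mul]
    simp only [dotProduct, Matrix.mulVec, Finset.mul_sum, hu, Pi.star_apply, star_trivial]
    exact Finset.sum_congr rfl fun i _ => Finset.sum_congr rfl fun j _ => by ring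
  rw [h1]
  have hint : Integrable fun x => (inner ℝ x u) ^ 2 * a x := by
    refine hm.integrable_mul 2 (‖u‖ ^ 2) (by fun_prop) fun x => ?_
    rw [abs_pow, ← mul_pow, mul_comm]
    exact pow_le_pow_left₀ (abs_nonneg _) (abs_real_inner_le_norm x u) 2
  have hnn : ∀ x, 0 ≤ (inner ℝ x u) ^ 2 * a x := fun x => mul_nonneg (sq_nonneg _) (ha.nonneg x)
  refine lt_of_le_of_ne (integral_nonneg hnn) fun h0 => ?_
  have h2 := (integral_eq_zero_iff_of_nonneg hnn hint).1 h0.symm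
  have h3 : a =ᵐ[volume] 0 := by
    filter_upwards [h2, ae_inner_ne_zero hu0] with x hx hx'
    simpa [hx'] using hx
  have := ha.totalRate_pos
  rw [totalRate, integral_congr_ae h3] at this
  simp at this

/-! ### Scaling limits of the characteristic exponent -/

lemma norm_exp_neg_mul_I_sub_one_le (s : ℝ) : ‖Complex.exp (-(s * Complex.I)) - 1‖ ≤ |s| := by
  have h := Real.norm_exp_I_mul_ofReal_sub_one_le (x := -s)
  rw [norm_neg, Real.norm_eq_abs] at h
  convert h using 3
  push_cast
  ring_nf

/-- Taylor's bound for `|s| ≤ 1`, the triangle inequality for `|s| ≥ 1`. Validity for all `s` is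
what dominated convergence requires. -/
lemma norm_exp_neg_mul_I_sub_one_add_le (s : ℝ) :
    ‖Complex.exp (-(s * Complex.I)) - 1 + s * Complex.I‖ ≤ 2 * s ^ 2 := by
  have hn : ‖(s * Complex.I : ℂ)‖ = |s| := by simp
  rcases le_total |s| 1 with h | h
  · have := Complex.norm_exp_sub_one_sub_id_le (x := -(s * Complex.I)) (by rwa [norm_neg, hn])
    rw [norm_neg, hn, sub_neg_eq_add, sq_abs] at this
    nlinarith [sq_nonneg s]
  · calc ‖Complex.exp (-(s * Complex.I)) - 1 + s * Complex.I‖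
        ≤ |s| + |s| := (norm_add_le _ _).trans
          (add_le_add (norm_exp_neg_mul_I_sub_one_le s) hn.le)
      _ ≤ 2 * s ^ 2 := by rw [← sq_abs s]; nlinarith

lemma tendsto_exponent_one (s : ℝ) :
    Tendsto (fun ε : ℝ => (ε : ℂ)⁻¹ * (Complex.exp (-((ε * s : ℝ) * Complex.I)) - 1)) (𝓝[>] 0)
      (𝓝 (-(s * Complex.I))) := by
  rw [tendsto_iff_norm_sub_tendsto_zero]
  have hz : Tendsto (fun ε : ℝ => ε * (2 * s ^ 2)) (𝓝[>] 0) (𝓝 0) := by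
    have : Tendsto (fun ε : ℝ => ε * (2 * s ^ 2)) (𝓝 0) (𝓝 (0 * (2 * s ^ 2))) :=
      tendsto_id.mul_const _
    rw [zero_mul] at this
    exact this.mono_left nhdsWithin_le_nhds
  refine squeeze_zero' (Eventually.of_forall fun _ => norm_nonneg _) ?_ hz
  filter_upwards [self_mem_nhdsWithin] with ε hε
  have hε : 0 < ε := hε
  have hc : (ε : ℂ) ≠ 0 := by exact_mod_cast hε.ne'
  have e : (ε : ℂ)⁻¹ * (Complex.exp (-((ε * s : ℝ) * Complex.I)) - 1) - -(s * Complex.I) =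
      (ε : ℂ)⁻¹ * (Complex.exp (-((ε * s : ℝ) * Complex.I)) - 1 + (ε * s : ℝ) * Complex.I) := by
    push_cast
    field_simp
    ring
  rw [e, norm_mul, norm_inv, Complex.norm_real, Real.norm_eq_abs, abs_of_pos hε]
  calc ε⁻¹ * _ ≤ ε⁻¹ * (2 * (ε * s) ^ 2) :=
        mul_le_mul_of_nonneg_left (norm_exp_neg_mul_I_sub_one_add_le _) (by positivity)
    _ = ε * (2 * s ^ 2) := by field_simp

/-- The third-order remainder leaves an error `ε |s|³ e^{ε|s|}`. Its growth in `s` is harmless,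
since only the limit at fixed `s` is taken here. -/
lemma tendsto_exponent_two (s : ℝ) :
    Tendsto (fun ε : ℝ => ((ε : ℂ) ^ 2)⁻¹ *
      (Complex.exp (-((ε * s : ℝ) * Complex.I)) - 1 + (ε * s : ℝ) * Complex.I)) (𝓝[>] 0)
      (𝓝 (-(s ^ 2 / 2 : ℝ))) := by
  rw [tendsto_iff_norm_sub_tendsto_zero]
  have hz : Tendsto (fun ε : ℝ => ε * (|s| ^ 3 * Real.exp (ε * |s|))) (𝓝[>] 0) (𝓝 0) := by
    have : Continuous fun ε : ℝ => ε * (|s| ^ 3 * Real.exp (ε * |s|)) := by fun_prop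
    have h := this.tendsto 0
    simp only [zero_mul] at h
    exact h.mono_left nhdsWithin_le_nhds
  refine squeeze_zero' (Eventually.of_forall fun _ => norm_nonneg _) ?_ hz
  filter_upwards [self_mem_nhdsWithin] with ε hε
  have hε : 0 < ε := hε
  have hc : (ε : ℂ) ≠ 0 := by exact_mod_cast hε.ne'
  set z : ℂ := -((ε * s : ℝ) * Complex.I) with hzdef
  have hn : ‖z‖ = ε * |s| := by
    rw [hzdef, norm_neg, norm_mul, Complex.norm_real, Complex.norm_I, mul_one, Real.norm_eq_abs,
      abs_mul, abs_of_pos hε]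
  have hb := Complex.norm_exp_sub_sum_le_norm_mul_exp z 3
  rw [hn] at hb
  have hsq : z ^ 2 = -((ε : ℂ) ^ 2 * s ^ 2) := by
    rw [hzdef, neg_sq, mul_pow, Complex.I_sq]; push_cast; ring
  have e : ((ε : ℂ) ^ 2)⁻¹ * (Complex.exp z - 1 + (ε * s : ℝ) * Complex.I) -
      (-(s ^ 2 / 2 : ℝ) : ℂ) =
      ((ε : ℂ) ^ 2)⁻¹ * (Complex.exp z - ∑ m ∈ Finset.range 3, z ^ m / m.factorial) := by
    simp only [Finset.sum_range_succ, Finset.sum_range_zero, hsq]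
    have hz' : z = -((ε * s : ℝ) * Complex.I) := rfl
    simp only [pow_zero, pow_one, Nat.factorial]
    nth_rewrite 3 [hz']
    push_cast
    field_simp
    ring
  rw [e, norm_mul, norm_inv, norm_pow, Complex.norm_real, Real.norm_eq_abs, abs_of_pos hε]
  calc (ε ^ 2)⁻¹ * _ ≤ (ε ^ 2)⁻¹ * ((ε * |s|) ^ 3 * Real.exp (ε * |s|)) :=
        mul_le_mul_of_nonneg_left hb (by positivity)
    _ = _ := by field_simp

/-- Dominated convergence with dominating function `|⟨x, u⟩ g(x)|`. The function `g` may change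
sign, as the odd part of a kernel does. -/
lemma HasMoments.tendsto_first {g : Space d → ℝ} (hg : HasMoments g) (u : Space d) :
    Tendsto (fun ε : ℝ => (ε : ℂ)⁻¹ *
      ∫ x, (Complex.exp (-(inner ℝ x (ε • u) * Complex.I)) - 1) * g x) (𝓝[>] 0)
      (𝓝 (-(inner ℝ (firstMoment g) u * Complex.I))) := by
  have hlim : (-(inner ℝ (firstMoment g) u * Complex.I) : ℂ) =
      ∫ x, -(inner ℝ x u * Complex.I) * g x := by
    rw [← hg.integral_inner_mul, ← integral_complex_ofReal, ← integral_mul_const, ← integral_neg]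
    refine integral_congr_ae (ae_of_all _ fun x => ?_)
    push_cast
    ring
  rw [hlim]
  simp_rw [← integral_const_mul, ← mul_assoc, inner_smul_right]
  refine tendsto_integral_filter_of_dominated_convergence (fun x => ‖inner ℝ x u * g x‖) ?_ ?_
    (hg.integrable_inner_mul u).norm (ae_of_all _ fun x => ?_)
  · refine Eventually.of_forall fun ε => ?_
    exact (Continuous.aestronglyMeasurable (by fun_prop)).mul
      (Complex.continuous_ofReal.comp_aestronglyMeasurable hg.aestronglyMeasurable)
  · filter_upwards [self_mem_nhdsWithin] with ε hε
    have hε : 0 < ε := hε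
    refine ae_of_all _ fun x => ?_
    rw [norm_mul, norm_mul, norm_mul, norm_inv, Complex.norm_real, Complex.norm_real,
      Real.norm_eq_abs, Real.norm_eq_abs, Real.norm_eq_abs, abs_of_pos hε]
    refine mul_le_mul_of_nonneg_right ?_ (abs_nonneg _)
    calc ε⁻¹ * _ ≤ ε⁻¹ * |ε * inner ℝ x u| :=
          mul_le_mul_of_nonneg_left (norm_exp_neg_mul_I_sub_one_le _) (by positivity)
      _ = _ := by rw [abs_mul, abs_of_pos hε]; field_simp
  · exact (tendsto_exponent_one _).mul_const _

/-- As the first moment vanishes, the linear Taylor term can be added to the integrand without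
changing the integral. The integrand is then of order `ε² ⟨x, u⟩²`, which matches the factor `ε⁻²`.
-/
lemma HasMoments.tendsto_second {g : Space d → ℝ} (hg : HasMoments g) (h0 : firstMoment g = 0)
    (u : Space d) :
    Tendsto (fun ε : ℝ => ((ε : ℂ) ^ 2)⁻¹ *
      ∫ x, (Complex.exp (-(inner ℝ x (ε • u) * Complex.I)) - 1) * g x) (𝓝[>] 0)
      (𝓝 (-((∑ i, ∑ j, secondMoment g i j * (u i * u j)) / 2 : ℝ))) := by
  have hsq : Integrable fun x => (inner ℝ x u) ^ 2 * g x := by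
    refine hg.integrable_mul 2 (‖u‖ ^ 2) (by fun_prop) fun x => ?_
    rw [abs_pow, ← mul_pow, mul_comm]
    exact pow_le_pow_left₀ (abs_nonneg _) (abs_real_inner_le_norm x u) 2
  have hlim : (-((∑ i, ∑ j, secondMoment g i j * (u i * u j)) / 2 : ℝ) : ℂ) =
      ∫ x, (-((inner ℝ x u) ^ 2 / 2 : ℝ) : ℂ) * g x := by
    rw [← hg.integral_inner_sq_mul, ← integral_div, ← integral_complex_ofReal, ← integral_neg]
    refine integral_congr_ae (ae_of_all _ fun x => ?_)
    push_cast
    ring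
  have hcomp : ∀ ε : ℝ, ∫ x, (Complex.exp (-(inner ℝ x (ε • u) * Complex.I)) - 1) * g x =
      ∫ x, (Complex.exp (-(inner ℝ x (ε • u) * Complex.I)) - 1 +
        inner ℝ x (ε • u) * Complex.I) * g x := by
    intro ε
    have h1 : ∫ x, ((inner ℝ x (ε • u) * g x : ℝ) : ℂ) * Complex.I = 0 := by
      rw [integral_mul_const, integral_complex_ofReal, hg.integral_inner_mul, h0]
      simp
    have hi1 : Integrable fun x => ((inner ℝ x (ε • u) * g x : ℝ) : ℂ) * Complex.I :=
      (hg.integrable_inner_mul _).ofReal.mul_const _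
    have hi2 : Integrable fun x =>
        (Complex.exp (-(inner ℝ x (ε • u) * Complex.I)) - 1) * (g x : ℂ) := by
      refine (hg.integrable_inner_mul (ε • u)).norm.mono'
        ((Continuous.aestronglyMeasurable (by fun_prop)).mul
        (Complex.continuous_ofReal.comp_aestronglyMeasurable hg.aestronglyMeasurable))
        (ae_of_all _ fun x => ?_)
      rw [norm_mul, norm_mul, Complex.norm_real]
      exact mul_le_mul_of_nonneg_right (norm_exp_neg_mul_I_sub_one_le _) (norm_nonneg _)
    rw [← add_zero (∫ x, (Complex.exp (-(inner ℝ x (ε • u) * Complex.I)) - 1) * (g x : ℂ)), ← h1,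
      ← integral_add hi2 hi1]
    refine integral_congr_ae (ae_of_all _ fun x => ?_)
    push_cast
    ring
  rw [hlim]
  simp_rw [hcomp, ← integral_const_mul, ← mul_assoc, inner_smul_right]
  refine tendsto_integral_filter_of_dominated_convergence
    (fun x => 2 * ‖(inner ℝ x u) ^ 2 * g x‖) ?_ ?_ (hsq.norm.const_mul 2)
    (ae_of_all _ fun x => ?_)
  · refine Eventually.of_forall fun ε => ?_
    exact (Continuous.aestronglyMeasurable (by fun_prop)).mul
      (Complex.continuous_ofReal.comp_aestronglyMeasurable hg.aestronglyMeasurable)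
  · filter_upwards [self_mem_nhdsWithin] with ε hε
    have hε : 0 < ε := hε
    refine ae_of_all _ fun x => ?_
    rw [norm_mul, norm_mul, norm_mul, norm_inv, norm_pow, norm_pow, Complex.norm_real,
      Complex.norm_real, Real.norm_eq_abs, Real.norm_eq_abs, Real.norm_eq_abs, abs_of_pos hε,
      ← mul_assoc, sq_abs]
    refine mul_le_mul_of_nonneg_right ?_ (abs_nonneg _)
    calc (ε ^ 2)⁻¹ * _ ≤ (ε ^ 2)⁻¹ * (2 * (ε * inner ℝ x u) ^ 2) :=
          mul_le_mul_of_nonneg_left (norm_exp_neg_mul_I_sub_one_add_le _) (by positivity)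
      _ = _ := by field_simp
  · exact (tendsto_exponent_two _).mul_const _

/-! ### The three scalings -/

lemma HasMoments.comp_neg {g : Space d → ℝ} (hg : HasMoments g) :
    HasMoments fun x => g (-x) := by
  refine ⟨?_, fun n => ?_⟩
  · exact hg.aestronglyMeasurable.comp_measurePreserving (Measure.measurePreserving_neg volume)
  · simpa using (hg.integrable n).comp_neg

lemma HasMoments.evenPart {g : Space d → ℝ} (hg : HasMoments g) : HasMoments (evenPart g) := by
  have h : ∀ n : ℕ, Integrable fun x => ‖x‖ ^ n * FreeKawasaki.evenPart g x := fun n => ?_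
  · exact ⟨by simpa using (h 0).aestronglyMeasurable, h⟩
  convert ((hg.integrable n).add (hg.comp_neg.integrable n)).div_const 2 using 1
  ext x
  simp only [FreeKawasaki.evenPart, Pi.add_apply]
  ring

lemma HasMoments.oddPart {g : Space d → ℝ} (hg : HasMoments g) : HasMoments (oddPart g) := by
  have h : ∀ n : ℕ, Integrable fun x => ‖x‖ ^ n * FreeKawasaki.oddPart g x := fun n => ?_
  · exact ⟨by simpa using (h 0).aestronglyMeasurable, h⟩
  convert ((hg.integrable n).sub (hg.comp_neg.integrable n)).div_const 2 using 1
  ext x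
  simp only [FreeKawasaki.oddPart, Pi.sub_apply]
  ring

lemma HasMoments.firstMoment_comp_neg (g : Space d → ℝ) :
    firstMoment (fun x => g (-x)) = -firstMoment g := by
  unfold firstMoment
  rw [← integral_neg_eq_self, ← integral_neg]
  simp

lemma HasMoments.firstMoment_evenPart {g : Space d → ℝ} (hg : HasMoments g) :
    firstMoment (FreeKawasaki.evenPart g) = 0 := by
  have h : ∀ x, FreeKawasaki.evenPart g x • x = (1 / 2 : ℝ) • (g x • x + g (-x) • x) := by
    intro x
    rw [← add_smul, smul_smul, FreeKawasaki.evenPart]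
    ring_nf
  unfold firstMoment
  simp_rw [h]
  rw [integral_smul, integral_add hg.integrable_smul hg.comp_neg.integrable_smul]
  have := HasMoments.firstMoment_comp_neg g
  unfold firstMoment at this
  rw [this]
  simp

lemma HasMoments.firstMoment_oddPart {g : Space d → ℝ} (hg : HasMoments g) :
    firstMoment (FreeKawasaki.oddPart g) = firstMoment g := by
  have h : ∀ x, FreeKawasaki.oddPart g x • x = (1 / 2 : ℝ) • (g x • x - g (-x) • x) := by
    intro x
    rw [← sub_smul, smul_smul, FreeKawasaki.oddPart]
    ring_nf
  unfold firstMoment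
  simp_rw [h]
  rw [integral_smul, integral_sub hg.integrable_smul hg.comp_neg.integrable_smul]
  have := HasMoments.firstMoment_comp_neg g
  unfold firstMoment at this
  rw [this, sub_neg_eq_add, ← two_smul ℝ, smul_smul]
  norm_num

lemma HasMoments.secondMoment_evenPart {g : Space d → ℝ} (hg : HasMoments g) :
    secondMoment (FreeKawasaki.evenPart g) = secondMoment g := by
  ext i j
  have h : ∀ x : Space d, x i * x j * FreeKawasaki.evenPart g x =
      (1 / 2 : ℝ) * (x i * x j * g x + x i * x j * g (-x)) := by
    intro x
    rw [FreeKawasaki.evenPart]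
    ring
  have h2 : ∫ x : Space d, x i * x j * g (-x) = ∫ x : Space d, x i * x j * g x := by
    rw [← integral_neg_eq_self]
    simp
  unfold secondMoment
  simp_rw [h]
  rw [integral_const_mul, integral_add (hg.integrable_coord_mul i j)
    (hg.comp_neg.integrable_coord_mul i j), h2]
  ring

/-- The kernel equals `((1 + ε) a(x) + (1 - ε) a(-x)) / 2`, and the odd part integrates to zero, so
the total rate does not depend on `ε`. -/
lemma IsJumpKernel.weaklyAsymmetric {a : Space d → ℝ} (ha : IsJumpKernel a) (hm : HasMoments a)
    {ε : ℝ} (h0 : 0 ≤ ε) (h1 : ε ≤ 1) : IsJumpKernel (weaklyAsymmetric a ε) := by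
  refine ⟨fun x => ?_, hm.evenPart.integrable_self.add (hm.oddPart.integrable_self.const_mul ε), ?_⟩
  · unfold FreeKawasaki.weaklyAsymmetric evenPart oddPart
    nlinarith [ha.nonneg x, ha.nonneg (-x)]
  · have e : ∫ x, oddPart a x = 0 := by
      have h := integral_neg_eq_self (oddPart a) volume
      have h2 : ∀ x, oddPart a (-x) = -oddPart a x := by
        intro x; unfold oddPart; rw [neg_neg]; ring
      simp_rw [h2, integral_neg] at h
      linarith
    have e2 : ∫ x, evenPart a x = totalRate a := by
      unfold evenPart totalRate
      rw [integral_div, integral_add hm.integrable_self hm.comp_neg.integrable_self,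
        integral_neg_eq_self]
      ring
    have : totalRate (FreeKawasaki.weaklyAsymmetric a ε) = totalRate a := by
      unfold FreeKawasaki.weaklyAsymmetric
      rw [totalRate, integral_add hm.evenPart.integrable_self
        (hm.oddPart.integrable_self.const_mul ε), integral_const_mul, e, e2]
      ring
    rw [this]
    exact ha.totalRate_pos

lemma tendsto_exponent_transport {a : Space d → ℝ} (hm : HasMoments a) (t : ℝ) (u : Space d) :
    Tendsto (fun ε : ℝ => ((t / ε ^ 1 : ℝ) : ℂ) *
        ∫ x, (Complex.exp (-(inner ℝ x (ε • u) * Complex.I)) - 1) * a x) (𝓝[>] 0)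
      (𝓝 (-(t * (inner ℝ (firstMoment a) u * Complex.I)) -
        t / 2 * ‖(0 : Space d →L[ℝ] Space d).adjoint u‖ ^ 2)) := by
  convert (hm.tendsto_first u).const_mul (t : ℂ) using 1
  · ext ε
    push_cast
    rw [pow_one, div_eq_mul_inv, mul_assoc]
  · simp

lemma tendsto_exponent_diffusion {a : Space d → ℝ} (hm : HasMoments a) (h0 : firstMoment a = 0)
    {S : Space d →L[ℝ] Space d} (hS : IsRootOf S (secondMoment a)) (t : ℝ) (u : Space d) :
    Tendsto (fun ε : ℝ => ((t / ε ^ 2 : ℝ) : ℂ) *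
        ∫ x, (Complex.exp (-(inner ℝ x (ε • u) * Complex.I)) - 1) * a x) (𝓝[>] 0)
      (𝓝 (-(t * (inner ℝ (0 : Space d) u * Complex.I)) - t / 2 * ‖S.adjoint u‖ ^ 2)) := by
  convert (hm.tendsto_second h0 u).const_mul (t : ℂ) using 1
  · ext ε
    push_cast
    rw [div_eq_mul_inv, mul_assoc]
  · rw [← hS.norm_adjoint_sq, inner_zero_left]
    push_cast
    ring_nf

/-- The weight `ε` of the odd part turns the factor `ε⁻²` into `ε⁻¹`, the first-order scaling that
produces the drift. The even part has vanishing first moment and produces the diffusion. -/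
lemma tendsto_exponent_weaklyAsymmetric {a : Space d → ℝ} (hm : HasMoments a)
    {S : Space d →L[ℝ] Space d} (hS : IsRootOf S (secondMoment a)) (t : ℝ) (u : Space d) :
    Tendsto (fun ε : ℝ => ((t / ε ^ 2 : ℝ) : ℂ) *
        ∫ x, (Complex.exp (-(inner ℝ x (ε • u) * Complex.I)) - 1) * weaklyAsymmetric a ε x)
      (𝓝[>] 0)
      (𝓝 (-(t * (inner ℝ (firstMoment a) u * Complex.I)) - t / 2 * ‖S.adjoint u‖ ^ 2)) := by
  have hint : ∀ {g : Space d → ℝ}, HasMoments g → ∀ ε : ℝ, Integrable fun x =>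
      (Complex.exp (-(inner ℝ x (ε • u) * Complex.I)) - 1) * (g x : ℂ) := by
    intro g hg ε
    refine (hg.integrable_inner_mul (ε • u)).norm.mono'
      ((Continuous.aestronglyMeasurable (by fun_prop)).mul
      (Complex.continuous_ofReal.comp_aestronglyMeasurable hg.aestronglyMeasurable))
      (ae_of_all _ fun x => ?_)
    rw [norm_mul, norm_mul, Complex.norm_real]
    exact mul_le_mul_of_nonneg_right (norm_exp_neg_mul_I_sub_one_le _) (norm_nonneg _)
  have h2 := (hm.evenPart.tendsto_second hm.firstMoment_evenPart u).const_mul (t : ℂ)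
  have h1 := (hm.oddPart.tendsto_first u).const_mul (t : ℂ)
  rw [hm.secondMoment_evenPart, ← hS.norm_adjoint_sq] at h2
  rw [hm.firstMoment_oddPart] at h1
  have h3 := h1.add h2
  have e0 : (t : ℂ) * -(inner ℝ (firstMoment a) u * Complex.I) +
      t * -((‖S.adjoint u‖ ^ 2 / 2 : ℝ) : ℂ) =
      -(t * (inner ℝ (firstMoment a) u * Complex.I)) - t / 2 * ‖S.adjoint u‖ ^ 2 := by
    push_cast
    ring
  rw [e0] at h3
  refine h3.congr' ?_
  · filter_upwards [self_mem_nhdsWithin] with ε hε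
    have hc : (ε : ℂ) ≠ 0 := by exact_mod_cast (ne_of_gt hε)
    have e : ∀ x : Space d, (Complex.exp (-(inner ℝ x (ε • u) * Complex.I)) - 1) *
        (weaklyAsymmetric a ε x : ℂ) =
        (Complex.exp (-(inner ℝ x (ε • u) * Complex.I)) - 1) * (FreeKawasaki.evenPart a x : ℂ) +
        ε * ((Complex.exp (-(inner ℝ x (ε • u) * Complex.I)) - 1) *
          (FreeKawasaki.oddPart a x : ℂ)) := by
      intro x
      rw [weaklyAsymmetric]
      push_cast
      ring
    simp_rw [e]
    rw [integral_add (hint hm.evenPart ε) ((hint hm.oddPart ε).const_mul _), integral_const_mul]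
    have key : ∀ X Y : ℂ, t * ((ε : ℂ)⁻¹ * X) + t * (((ε : ℂ) ^ 2)⁻¹ * Y) =
        ((t / ε ^ 2 : ℝ) : ℂ) * (Y + ε * X) := by
      intro X Y
      push_cast
      field_simp
      ring
    exact key _ _

/-! ### Laplace transforms of sums of independent variables -/

section IndependentSums

variable {Ω : Type*} [MeasurableSpace Ω] (P : Measure Ω) [IsProbabilityMeasure P]

/-- The cumulant `-log E e^{-Y}`. -/
noncomputable def logLaplace (Y : Ω → ℝ) : ℝ := -Real.log (∫ w, Real.exp (-Y w) ∂P)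

variable {P} {Y : Ω → ℝ}

lemma integrable_exp_neg (hY : Measurable Y) (h0 : ∀ w, 0 ≤ Y w) :
    Integrable (fun w => Real.exp (-Y w)) P := by
  refine Integrable.of_bound (C := 1) (Measurable.aestronglyMeasurable (by fun_prop))
    (ae_of_all _ fun w => ?_)
  rw [Real.norm_eq_abs, Real.abs_exp, Real.exp_le_one_iff]
  linarith [h0 w]

/-- Jensen's inequality, obtained by integrating the tangent line of `exp(-·)` at the mean. -/
lemma exp_neg_integral_le (hY : Measurable Y) (h0 : ∀ w, 0 ≤ Y w) (hi : Integrable Y P) :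
    Real.exp (-∫ w, Y w ∂P) ≤ ∫ w, Real.exp (-Y w) ∂P := by
  set m := ∫ w, Y w ∂P with hm
  have h : ∀ w, Real.exp (-m) * (1 + m - Y w) ≤ Real.exp (-Y w) := by
    intro w
    have h1 := Real.add_one_le_exp (m - Y w)
    calc Real.exp (-m) * (1 + m - Y w) ≤ Real.exp (-m) * Real.exp (m - Y w) :=
          mul_le_mul_of_nonneg_left (by linarith) (Real.exp_pos _).le
      _ = Real.exp (-Y w) := by rw [← Real.exp_add]; ring_nf
  have h2 : ∫ w, Real.exp (-m) * (1 + m - Y w) ∂P = Real.exp (-m) := by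
    rw [integral_const_mul, integral_sub (integrable_const _) hi, ← hm]
    simp
  rw [← h2]
  exact integral_mono (((integrable_const _).sub hi).const_mul _) (integrable_exp_neg hY h0) h

lemma integral_exp_neg_pos (hY : Measurable Y) (h0 : ∀ w, 0 ≤ Y w) :
    0 < ∫ w, Real.exp (-Y w) ∂P := by
  rw [integral_pos_iff_support_of_nonneg (fun _ => (Real.exp_pos _).le) (integrable_exp_neg hY h0)]
  have : Function.support (fun w => Real.exp (-Y w)) = univ := by
    ext w; simp [Real.exp_ne_zero]
  rw [this]
  simp

lemma exp_neg_logLaplace (hY : Measurable Y) (h0 : ∀ w, 0 ≤ Y w) :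
    Real.exp (-logLaplace P Y) = ∫ w, Real.exp (-Y w) ∂P := by
  rw [logLaplace, neg_neg, Real.exp_log (integral_exp_neg_pos hY h0)]

lemma logLaplace_nonneg (hY : Measurable Y) (h0 : ∀ w, 0 ≤ Y w) : 0 ≤ logLaplace P Y := by
  have h : ∫ w, Real.exp (-Y w) ∂P ≤ 1 := by
    calc ∫ w, Real.exp (-Y w) ∂P ≤ ∫ _, (1 : ℝ) ∂P :=
          integral_mono (integrable_exp_neg hY h0) (integrable_const _) fun w =>
            Real.exp_le_one_iff.2 (by linarith [h0 w])
      _ = 1 := by simp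
  rw [logLaplace, Left.nonneg_neg_iff]
  exact Real.log_nonpos (integral_exp_neg_pos hY h0).le h

lemma logLaplace_le (hY : Measurable Y) (h0 : ∀ w, 0 ≤ Y w) (hi : Integrable Y P) :
    logLaplace P Y ≤ ∫ w, Y w ∂P := by
  rw [← neg_le_neg_iff, ← Real.exp_le_exp, exp_neg_logLaplace hY h0]
  exact exp_neg_integral_le hY h0 hi

lemma exp_neg_le_quadratic {y : ℝ} (hy : 0 ≤ y) : Real.exp (-y) ≤ 1 - y + y ^ 2 := by
  rw [Real.exp_neg]
  have h1 : 1 + y ≤ Real.exp y := by linarith [Real.add_one_le_exp y]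
  calc (Real.exp y)⁻¹ ≤ (1 + y)⁻¹ := inv_anti₀ (by linarith) h1
    _ ≤ 1 - y + y ^ 2 := by
      rw [inv_le_iff_one_le_mul₀ (by linarith)]
      nlinarith [pow_nonneg hy 3]

/-- On `[0, δ]` one has `e^{-y} ≤ 1 - y + y² ≤ 1 - (1 - δ) y`; then `log z ≤ z - 1`. With
`logLaplace_le` this identifies cumulant and mean up to a relative error `δ`. -/
lemma le_logLaplace {δ : ℝ} (hY : Measurable Y) (h0 : ∀ w, 0 ≤ Y w) (hδ : ∀ w, Y w ≤ δ) :
    (1 - δ) * ∫ w, Y w ∂P ≤ logLaplace P Y := by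
  have hi : Integrable Y P := Integrable.of_bound (C := δ) hY.aestronglyMeasurable
    (ae_of_all _ fun w => by rw [Real.norm_eq_abs, abs_of_nonneg (h0 w)]; exact hδ w)
  have h1 : ∫ w, Real.exp (-Y w) ∂P ≤ 1 - (1 - δ) * ∫ w, Y w ∂P := by
    calc ∫ w, Real.exp (-Y w) ∂P ≤ ∫ w, (1 - (1 - δ) * Y w) ∂P := by
          refine integral_mono (integrable_exp_neg hY h0)
            ((integrable_const _).sub (hi.const_mul _)) fun w => ?_
          refine (exp_neg_le_quadratic (h0 w)).trans ?_
          nlinarith [h0 w, hδ w]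
      _ = _ := by
          rw [integral_sub (integrable_const _) (hi.const_mul _), integral_const_mul]
          simp
  have h2 := Real.log_le_sub_one_of_pos (integral_exp_neg_pos (P := P) hY h0)
  rw [logLaplace]
  linarith

lemma integral_exp_neg_sum {ι : Type*} {Y : ι → Ω → ℝ} (hY : ∀ i, Measurable (Y i))
    (h0 : ∀ i w, 0 ≤ Y i w) (s : Finset ι) :
    ∫ w : ι → Ω, Real.exp (-∑ i ∈ s, Y i (w i)) ∂(Measure.infinitePi fun _ : ι => P) =
      Real.exp (-∑ i ∈ s, logLaplace P (Y i)) := by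
  have hm : Measurable fun y : (i : s) → Ω => ∏ i : s, Real.exp (-Y i (y i)) :=
    Finset.measurable_prod _ fun i _ => ((hY i).comp (measurable_pi_apply i)).neg.exp
  have h1 : ∀ w : ι → Ω, Real.exp (-∑ i ∈ s, Y i (w i)) =
      (fun y : (i : s) → Ω => ∏ i : s, Real.exp (-Y i (y i))) (s.restrict w) := by
    intro w
    simp only [Finset.restrict]
    rw [Finset.prod_coe_sort s fun i => Real.exp (-Y i (w i)), ← Real.exp_sum,
      Finset.sum_neg_distrib]
  simp_rw [h1]
  rw [integral_restrict_infinitePi (μ := fun _ : ι => P) hm.aestronglyMeasurable,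
    integral_fintype_prod_eq_prod (fun (i : s) (w : Ω) => Real.exp (-Y i w)),
    Finset.prod_coe_sort s fun i => ∫ w, Real.exp (-Y i w) ∂P, ← Finset.sum_neg_distrib,
    Real.exp_sum]
  exact Finset.prod_congr rfl fun i _ => (exp_neg_logLaplace (hY i) (h0 i)).symm

/-- Summable means make the random series finite almost surely, so the value `toReal ⊤ = 0` plays no
role. The finite products then converge by dominated convergence with bound 1. -/
lemma integral_exp_neg_tsum {ι : Type*} [Countable ι] {Y : ι → Ω → ℝ}
    (hY : ∀ i, Measurable (Y i)) (h0 : ∀ i w, 0 ≤ Y i w) (hi : ∀ i, Integrable (Y i) P)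
    (hsum : ∑' i, ENNReal.ofReal (∫ w, Y i w ∂P) ≠ ⊤) :
    ∫ w : ι → Ω, Real.exp (-(∑' i, ENNReal.ofReal (Y i (w i))).toReal)
        ∂(Measure.infinitePi fun _ : ι => P) =
      Real.exp (-∑' i, logLaplace P (Y i)) := by
  have hs : Summable fun i => logLaplace P (Y i) := by
    refine Summable.of_nonneg_of_le (fun i => logLaplace_nonneg (hY i) (h0 i))
      (fun i => logLaplace_le (hY i) (h0 i) (hi i)) ?_
    convert ENNReal.summable_toReal hsum using 2 with i
    rw [ENNReal.toReal_ofReal (integral_nonneg (h0 i))]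
  have hYm : ∀ i, Measurable fun w : ι → Ω => Y i (w i) :=
    fun i => (hY i).comp (measurable_pi_apply i)
  have hfin : ∀ᵐ w ∂(Measure.infinitePi fun _ : ι => P),
      ∑' i, ENNReal.ofReal (Y i (w i)) < ⊤ := by
    refine ae_lt_top (Measurable.tsum fun i => (hYm i).ennreal_ofReal) ?_
    rw [lintegral_tsum fun i => (hYm i).ennreal_ofReal.aemeasurable]
    convert hsum using 3 with i
    have h := lintegral_map (μ := Measure.infinitePi fun _ : ι => P) (hY i).ennreal_ofReal
      (measurable_pi_apply i)
    rw [Measure.infinitePi_map_eval] at h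
    rw [ofReal_integral_eq_lintegral_ofReal (hi i) (ae_of_all _ (h0 i)), h]
  refine tendsto_nhds_unique (f := fun s : Finset ι => Real.exp (-∑ i ∈ s, logLaplace P (Y i)))
    (l := atTop) ?_ ((Real.continuous_exp.tendsto _).comp (Tendsto.neg hs.hasSum))
  simp_rw [← integral_exp_neg_sum hY h0]
  refine tendsto_integral_filter_of_dominated_convergence (fun _ => 1) ?_ ?_ (integrable_const _) ?_
  · exact Eventually.of_forall fun s => Measurable.aestronglyMeasurable
      (Finset.measurable_sum _ fun i _ => hYm i).neg.exp
  · refine Eventually.of_forall fun s => ae_of_all _ fun w => ?_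
    rw [Real.norm_eq_abs, Real.abs_exp, Real.exp_le_one_iff, Left.neg_nonpos_iff]
    exact Finset.sum_nonneg fun i _ => h0 i _
  · filter_upwards [hfin] with w hw
    have h1 : Summable fun i => Y i (w i) := by
      convert ENNReal.summable_toReal hw.ne using 2 with i
      rw [ENNReal.toReal_ofReal (h0 i _)]
    have h2 : (∑' i, ENNReal.ofReal (Y i (w i))).toReal = ∑' i, Y i (w i) := by
      rw [ENNReal.tsum_toReal_eq fun i => ENNReal.ofReal_ne_top]
      exact tsum_congr fun i => ENNReal.toReal_ofReal (h0 i _)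
    rw [h2]
    exact (Real.continuous_exp.tendsto _).comp (Tendsto.neg h1.hasSum)

end IndependentSums

/-! ### Configurations -/

lemma Configuration.countable (γ : Configuration d) : γ.1.Countable := by
  have h : γ.1 = ⋃ n : ℕ, γ.1 ∩ Metric.closedBall 0 (n : ℝ) := by
    rw [← inter_iUnion, Metric.iUnion_closedBall_nat, inter_univ]
  rw [h]
  exact countable_iUnion fun n => (γ.2 _ (isCompact_closedBall _ _)).countable

lemma Configuration.lintegral_toMeasure (γ : Configuration d) {g : Space d → ℝ≥0∞}
    (hg : Measurable g) : ∫⁻ x, g x ∂γ.toMeasure = ∑' x : γ.1, g x := by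
  rw [Configuration.toMeasure, lintegral_sum_measure]
  exact tsum_congr fun x => lintegral_dirac' _ hg

lemma measurable_tsum_configuration {g : Space d → ℝ≥0∞} (hg : Measurable g) :
    Measurable fun γ : Configuration d => ∑' x : γ.1, g x := by
  simp_rw [← Configuration.lintegral_toMeasure _ hg]
  exact (Measure.measurable_lintegral hg).comp (comap_measurable Configuration.toMeasure)

/-! ### The Laplace transform of the rescaled field -/

/-- The contribution of one particle to the rescaled field. -/
noncomputable def particleField (ε T : ℝ) (φ : Space d → ℝ) (x : Space d) (w : ParticleSample d) :
    ℝ :=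
  ε ^ d * φ (ε • (x + displacement w T))

/-- No integrability is needed: the Bochner integral of a non-integrable function and `toReal ⊤` are
both zero. -/
lemma rescaledField_eq {κ : ℕ} {ε t : ℝ} (hε : 0 ≤ ε) {φ : Space d → ℝ} (hφ : Continuous φ)
    (h0 : ∀ x, 0 ≤ φ x) (γ : Configuration d) (w : γ.1 → ParticleSample d) :
    rescaledField κ ε t φ γ w =
      (∑' x : γ.1, ENNReal.ofReal (particleField ε (t / ε ^ κ) φ x (w x))).toReal := by
  have hc : Continuous fun x : Space d => φ (ε • x) := by fun_prop
  rw [rescaledField, process, integral_eq_lintegral_of_nonneg_ae (ae_of_all _ fun x => h0 _)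
    hc.aestronglyMeasurable, lintegral_sum_measure]
  simp_rw [lintegral_dirac' _ hc.measurable.ennreal_ofReal, particlePath_eq, particleField,
    ENNReal.ofReal_mul (pow_nonneg hε d)]
  rw [ENNReal.tsum_mul_left, ENNReal.toReal_mul, ENNReal.toReal_ofReal (pow_nonneg hε d)]

lemma measurable_particleField {φ : Space d → ℝ} (hφ : Measurable φ) (ε T : ℝ) :
    Measurable fun z : Space d × ParticleSample d => particleField ε T φ z.1 z.2 := by
  have h := measurable_displacement (d := d) T
  have h2 : Measurable fun z : Space d × ParticleSample d => ε • (z.1 + displacement z.2 T) := by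
    fun_prop
  exact (hφ.comp h2).const_mul _

/-! ### The law of large numbers for linear statistics -/

/-- The linear statistic `∑_{x ∈ γ} h(x)`. -/
noncomputable def linearStatistic (h : Space d → ℝ) (γ : Configuration d) : ℝ≥0∞ :=
  ∑' x : γ.1, ENNReal.ofReal (h x)

lemma measurable_linearStatistic {h : Space d → ℝ} (hh : Measurable h) :
    Measurable (linearStatistic h) :=
  measurable_tsum_configuration hh.ennreal_ofReal

section Moments

variable {μ : Measure (Configuration d)} {ρ : Space d → ℝ} {k : Space d → Space d → ℝ}
  {h : Space d → ℝ} {M H C : ℝ}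

lemma IsFirstCorrelationFunction.integrable_mul (hρ : IsFirstCorrelationFunction μ ρ)
    (hM : ∀ x, ρ x ≤ M) (hi : Integrable h) : Integrable fun x => h x * ρ x :=
  hi.mul_bdd (c := M) hρ.measurable.aestronglyMeasurable (ae_of_all _ fun x => by
    rw [Real.norm_eq_abs, abs_of_nonneg (hρ.nonneg x)]; exact hM x)

lemma IsFirstCorrelationFunction.lintegral_linearStatistic (hρ : IsFirstCorrelationFunction μ ρ)
    (hM : ∀ x, ρ x ≤ M) (hh : Measurable h) (h0 : ∀ x, 0 ≤ h x) (hi : Integrable h) :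
    ∫⁻ γ, linearStatistic h γ ∂μ = ENNReal.ofReal (∫ x, h x * ρ x) := by
  unfold linearStatistic
  rw [hρ.campbell (fun x => ENNReal.ofReal (h x)) hh.ennreal_ofReal,
    ofReal_integral_eq_lintegral_ofReal (hρ.integrable_mul hM hi)
      (ae_of_all _ fun x => mul_nonneg (h0 x) (hρ.nonneg x))]
  exact lintegral_congr fun x => (ENNReal.ofReal_mul (h0 x)).symm

-- Splitting off the diagonal puts the double sum in the form to which the two Campbell formulas
-- apply.
open scoped Classical in
lemma linearStatistic_sq (h : Space d → ℝ) (γ : Configuration d) :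
    linearStatistic h γ ^ 2 =
      (∑' x : γ.1, ∑' y : γ.1,
        (if x = y then 0 else ENNReal.ofReal (h x) * ENNReal.ofReal (h y))) +
      ∑' x : γ.1, ENNReal.ofReal (h x) * ENNReal.ofReal (h x) := by
  rw [sq, linearStatistic, ← ENNReal.tsum_mul_right, ← ENNReal.tsum_add]
  refine tsum_congr fun x => ?_
  rw [← ENNReal.tsum_mul_left, ENNReal.tsum_eq_add_tsum_ite x, add_comm]
  simp_rw [eq_comm]

/-- With `k = ρ ρ + u`, the product part gives the squared mean, the Ursell part at most `H C ∫ h`,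
and the diagonal at most `H M ∫ h`. So the variance is small as soon as `sup h` is small, even if `∫
h` is not. -/
lemma lintegral_second_moment_le (hρ : IsFirstCorrelationFunction μ ρ)
    (hk : IsSecondCorrelationFunction μ k) (hM : ∀ x, ρ x ≤ M) (hh : Measurable h)
    (h0 : ∀ x, 0 ≤ h x) (hH : ∀ x, h x ≤ H) (hi : Integrable h)
    (hu : ∀ x, Integrable (fun y => ursell ρ k x y) ∧ ∫ y, |ursell ρ k x y| ≤ C) :
    ∫⁻ γ, linearStatistic h γ ^ 2 ∂μ ≤
      ENNReal.ofReal ((∫ x, h x * ρ x) ^ 2 + (C + M) * H * ∫ x, h x) := by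
  classical
  set m := ∫ x, h x * ρ x with hm
  have hm0 : 0 ≤ m := integral_nonneg fun x => mul_nonneg (h0 x) (hρ.nonneg x)
  have hC : 0 ≤ C := (integral_nonneg fun _ => abs_nonneg _).trans (hu 0).2
  have hM0 : 0 ≤ M := (hρ.nonneg 0).trans (hM 0)
  have hH0 : 0 ≤ H := (h0 0).trans (hH 0)
  have hI0 : 0 ≤ ∫ x, h x := integral_nonneg h0
  have hlin : ∫⁻ x, ENNReal.ofReal (h x) = ENNReal.ofReal (∫ x, h x) :=
    (ofReal_integral_eq_lintegral_ofReal hi (ae_of_all _ h0)).symm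
  have hlinρ : ∫⁻ x, ENNReal.ofReal (h x) * ENNReal.ofReal (ρ x) = ENNReal.ofReal m := by
    rw [hm, ofReal_integral_eq_lintegral_ofReal (hρ.integrable_mul hM hi)
      (ae_of_all _ fun x => mul_nonneg (h0 x) (hρ.nonneg x))]
    exact lintegral_congr fun x => (ENNReal.ofReal_mul (h0 x)).symm
  have hme := hh.ennreal_ofReal
  have hmρ : Measurable fun x => ENNReal.ofReal (h x) * ENNReal.ofReal (ρ x) :=
    hme.mul hρ.measurable.ennreal_ofReal
  have hmh : Measurable fun x => ENNReal.ofReal (h x) * ENNReal.ofReal (h x) := hme.mul hme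
  have hinner : ∀ x, ∫⁻ y, ENNReal.ofReal (h x) * ENNReal.ofReal (h y) * ENNReal.ofReal (k x y) ≤
      ENNReal.ofReal (h x) * ENNReal.ofReal (ρ x) * ENNReal.ofReal m +
        ENNReal.ofReal (h x) * ENNReal.ofReal (H * C) := by
    intro x
    have hb : ∀ y, ENNReal.ofReal (h x) * ENNReal.ofReal (h y) * ENNReal.ofReal (k x y) ≤
        ENNReal.ofReal (h x) * ENNReal.ofReal (ρ x) *
          (ENNReal.ofReal (h y) * ENNReal.ofReal (ρ y)) +
        ENNReal.ofReal (h x) * ENNReal.ofReal H * ENNReal.ofReal |ursell ρ k x y| := by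
      intro y
      have e : k x y ≤ ρ x * ρ y + |ursell ρ k x y| := by
        have := le_abs_self (ursell ρ k x y)
        rw [ursell] at this ⊢
        linarith
      rw [← ENNReal.ofReal_mul (h0 x), ← ENNReal.ofReal_mul (mul_nonneg (h0 x) (h0 y)),
        ← ENNReal.ofReal_mul (h0 x), ← ENNReal.ofReal_mul (h0 y),
        ← ENNReal.ofReal_mul (mul_nonneg (h0 x) (hρ.nonneg x)), ← ENNReal.ofReal_mul (h0 x),
        ← ENNReal.ofReal_mul (mul_nonneg (h0 x) hH0), ← ENNReal.ofReal_add]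
      · refine ENNReal.ofReal_le_ofReal ?_
        calc h x * h y * k x y ≤ h x * h y * (ρ x * ρ y + |ursell ρ k x y|) :=
              mul_le_mul_of_nonneg_left e (mul_nonneg (h0 x) (h0 y))
          _ = h x * ρ x * (h y * ρ y) + h x * h y * |ursell ρ k x y| := by ring
          _ ≤ _ := by
              gcongr
              · exact h0 x
              · exact hH y
      · exact mul_nonneg (mul_nonneg (h0 x) (hρ.nonneg x)) (mul_nonneg (h0 y) (hρ.nonneg y))
      · exact mul_nonneg (mul_nonneg (h0 x) hH0) (abs_nonneg _)
    refine (lintegral_mono hb).trans ?_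
    rw [lintegral_add_left (hmρ.const_mul _),
      lintegral_const_mul _ hmρ, hlinρ,
      lintegral_const_mul' _ _ (ENNReal.mul_ne_top ENNReal.ofReal_ne_top ENNReal.ofReal_ne_top),
      ← ofReal_integral_eq_lintegral_ofReal (hu x).1.abs (ae_of_all _ fun _ => abs_nonneg _),
      mul_assoc (ENNReal.ofReal (h x)) (ENNReal.ofReal H), ← ENNReal.ofReal_mul hH0]
    gcongr
    exact (hu x).2
  have hpair : ∫⁻ γ : Configuration d, ∑' x : γ.1, ∑' y : γ.1,
      (if x = y then 0 else ENNReal.ofReal (h x) * ENNReal.ofReal (h y)) ∂μ ≤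
      ENNReal.ofReal m * ENNReal.ofReal m + ENNReal.ofReal (∫ x, h x) * ENNReal.ofReal (H * C) := by
    have hc := hk.campbell (fun x y => ENNReal.ofReal (h x) * ENNReal.ofReal (h y))
      ((hme.comp measurable_fst).mul (hme.comp measurable_snd))
    refine hc.le.trans ((lintegral_mono hinner).trans (le_of_eq ?_))
    rw [lintegral_add_left (hmρ.mul_const _),
      lintegral_mul_const _ hmρ, hlinρ, lintegral_mul_const _ hme, hlin]
  have hdiag : ∫⁻ γ : Configuration d, ∑' x : γ.1,
      ENNReal.ofReal (h x) * ENNReal.ofReal (h x) ∂μ ≤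
      ENNReal.ofReal (∫ x, h x) * ENNReal.ofReal (H * M) := by
    rw [hρ.campbell (fun x => ENNReal.ofReal (h x) * ENNReal.ofReal (h x)) hmh, ← hlin,
      ← lintegral_mul_const _ hme]
    refine lintegral_mono fun x => ?_
    rw [ENNReal.ofReal_mul hH0, mul_assoc]
    gcongr
    · exact hH x
    · exact hM x
  have hsplit : ∫⁻ γ, linearStatistic h γ ^ 2 ∂μ = _ :=
    (lintegral_congr fun γ => linearStatistic_sq h γ).trans
      (lintegral_add_right _ (measurable_tsum_configuration hmh))
  rw [hsplit]
  refine (add_le_add hpair hdiag).trans (le_of_eq ?_)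
  rw [← ENNReal.ofReal_mul hm0, ← ENNReal.ofReal_mul hI0, ← ENNReal.ofReal_mul hI0,
    ← ENNReal.ofReal_add (by positivity) (by positivity),
    ← ENNReal.ofReal_add (by positivity) (by positivity)]
  congr 1
  ring

lemma abs_exp_neg_sub_exp_neg_le {x y : ℝ} (hx : 0 ≤ x) (hy : 0 ≤ y) :
    |Real.exp (-x) - Real.exp (-y)| ≤ |x - y| := by
  wlog hxy : x ≤ y generalizing x y
  · rw [abs_sub_comm, abs_sub_comm x]
    exact this hy hx (le_of_not_ge hxy)
  have h1 := Real.add_one_le_exp (x - y)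
  have h2 : Real.exp (-y) = Real.exp (-x) * Real.exp (x - y) := by
    rw [← Real.exp_add]; ring_nf
  have h3 : Real.exp (-x) ≤ 1 := Real.exp_le_one_iff.2 (by linarith)
  have h4 : Real.exp (x - y) ≤ 1 := Real.exp_le_one_iff.2 (by linarith)
  rw [h2, abs_of_nonneg (by nlinarith [Real.exp_pos (-x)]), abs_of_nonpos (by linarith)]
  nlinarith [Real.exp_pos (-x)]

/-- The function `e^{-x}` is 1-Lipschitz on `[0, ∞)`, so the error is at most the mean absolute
deviation, which is at most the standard deviation. -/
lemma abs_laplace_linearStatistic_sub_le [IsProbabilityMeasure μ]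
    (hρ : IsFirstCorrelationFunction μ ρ)
    (hk : IsSecondCorrelationFunction μ k) (hM : ∀ x, ρ x ≤ M) (hh : Measurable h)
    (h0 : ∀ x, 0 ≤ h x) (hH : ∀ x, h x ≤ H) (hi : Integrable h)
    (hu : ∀ x, Integrable (fun y => ursell ρ k x y) ∧ ∫ y, |ursell ρ k x y| ≤ C) :
    |(∫ γ, Real.exp (-(linearStatistic h γ).toReal) ∂μ) - Real.exp (-∫ x, h x * ρ x)| ≤
      √((C + M) * H * ∫ x, h x) := by
  set m := ∫ x, h x * ρ x with hm
  have hm0 : 0 ≤ m := integral_nonneg fun x => mul_nonneg (h0 x) (hρ.nonneg x)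
  set N : Configuration d → ℝ := fun γ => (linearStatistic h γ).toReal with hN
  have hLm := measurable_linearStatistic hh
  have hNm : Measurable N := hLm.ennreal_toReal
  have hN0 : ∀ γ, 0 ≤ N γ := fun γ => ENNReal.toReal_nonneg
  have h1 := hρ.lintegral_linearStatistic hM hh h0 hi
  have h2 := lintegral_second_moment_le hρ hk hM hh h0 hH hi hu
  have hfin : ∀ᵐ γ ∂μ, linearStatistic h γ < ⊤ :=
    ae_lt_top hLm (by rw [h1]; exact ENNReal.ofReal_ne_top)
  have hNi : Integrable N μ :=
    integrable_toReal_of_lintegral_ne_top hLm.aemeasurable (by rw [h1]; exact ENNReal.ofReal_ne_top)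
  have hEN : ∫ γ, N γ ∂μ = m := by
    rw [integral_toReal hLm.aemeasurable hfin, h1, ENNReal.toReal_ofReal hm0]
  have hsq : ∀ γ, N γ ^ 2 = (linearStatistic h γ ^ 2).toReal := fun γ => by
    rw [ENNReal.toReal_pow]
  have h2' : ∫⁻ γ, linearStatistic h γ ^ 2 ∂μ ≠ ⊤ := (h2.trans_lt ENNReal.ofReal_lt_top).ne
  have hN2i : Integrable (fun γ => N γ ^ 2) μ := by
    simp_rw [hsq]
    exact integrable_toReal_of_lintegral_ne_top (hLm.pow_const 2).aemeasurable h2'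
  have hv0 : 0 ≤ (C + M) * H * ∫ x, h x := by
    have hC : 0 ≤ C := (integral_nonneg fun _ => abs_nonneg _).trans (hu 0).2
    have hM0 : 0 ≤ M := (hρ.nonneg 0).trans (hM 0)
    have hH0 : 0 ≤ H := (h0 0).trans (hH 0)
    have hI0 : 0 ≤ ∫ x, h x := integral_nonneg h0
    positivity
  have hEN2 : ∫ γ, N γ ^ 2 ∂μ ≤ m ^ 2 + (C + M) * H * ∫ x, h x := by
    simp_rw [hsq]
    rw [integral_toReal (hLm.pow_const 2).aemeasurable
      (ae_lt_top (hLm.pow_const 2) h2')]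
    exact ENNReal.toReal_le_of_le_ofReal (by positivity) h2
  have hDi : Integrable (fun γ => |N γ - m|) μ := (hNi.sub (integrable_const m)).abs
  have hvar : (∫ γ, |N γ - m| ∂μ) ^ 2 ≤ (C + M) * H * ∫ x, h x := by
    set c := ∫ γ, |N γ - m| ∂μ with hc
    -- Integrating this square, which is non-negative, gives `c² ≤ E (N - m)²`.
    have e : ∀ γ, (|N γ - m| - c) ^ 2 =
        N γ ^ 2 - 2 * m * N γ + m ^ 2 - 2 * c * |N γ - m| + c ^ 2 := by
      intro γ
      rw [sub_sq, sq_abs]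
      ring
    have hnn : 0 ≤ ∫ γ, (|N γ - m| - c) ^ 2 ∂μ := integral_nonneg fun _ => sq_nonneg _
    simp_rw [e] at hnn
    have i1 : Integrable (fun γ => N γ ^ 2 - 2 * m * N γ) μ := hN2i.sub (hNi.const_mul _)
    have i2 : Integrable (fun γ => N γ ^ 2 - 2 * m * N γ + m ^ 2) μ := i1.add (integrable_const _)
    have i3 : Integrable (fun γ => N γ ^ 2 - 2 * m * N γ + m ^ 2 - 2 * c * |N γ - m|) μ :=
      i2.sub (hDi.const_mul _)
    rw [integral_add i3 (integrable_const _), integral_sub i2 (hDi.const_mul _),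
      integral_add i1 (integrable_const _), integral_sub hN2i (hNi.const_mul _),
      integral_const_mul, integral_const_mul, hEN, ← hc] at hnn
    simp only [integral_const, probReal_univ, smul_eq_mul, one_mul] at hnn
    nlinarith
  have hei : Integrable (fun γ => Real.exp (-N γ)) μ := integrable_exp_neg hNm hN0
  calc |(∫ γ, Real.exp (-N γ) ∂μ) - Real.exp (-m)|
      = |∫ γ, (Real.exp (-N γ) - Real.exp (-m)) ∂μ| := by
        rw [integral_sub hei (integrable_const _)]
        simp
    _ ≤ ∫ γ, |Real.exp (-N γ) - Real.exp (-m)| ∂μ := abs_integral_le_integral_abs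
    _ ≤ ∫ γ, |N γ - m| ∂μ := integral_mono (hei.sub (integrable_const _)).abs hDi
        fun γ => abs_exp_neg_sub_exp_neg_le (hN0 γ) hm0
    _ ≤ _ := Real.le_sqrt_of_sq_le hvar

end Moments

/-! ### Averages over the displacement -/

/-- The average of `φ(y + Z)` over a random shift `Z`. -/
noncomputable def averageShift {Ω : Type*} [MeasurableSpace Ω] (ν : Measure Ω) (Z : Ω → Space d)
    (φ : Space d → ℝ) (y : Space d) : ℝ :=
  ∫ w, φ (y + Z w) ∂ν

section AverageShift

variable {Ω : Type*} [MeasurableSpace Ω] {ν : Measure Ω} {Z : Ω → Space d} {φ : Space d → ℝ}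

lemma averageShift_nonneg (h0 : ∀ x, 0 ≤ φ x) (y : Space d) : 0 ≤ averageShift ν Z φ y :=
  integral_nonneg fun _ => h0 _

variable [IsProbabilityMeasure ν]

lemma integrable_averageShift (hZ : Measurable Z) (hφm : Measurable φ) (hφ : Integrable φ) :
    Integrable (averageShift ν Z φ) :=
  (integrable_shift_prod ν hZ hφm hφ).integral_prod_right

/-- Mass conservation supplies the equal-integral hypothesis of Scheffé's lemma. -/
lemma integral_averageShift (hZ : Measurable Z) (hφm : Measurable φ) (hφ : Integrable φ) :
    ∫ y, averageShift ν Z φ y = ∫ y, φ y := by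
  have h := integral_mul_shift ν hZ (f := fun _ => (1 : ℝ)) measurable_const (C := 1)
    (fun _ => by simp) hφm hφ
  simp only [one_mul, integral_add_right_eq_self, integral_const, probReal_univ, one_smul] at h
  exact h

end AverageShift

/-- **Scheffé's lemma** for non-negative functions with the same integral. -/
lemma tendsto_integral_abs_sub {X ι : Type*} [MeasurableSpace X] {ν : Measure X} {l : Filter ι}
    [l.IsCountablyGenerated] {F : ι → X → ℝ} {G : X → ℝ} (hG : Integrable G ν)
    (hG0 : ∀ x, 0 ≤ G x) (hF : ∀ᶠ i in l, Integrable (F i) ν ∧ (∀ x, 0 ≤ F i x) ∧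
      ∫ x, F i x ∂ν = ∫ x, G x ∂ν)
    (hlim : ∀ x, Tendsto (fun i => F i x) l (𝓝 (G x))) :
    Tendsto (fun i => ∫ x, |F i x - G x| ∂ν) l (𝓝 0) := by
  have h1 : Tendsto (fun i => ∫ x, max (G x - F i x) 0 ∂ν) l (𝓝 (∫ _, (0 : ℝ) ∂ν)) := by
    refine tendsto_integral_filter_of_dominated_convergence G ?_ ?_ hG (ae_of_all _ fun x => ?_)
    · filter_upwards [hF] with i hi
      exact (hG.sub hi.1).pos_part.aestronglyMeasurable
    · filter_upwards [hF] with i hi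
      refine ae_of_all _ fun x => ?_
      rw [Real.norm_eq_abs, abs_of_nonneg (le_max_right _ _)]
      exact max_le (by linarith [hi.2.1 x]) (hG0 x)
    · have := ((hlim x).const_sub (G x)).max (tendsto_const_nhds (x := (0 : ℝ)))
      simpa using this
  have h2 := h1.const_mul 2
  simp only [integral_zero, mul_zero] at h2
  refine h2.congr' ?_
  filter_upwards [hF] with i hi
  -- The last summand integrates to zero because the masses agree, and the positive part of `G - F`
  -- is dominated by `G`.
  have e : ∀ x, |F i x - G x| = 2 * max (G x - F i x) 0 + (F i x - G x) := by
    intro x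
    rcases le_total (F i x) (G x) with h | h
    · rw [abs_of_nonpos (by linarith), max_eq_left (by linarith)]; ring
    · rw [abs_of_nonneg (by linarith), max_eq_right (by linarith)]; ring
  simp_rw [e]
  have hp : Integrable (fun x => max (G x - F i x) 0) ν := (hG.sub hi.1).pos_part
  have hs : Integrable (fun x => F i x - G x) ν := hi.1.sub hG
  rw [integral_add (hp.const_mul 2) hs,
    integral_const_mul,
    integral_sub hi.1 hG, hi.2.2]
  ring

/-! ### The Laplace transform of the field as that of a linear statistic -/

section Field

variable {a : Space d → ℝ} {φ : Space d → ℝ} {ε T : ℝ}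

lemma integral_particleField (a : Space d → ℝ) (φ : Space d → ℝ) (ε T : ℝ) (x : Space d) :
    ∫ w, particleField ε T φ x w ∂(particleLaw a) =
      ε ^ d * averageShift (particleLaw a) (fun w => ε • displacement w T) φ (ε • x) := by
  unfold particleField averageShift
  rw [integral_const_mul]
  simp_rw [smul_add]

lemma integral_comp_smul_scale (hε : 0 < ε) (F : Space d → ℝ) :
    ∫ x, ε ^ d * F (ε • x) = ∫ y, F y := by
  rw [integral_const_mul, Measure.integral_comp_smul_of_nonneg _ _ _ (hR := hε.le),
    finrank_euclideanSpace_fin, smul_eq_mul, mul_inv_cancel_left₀ (pow_pos hε d).ne']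

lemma measurable_smul_displacement (ε T : ℝ) :
    Measurable fun w : ParticleSample d => ε • displacement w T := by
  have := measurable_displacement (d := d) T
  fun_prop

/-- The logarithmic Laplace transform of the contribution of a particle started in `x`. -/
noncomputable def fieldCumulant (a : Space d → ℝ) (ε T : ℝ) (φ : Space d → ℝ) (x : Space d) : ℝ :=
  logLaplace (particleLaw a) (particleField ε T φ x)

lemma measurable_particleField_right (hφ : Measurable φ) (x : Space d) :
    Measurable (particleField ε T φ x) :=
  (measurable_particleField hφ ε T).comp (measurable_const.prodMk measurable_id)

lemma measurable_fieldCumulant (ha : IsJumpKernel a) (hφ : Measurable φ) :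
    Measurable (fieldCumulant a ε T φ) := by
  have := ha.isProbabilityMeasure_particleLaw
  have h : StronglyMeasurable fun z : Space d × ParticleSample d =>
      Real.exp (-particleField ε T φ z.1 z.2) :=
    (measurable_particleField hφ ε T).neg.exp.stronglyMeasurable
  exact h.integral_prod_right.measurable.log.neg

lemma integrable_mean_particleField (ha : IsJumpKernel a) (hφ : Measurable φ)
    (hi : Integrable φ) (hε : 0 < ε) :
    Integrable fun x => ∫ w, particleField ε T φ x w ∂(particleLaw a) := by
  have := ha.isProbabilityMeasure_particleLaw
  simp_rw [integral_particleField]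
  exact ((integrable_averageShift (measurable_smul_displacement ε T) hφ hi).comp_smul
    hε.ne').const_mul _

lemma integral_mean_particleField (ha : IsJumpKernel a) (hφ : Measurable φ)
    (hi : Integrable φ) (hε : 0 < ε) :
    ∫ x, ∫ w, particleField ε T φ x w ∂(particleLaw a) = ∫ x, φ x := by
  have := ha.isProbabilityMeasure_particleLaw
  simp_rw [integral_particleField]
  rw [integral_comp_smul_scale hε, integral_averageShift (measurable_smul_displacement ε T) hφ hi]

lemma particleField_nonneg (hε : 0 ≤ ε) (h0 : ∀ x, 0 ≤ φ x) (x : Space d) (w : ParticleSample d) :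
    0 ≤ particleField ε T φ x w :=
  mul_nonneg (pow_nonneg hε d) (h0 _)

lemma particleField_le (hε : 0 ≤ ε) {K : ℝ} (hK : ∀ x, |φ x| ≤ K) (x : Space d)
    (w : ParticleSample d) : particleField ε T φ x w ≤ ε ^ d * K :=
  mul_le_mul_of_nonneg_left ((le_abs_self _).trans (hK _)) (pow_nonneg hε d)

lemma integrable_particleField (ha : IsJumpKernel a) (hφ : Measurable φ) (h0 : ∀ x, 0 ≤ φ x)
    (hε : 0 ≤ ε) {K : ℝ} (hK : ∀ x, |φ x| ≤ K) (x : Space d) :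
    Integrable (particleField ε T φ x) (particleLaw a) := by
  have := ha.isProbabilityMeasure_particleLaw
  refine Integrable.of_bound (measurable_particleField_right hφ x).aestronglyMeasurable (ε ^ d * K)
    (ae_of_all _ fun w => ?_)
  rw [Real.norm_eq_abs, abs_of_nonneg (particleField_nonneg hε h0 x w)]
  exact particleField_le hε hK x w

/-- By Campbell's formula the sum of the particle means is finite for almost every `γ`. For such `γ`
independence turns the inner expectation into the exponential of the summed cumulants. -/
lemma fieldLaplace_eq {μ : Measure (Configuration d)} {ρ : Space d → ℝ} {M K : ℝ} {κ : ℕ} {t : ℝ}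
    (ha : IsJumpKernel a) (hρ : IsFirstCorrelationFunction μ ρ) (hM : ∀ x, ρ x ≤ M)
    (hφ : Continuous φ) (h0 : ∀ x, 0 ≤ φ x) (hi : Integrable φ) (hK : ∀ x, |φ x| ≤ K)
    (hε : 0 < ε) :
    fieldLaplace a μ κ ε t φ =
      ∫ γ, Real.exp (-(linearStatistic (fieldCumulant a ε (t / ε ^ κ) φ) γ).toReal) ∂μ := by
  have := ha.isProbabilityMeasure_particleLaw
  set T := t / ε ^ κ with hT
  set f : Space d → ℝ := fun x => ∫ w, particleField ε T φ x w ∂(particleLaw a) with hf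
  have hfi : Integrable f := integrable_mean_particleField ha hφ.measurable hi hε
  have hf0 : ∀ x, 0 ≤ f x := fun x => integral_nonneg (particleField_nonneg hε.le h0 x)
  have hfm : Measurable f := by
    have h : StronglyMeasurable fun z : Space d × ParticleSample d =>
        particleField ε T φ z.1 z.2 := (measurable_particleField hφ.measurable ε T).stronglyMeasurable
    exact h.integral_prod_right.measurable
  have hfin : ∀ᵐ γ ∂μ, linearStatistic f γ < ⊤ := by
    refine ae_lt_top (measurable_linearStatistic hfm) ?_
    rw [hρ.lintegral_linearStatistic hM hfm hf0 hfi]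
    exact ENNReal.ofReal_ne_top
  refine integral_congr_ae ?_
  filter_upwards [hfin] with γ hγ
  have : Countable γ.1 := γ.countable.to_subtype
  simp_rw [rescaledField_eq hε.le hφ h0]
  rw [configurationLaw, integral_exp_neg_tsum
    (Y := fun (x : γ.1) w => particleField ε T φ x w)
    (fun x => measurable_particleField_right hφ.measurable x)
    (fun x w => particleField_nonneg hε.le h0 x w)
    (fun x => integrable_particleField ha hφ.measurable h0 hε.le hK x) hγ.ne, linearStatistic,
    ENNReal.tsum_toReal_eq fun _ => ENNReal.ofReal_ne_top]
  congr 2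
  refine tsum_congr fun x => ?_
  exact (ENNReal.toReal_ofReal (logLaplace_nonneg
    (measurable_particleField_right hφ.measurable _) (particleField_nonneg hε.le h0 _))).symm

end Field

/-! ### The hydrodynamic limit -/

/-- The quantitative law of large numbers for the rescaled field. -/
lemma abs_fieldLaplace_sub_le {a φ ρ : Space d → ℝ} {k : Space d → Space d → ℝ}
    {μ : Measure (Configuration d)} [IsProbabilityMeasure μ] {ε t M C K : ℝ} {κ : ℕ}
    (ha : IsJumpKernel a) (hρ : IsFirstCorrelationFunction μ ρ)
    (hk : IsSecondCorrelationFunction μ k) (hM : ∀ x, ρ x ≤ M)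
    (hu : ∀ x, Integrable (fun y => ursell ρ k x y) ∧ ∫ y, |ursell ρ k x y| ≤ C)
    (hφ : Continuous φ) (h0 : ∀ x, 0 ≤ φ x) (hi : Integrable φ) (hK : ∀ x, |φ x| ≤ K)
    (hε : 0 < ε) :
    |fieldLaplace a μ κ ε t φ - Real.exp (-∫ y, averageShift (particleLaw a)
        (fun w => ε • displacement w (t / ε ^ κ)) φ y * ρ (ε⁻¹ • y))| ≤
      √((C + M) * (ε ^ d * K) * ∫ x, φ x) + ε ^ d * K * (M * ∫ x, φ x) := by
  have := ha.isProbabilityMeasure_particleLaw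
  set T := t / ε ^ κ with hT
  set f : Space d → ℝ := fun x => ∫ w, particleField ε T φ x w ∂(particleLaw a) with hf
  set h : Space d → ℝ := fieldCumulant a ε T φ with hh
  have hC : 0 ≤ C := (integral_nonneg fun _ => abs_nonneg _).trans (hu 0).2
  have hM0 : 0 ≤ M := (hρ.nonneg 0).trans (hM 0)
  have hK0 : 0 ≤ K := (abs_nonneg _).trans (hK 0)
  have hfi : Integrable f := integrable_mean_particleField ha hφ.measurable hi hε
  have hfI : ∫ x, f x = ∫ x, φ x := integral_mean_particleField ha hφ.measurable hi hε
  have hf0 : ∀ x, 0 ≤ f x := fun x => integral_nonneg (particleField_nonneg hε.le h0 x)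
  have hmx : ∀ x, Measurable (particleField ε T φ x) :=
    measurable_particleField_right hφ.measurable
  have hpi : ∀ x, Integrable (particleField ε T φ x) (particleLaw a) :=
    integrable_particleField ha hφ.measurable h0 hε.le hK
  have hhf : ∀ x, h x ≤ f x := fun x =>
    logLaplace_le (hmx x) (particleField_nonneg hε.le h0 x) (hpi x)
  have hh0 : ∀ x, 0 ≤ h x := fun x =>
    logLaplace_nonneg (hmx x) (particleField_nonneg hε.le h0 x)
  have hfh : ∀ x, (1 - ε ^ d * K) * f x ≤ h x := fun x =>
    le_logLaplace (hmx x) (particleField_nonneg hε.le h0 x) (particleField_le hε.le hK x)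
  have hhm : Measurable h := measurable_fieldCumulant ha hφ.measurable
  have hfK : ∀ x, f x ≤ ε ^ d * K := by
    intro x
    calc f x ≤ ∫ _, ε ^ d * K ∂(particleLaw a) :=
          integral_mono (hpi x) (integrable_const _) (particleField_le hε.le hK x)
      _ = ε ^ d * K := by simp
  have hhi : Integrable h := hfi.mono' hhm.aestronglyMeasurable (ae_of_all _ fun x => by
    rw [Real.norm_eq_abs, abs_of_nonneg (hh0 x)]; exact hhf x)
  have hhI : ∫ x, h x ≤ ∫ x, φ x := hfI ▸ integral_mono hhi hfi hhf
  -- First error: the fluctuations of the initial configuration, with `sup h ≤ ε^d K`.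
  have h1 := abs_laplace_linearStatistic_sub_le hρ hk hM hhm hh0
    (fun x => (hhf x).trans (hfK x)) hhi hu
  have h2 : √((C + M) * (ε ^ d * K) * ∫ x, h x) ≤ √((C + M) * (ε ^ d * K) * ∫ x, φ x) :=
    Real.sqrt_le_sqrt (mul_le_mul_of_nonneg_left hhI (by positivity))
  have hmean : ∫ y, averageShift (particleLaw a) (fun w => ε • displacement w T) φ y *
      ρ (ε⁻¹ • y) = ∫ x, f x * ρ x := by
    rw [← integral_comp_smul_scale hε]
    refine integral_congr_ae (ae_of_all _ fun x => ?_)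
    simp only [hf, integral_particleField, inv_smul_smul₀ hε.ne', mul_assoc]
  -- Second error: replacing the cumulant by the mean, by the two-sided bounds `hhf` and `hfh`.
  have h3 : |(∫ x, h x * ρ x) - ∫ x, f x * ρ x| ≤ ε ^ d * K * (M * ∫ x, φ x) := by
    rw [← integral_sub (hρ.integrable_mul hM hhi) (hρ.integrable_mul hM hfi), ← hfI,
      ← integral_const_mul, ← integral_const_mul, ← Real.norm_eq_abs]
    refine norm_integral_le_of_norm_le ((hfi.const_mul _).const_mul _) (ae_of_all _ fun x => ?_)
    rw [← sub_mul, Real.norm_eq_abs, abs_mul, abs_of_nonneg (hρ.nonneg x)]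
    have e : |h x - f x| ≤ ε ^ d * K * f x := by
      rw [abs_le]
      constructor <;>
        nlinarith [hhf x, hfh x, mul_nonneg (mul_nonneg (pow_pos hε d).le hK0) (hf0 x)]
    calc |h x - f x| * ρ x ≤ (ε ^ d * K * f x) * M :=
          mul_le_mul e (hM x) (hρ.nonneg x)
            (mul_nonneg (mul_nonneg (pow_pos hε d).le hK0) (hf0 x))
      _ = _ := by ring
  have h4 := abs_exp_neg_sub_exp_neg_le
    (integral_nonneg fun x => mul_nonneg (hh0 x) (hρ.nonneg x) : 0 ≤ ∫ x, h x * ρ x)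
    (integral_nonneg fun x => mul_nonneg (hf0 x) (hρ.nonneg x) : 0 ≤ ∫ x, f x * ρ x)
  rw [hmean, fieldLaplace_eq ha hρ hM hφ h0 hi hK hε]
  calc _ ≤ _ := abs_sub_le _ (Real.exp (-∫ x, h x * ρ x)) _
    _ ≤ _ := add_le_add (h1.trans h2) (h4.trans h3)

/-- Convergence of the mean of the rescaled field. -/
lemma tendsto_integral_averageShift_mul {a : ℝ → Space d → ℝ}
    (ha : ∀ᶠ ε in 𝓝[>] 0, IsJumpKernel (a ε))
    {ρ : ℝ → Space d → ℝ} (hρm : ∀ ε, 0 < ε → Measurable (ρ ε)) {M : ℝ}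
    (hM : ∀ ε, 0 < ε → ∀ x, |ρ ε x| ≤ M) {ρ₀ : Space d → ℝ}
    (hρ_lim : ∀ x, Tendsto (fun ε : ℝ => ρ ε (ε⁻¹ • x)) (𝓝[>] 0) (𝓝 (ρ₀ x)))
    {T : ℝ → ℝ} {Z : Space d → Space d} (hZ : Measurable Z) {φ : Space d → ℝ}
    (hφ : Continuous φ) (h0 : ∀ x, 0 ≤ φ x) (hi : Integrable φ)
    (hlim : ∀ y, Tendsto (fun ε : ℝ => averageShift (particleLaw (a ε))
      (fun w => ε • displacement w (T ε)) φ y) (𝓝[>] 0) (𝓝 (averageShift (gauss d) Z φ y))) :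
    Tendsto (fun ε : ℝ => ∫ y, averageShift (particleLaw (a ε))
      (fun w => ε • displacement w (T ε)) φ y * ρ ε (ε⁻¹ • y)) (𝓝[>] 0)
      (𝓝 (∫ y, averageShift (gauss d) Z φ y * ρ₀ y)) := by
  set G := averageShift (gauss d) Z φ with hG
  set F : ℝ → Space d → ℝ := fun ε => averageShift (particleLaw (a ε))
    (fun w => ε • displacement w (T ε)) φ with hF
  have hGi : Integrable G := integrable_averageShift hZ hφ.measurable hi
  have hFi : ∀ᶠ ε in 𝓝[>] 0, Integrable (F ε) ∧ (∀ x, 0 ≤ F ε x) ∧ ∫ x, F ε x = ∫ x, G x := by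
    filter_upwards [ha] with ε hε
    have := hε.isProbabilityMeasure_particleLaw
    have hm := measurable_smul_displacement (d := d) ε (T ε)
    exact ⟨integrable_averageShift hm hφ.measurable hi, averageShift_nonneg h0, by
      rw [hF, hG, integral_averageShift hm hφ.measurable hi,
        integral_averageShift hZ hφ.measurable hi]⟩
  -- No integrable function is available that dominates all `F ε`. Convergence in `L¹` replaces `F
  -- ε` by the fixed `G` uniformly over densities bounded by `M`, after which `G M` dominates.
  have h1 : Tendsto (fun ε => M * ∫ x, |F ε x - G x|) (𝓝[>] 0) (𝓝 (M * 0)) :=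
    (tendsto_integral_abs_sub hGi (averageShift_nonneg h0) hFi hlim).const_mul M
  rw [mul_zero] at h1
  have hm : ∀ ε, 0 < ε → Measurable fun y => ρ ε (ε⁻¹ • y) := fun ε hε =>
    (hρm ε hε).comp (measurable_const_smul _)
  have h2 : Tendsto (fun ε => ∫ y, G y * ρ ε (ε⁻¹ • y)) (𝓝[>] 0) (𝓝 (∫ y, G y * ρ₀ y)) := by
    refine tendsto_integral_filter_of_dominated_convergence (fun y => |G y| * M) ?_ ?_
      (hGi.abs.mul_const M) (ae_of_all _ fun y => (hρ_lim y).const_mul _)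
    · filter_upwards [self_mem_nhdsWithin] with ε hε
      exact hGi.aestronglyMeasurable.mul (hm ε hε).aestronglyMeasurable
    · filter_upwards [self_mem_nhdsWithin] with ε hε
      refine ae_of_all _ fun y => ?_
      rw [norm_mul]
      exact mul_le_mul_of_nonneg_left (hM ε hε _) (norm_nonneg _)
  have h3 : Tendsto (fun ε => (∫ y, F ε y * ρ ε (ε⁻¹ • y)) - ∫ y, G y * ρ ε (ε⁻¹ • y))
      (𝓝[>] 0) (𝓝 0) := by
    refine squeeze_zero_norm' ?_ h1
    filter_upwards [hFi, self_mem_nhdsWithin] with ε hFε hε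
    have hb : ∀ y, |ρ ε (ε⁻¹ • y)| ≤ M := fun y => hM ε hε _
    have i1 : Integrable fun y => F ε y * ρ ε (ε⁻¹ • y) :=
      hFε.1.mul_bdd (c := M) (hm ε hε).aestronglyMeasurable (ae_of_all _ hb)
    have i2 : Integrable fun y => G y * ρ ε (ε⁻¹ • y) :=
      hGi.mul_bdd (c := M) (hm ε hε).aestronglyMeasurable (ae_of_all _ hb)
    have h := abs_integral_mul_le hb (hFε.1.sub hGi)
    rw [← integral_sub i1 i2]
    simpa [mul_sub, mul_comm] using h
  simpa using h3.add h2

/-- The common form of the three regimes: the scaling enters only through the limit of the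
characteristic exponents. Positivity of the dimension makes the error, of order `ε^{d/2}`, vanish.
-/
lemma tendsto_fieldLaplace (hd : 0 < d) {a : ℝ → Space d → ℝ}
    (ha : ∀ᶠ ε in 𝓝[>] 0, IsJumpKernel (a ε)) {μ : ℝ → Measure (Configuration d)}
    (hμ : ∀ ε, 0 < ε → IsProbabilityMeasure (μ ε)) {ρ : ℝ → Space d → ℝ}
    (hρ : ∀ ε, 0 < ε → IsFirstCorrelationFunction (μ ε) (ρ ε))
    {k : ℝ → Space d → Space d → ℝ}
    (hk : ∀ ε, 0 < ε → IsSecondCorrelationFunction (μ ε) (k ε))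
    {M : ℝ} (hM : ∀ ε, 0 < ε → ∀ x, ρ ε x ≤ M) {ρ₀ : Space d → ℝ} (hρ₀ : Measurable ρ₀)
    (hρ_lim : ∀ x, Tendsto (fun ε : ℝ => ρ ε (ε⁻¹ • x)) (𝓝[>] 0) (𝓝 (ρ₀ x)))
    (hρ₀M : ∀ x, |ρ₀ x| ≤ M) {C : ℝ}
    (hu : ∀ ε, 0 < ε → ∀ x, Integrable (fun y => ursell (ρ ε) (k ε) x y) ∧
      ∫ y, |ursell (ρ ε) (k ε) x y| ≤ C)
    {κ : ℕ} {b : Space d} {S : Space d →L[ℝ] Space d} {t : ℝ} (ht : 0 ≤ t)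
    (hlim : ∀ u : Space d, Tendsto (fun ε : ℝ => ((t / ε ^ κ : ℝ) : ℂ) *
        ∫ x, (Complex.exp (-(inner ℝ x (ε • u) * Complex.I)) - 1) * a ε x) (𝓝[>] 0)
      (𝓝 (-(t * (inner ℝ b u * Complex.I)) - t / 2 * ‖S.adjoint u‖ ^ 2)))
    {φ : Space d → ℝ} (hφ : IsTestFunction φ) (h0 : ∀ x, 0 ≤ φ x) :
    Tendsto (fun ε : ℝ => fieldLaplace (a ε) (μ ε) κ ε t φ) (𝓝[>] 0)
      (𝓝 (diracLaplace (limitDensity b S ρ₀ t) φ)) := by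
  obtain ⟨K, -, hK⟩ := hφ.bounded
  have hc := hφ.1.continuous
  have hmean : Tendsto (fun ε : ℝ => ∫ y, averageShift (particleLaw (a ε))
      (fun w => ε • displacement w (t / ε ^ κ)) φ y * ρ ε (ε⁻¹ • y)) (𝓝[>] 0)
      (𝓝 (∫ y, averageShift (gauss d) (limitShift b S t) φ y * ρ₀ y)) := by
    refine tendsto_integral_averageShift_mul (M := M) ha (fun ε hε => (hρ ε hε).measurable)
      (fun ε hε x => ?_) hρ_lim (measurable_limitShift t) hc h0 hφ.integrable fun y => ?_
    · rw [abs_of_nonneg ((hρ ε hε).nonneg x)]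
      exact hM ε hε x
    · refine tendsto_integral_displacement (f := fun z => φ (y + z)) (T := fun ε => t / ε ^ κ)
        ha ?_ b S ht hlim (by fun_prop) fun z => hK _
      filter_upwards [self_mem_nhdsWithin] with ε hε
      exact div_nonneg ht (pow_nonneg (le_of_lt hε) κ)
  have hdual : ∫ y, averageShift (gauss d) (limitShift b S t) φ y * ρ₀ y =
      ∫ x, φ x * limitDensity b S ρ₀ t x := by
    have h := integral_limitDensity_mul (b := b) (S := S) hρ₀ hρ₀M hc.measurable hφ.integrable t
    simp_rw [mul_comm _ (ρ₀ _), mul_comm (φ _)]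
    exact h.symm
  rw [hdual] at hmean
  have hexp := (Real.continuous_exp.tendsto _).comp hmean.neg
  have herr : Tendsto (fun ε : ℝ => √((C + M) * (ε ^ d * K) * ∫ x, φ x) +
      ε ^ d * K * (M * ∫ x, φ x)) (𝓝[>] 0) (𝓝 0) := by
    have hcont : Continuous fun ε : ℝ => √((C + M) * (ε ^ d * K) * ∫ x, φ x) +
        ε ^ d * K * (M * ∫ x, φ x) := by fun_prop
    have h := hcont.tendsto 0
    simp only [zero_pow hd.ne', zero_mul, mul_zero, Real.sqrt_zero, add_zero] at h
    exact h.mono_left nhdsWithin_le_nhds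
  have hdiff : Tendsto (fun ε : ℝ => fieldLaplace (a ε) (μ ε) κ ε t φ -
      Real.exp (-∫ y, averageShift (particleLaw (a ε))
        (fun w => ε • displacement w (t / ε ^ κ)) φ y * ρ ε (ε⁻¹ • y))) (𝓝[>] 0) (𝓝 0) := by
    refine squeeze_zero_norm' ?_ herr
    filter_upwards [ha, self_mem_nhdsWithin] with ε haε hε
    have := hμ ε hε
    exact abs_fieldLaplace_sub_le haε (hρ ε hε) (hk ε hε) (hM ε hε) (hu ε hε) hc h0
      hφ.integrable hK hε
  have := hdiff.add hexp
  rw [zero_add] at this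
  refine this.congr fun ε => ?_
  simp

lemma measurable_limit_density {ρ : ℝ → Space d → ℝ} (hρ : ∀ ε, 0 < ε → Measurable (ρ ε))
    {ρ₀ : Space d → ℝ}
    (hρ_lim : ∀ x, Tendsto (fun ε : ℝ => ρ ε (ε⁻¹ • x)) (𝓝[>] 0) (𝓝 (ρ₀ x))) :
    Measurable ρ₀ := by
  have he : Tendsto (fun n : ℕ => 1 / ((n : ℝ) + 1)) atTop (𝓝[>] 0) :=
    tendsto_nhdsWithin_iff.2 ⟨tendsto_one_div_add_atTop_nhds_zero_nat,
      Eventually.of_forall fun n => mem_Ioi.2 Nat.one_div_pos_of_nat⟩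
  refine measurable_of_tendsto_metrizable
    (f := fun (n : ℕ) x => ρ (1 / ((n : ℝ) + 1)) ((1 / ((n : ℝ) + 1))⁻¹ • x)) (fun n => ?_)
    (tendsto_pi_nhds.2 fun x => (hρ_lim x).comp he)
  exact (hρ _ Nat.one_div_pos_of_nat).comp (measurable_const_smul _)

lemma isRootOf_zero : IsRootOf (0 : Space d →L[ℝ] Space d) 0 := fun i j => by simp

end FreeKawasaki

/-! ### The three scaling regimes. -/

theorem mainTheorem1 {d : ℕ} (hd : 0 < d)
    (a : Space d → ℝ) (ha_nonneg : ∀ x, 0 ≤ a x) (ha_int : Integrable a)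
    (ha_pos : 0 < totalRate a)
    (ha_moments : ∀ n : ℕ, Integrable fun x => ‖x‖ ^ n * a x)
    (μ : ℝ → Measure (Configuration d))
    (hμ : ∀ ε, 0 < ε → IsProbabilityMeasure (μ ε))
    (hμ_tempered : ∀ ε, 0 < ε → ∀ᵐ γ ∂(μ ε), γ ∈ Tempered d)
    (ρ : ℝ → Space d → ℝ)
    (hρ : ∀ ε, 0 < ε → IsFirstCorrelationFunction (μ ε) (ρ ε))
    (k : ℝ → Space d → Space d → ℝ)
    (hk : ∀ ε, 0 < ε → IsSecondCorrelationFunction (μ ε) (k ε))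
    (hρ_bdd : ∃ M : ℝ, ∀ ε, 0 < ε → ∀ x, ρ ε x ≤ M)
    (ρ₀ : Space d → ℝ)
    (hρ_lim : ∀ x, Tendsto (fun ε : ℝ => ρ ε (ε⁻¹ • x)) (𝓝[>] 0) (𝓝 (ρ₀ x)))
    (h_mixing : ∃ C : ℝ, ∀ ε, 0 < ε → ∀ x,
      Integrable (fun y => ursell (ρ ε) (k ε) x y) ∧
        ∫ y, |ursell (ρ ε) (k ε) x y| ≤ C) :
    (firstMoment a ≠ 0 →
      ∃ r : ℝ → Space d → ℝ,
        IsUniqueBoundedWeakSolution (firstMoment a) 0 ρ₀ r ∧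
        (ContDiff ℝ 1 ρ₀ → IsStrongSolution 1 (firstMoment a) 0 ρ₀ r) ∧
        ∀ t, 0 ≤ t → ∀ φ, IsTestFunction φ → (∀ x, 0 ≤ φ x) →
          Tendsto (fun ε : ℝ => fieldLaplace a (μ ε) 1 ε t φ) (𝓝[>] 0)
            (𝓝 (diracLaplace (r t) φ))) ∧
    (firstMoment a = 0 →
      ∃ r : ℝ → Space d → ℝ,
        IsUniqueBoundedWeakSolution 0 (secondMoment a) ρ₀ r ∧
        IsStrongSolution 2 0 (secondMoment a) ρ₀ r ∧
        ∀ t, 0 ≤ t → ∀ φ, IsTestFunction φ → (∀ x, 0 ≤ φ x) →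
          Tendsto (fun ε : ℝ => fieldLaplace a (μ ε) 2 ε t φ) (𝓝[>] 0)
            (𝓝 (diracLaplace (r t) φ))) ∧
    (firstMoment (oddPart a) ≠ 0 →
      ∃ r : ℝ → Space d → ℝ,
        IsUniqueBoundedWeakSolution (firstMoment a) (secondMoment a) ρ₀ r ∧
        IsStrongSolution 2 (firstMoment a) (secondMoment a) ρ₀ r ∧
        ∀ t, 0 ≤ t → ∀ φ, IsTestFunction φ → (∀ x, 0 ≤ φ x) →
          Tendsto (fun ε : ℝ => fieldLaplace (weaklyAsymmetric a ε) (μ ε) 2 ε t φ) (𝓝[>] 0)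
            (𝓝 (diracLaplace (r t) φ))) := by
  obtain ⟨M, hM⟩ := hρ_bdd
  obtain ⟨C, hC⟩ := h_mixing
  have ha : IsJumpKernel a := ⟨ha_nonneg, ha_int, ha_pos⟩
  have hm : HasMoments a := ⟨ha_int.aestronglyMeasurable, ha_moments⟩
  have hρ₀ : Measurable ρ₀ := measurable_limit_density (fun ε hε => (hρ ε hε).measurable) hρ_lim
  have hρ₀M : ∀ x, |ρ₀ x| ≤ M := by
    intro x
    refine le_of_tendsto (hρ_lim x).abs ?_
    filter_upwards [self_mem_nhdsWithin] with ε hε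
    rw [abs_of_nonneg ((hρ ε hε).nonneg _)]
    exact hM ε hε _
  have hae : ∀ᶠ _ in 𝓝[>] (0 : ℝ), IsJumpKernel a := Eventually.of_forall fun _ => ha
  obtain ⟨S, hS⟩ := exists_isRootOf (posDef_secondMoment ha hm)
  -- Drift and root are `(a⁽¹⁾, 0)`, `(0, S)` and `(a⁽¹⁾, S)`; the same `S` serves the last case
  -- since the even part has the second moments of `a`.
  refine ⟨fun _ => ⟨limitDensity (firstMoment a) 0 ρ₀, ?_, ?_, ?_⟩,
    fun h => ⟨limitDensity 0 (S : Space d →L[ℝ] Space d) ρ₀, ?_, ?_, ?_⟩,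
    fun _ => ⟨limitDensity (firstMoment a) (S : Space d →L[ℝ] Space d) ρ₀, ?_, ?_, ?_⟩⟩
  · exact isUniqueBoundedWeakSolution_limitDensity isRootOf_zero hρ₀ hρ₀M
  · exact fun h => isStrongSolution_transport h hρ₀M
  · exact fun t ht φ hφ h0 => tendsto_fieldLaplace hd hae hμ hρ hk hM hρ₀ hρ_lim hρ₀M hC ht
      (tendsto_exponent_transport hm t) hφ h0
  · exact isUniqueBoundedWeakSolution_limitDensity hS hρ₀ hρ₀M
  · exact isStrongSolution_limitDensity hS hρ₀ hρ₀M
  · exact fun t ht φ hφ h0 => tendsto_fieldLaplace hd hae hμ hρ hk hM hρ₀ hρ_lim hρ₀M hC ht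
      (tendsto_exponent_diffusion hm h hS t) hφ h0
  · exact isUniqueBoundedWeakSolution_limitDensity hS hρ₀ hρ₀M
  · exact isStrongSolution_limitDensity hS hρ₀ hρ₀M
  · refine fun t ht φ hφ h0 => tendsto_fieldLaplace hd ?_ hμ hρ hk hM hρ₀ hρ_lim hρ₀M hC ht
      (tendsto_exponent_weaklyAsymmetric hm hS t) hφ h0
    -- The weakly asymmetric kernel is non-negative for `ε ≤ 1`, which is enough for the limit at
    -- zero.
    filter_upwards [Ioc_mem_nhdsGT (zero_lt_one' ℝ)] with ε hε
    exact ha.weaklyAsymmetric hm hε.1.le hε.2
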